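/- **Meyer basis.** Let $\theta:\mathbb R\to\mathbb R$ be an even $C^1$ function (in particular any $C^\infty$ one) with $\theta(\omega)=1$ for $|\omega|\le 2\pi/3$, $\theta(\omega)=0$ for $|\omega|\ge 4\pi/3$ and $\theta(\omega)^2+\theta(2\pi-\omega)^2=1$ for $2\pi/3\le\omega\le4\pi/3$. Let $\phi^*,\psi^*$ be the Meyer scaling function and wavelet, with Fourier transforms (convention $\int u(x)e^{-i\omega x}dx$) $\theta(\omega)$ and $e^{-i\omega/2}\,[\theta(\omega+2\pi)+\theta(\omega-2\pi)]\,\theta(\omega/2)$, and let $$\phi_{j,k}(x)=2^{j/2}\sum_{i\in\mathbb Z}\phi^*(2^j(x+i)-k),\qquad \psi_{j,k}(x)=2^{j/2}\sum_{i\in\mathbb Z}\psi^*(2^j(x+i)-k),\qquad 0\le k<2^j,$$ be the periodized Meyer basis of $L^2([0,1])$. For $f\in L^2([0,1])$ put $c_{j,k}=\int_0^1 f\phi_{j,k}$ and $\beta_{j,k}=\int_0^1 f\psi_{j,k}$. **Besov densities.** Fix $J\in\mathbb N$, $A>0$, $1\le p\le2$, $1\le q\le2$, $p'=\min(2,p)$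 and $s>\frac12+\frac1{p'}$. Let $D^s_{p,q}(A)$ be the set of $f\in L^2([0,1])$ with $f\ge0$, $\int_0^1f=1$ and $$\Big(\sum_{k=0}^{2^{J}-1}|c_{J,k}|^p\Big)^{1/p}+\Big(\sum_{j\ge J}2^{j(s+1/2-1/p)q}\Big(\sum_{k=0}^{2^j-1}|\beta_{j,k}|^p\Big)^{q/p}\Big)^{1/q}\le A .$$ **Estimator.** Let $X_1,\dots,X_n$ be i.i.d. with density $f$ on $[0,1]$. Write $g_\ell=\int_0^1g(u)e^{-2\pi i\ell u}du$ for $\ell\in\mathbb Z$, abbreviate $\psi^{j,k}_\ell=(\psi_{j,k})_\ell$ and $\phi^{j,k}_\ell=(\phi_{j,k})_\ell$, and set $$\hat\beta_{j,k}=\sum_{\ell}\overline{\psi^{j,k}_\ell}\,\frac1n\sum_{m=1}^ne^{-2\pi i\ell X_m},\qquad \hat c_{j,k}=\sum_{\ell}\overline{\phi^{j,k}_\ell}\,\frac1n\sum_{m=1}^ne^{-2\pi i\ell X_m},$$ $$\hat V_{j,k}=\frac1{n^2}\sum_{m=1}^n\Big|\sum_\ell\overline{\psi^{j,k}_\ell}e^{-2\pi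 i\ell X_m}\Big|^2,\qquad \eta_j=\sum_\ell|\psi^{j,k}_\ell|,\qquad \kappa=\tfrac43+\sqrt{\tfrac53}$$ (finite sums, over the $\ell$ whose coefficient is nonzero). For $\delta>0$ define the random thresholds $$\tau_{j,k}=\sqrt{2\delta\log n\Big(\hat V_{j,k}+\sqrt{2\delta\log n\,\hat V_{j,k}\tfrac{\eta_j^2}{n^2}}+\delta\kappa\log n\,\tfrac{\eta_j^2}{n^2}\Big)}+\frac{\delta\log n}{3n}\eta_j .$$ For $n\ge e$ let $j_0=j_0(n)$ and $j_1=j_1(n)$ be the integers with $2^{j_0}>\log n\ge2^{j_0-1}$ and $2^{j_1}>n^{1/2}\ge2^{j_1-1}$, and let $$\hat f_n=\sum_{k=0}^{2^{j_0}-1}\hat c_{j_0,k}\phi_{j_0,k}+\sum_{j=j_0}^{j_1}\sum_{k=0}^{2^j-1}\hat\beta_{j,k}\mathbf 1_{\{|\hat\beta_{j,k}|\ge\tau_{j,k}\}}\psi_{j,k}.$$ **Theorem.** Let $\delta>1/2$. Then there is a constant $C>0$, independent of $n$ and $f$, such that for all sufficiently large $n$ $$\sup_{f\in D^s_{p,q}(A)}\mathbb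 E\int_0^1|\hat f_n(x)-f(x)|^2\,dx\;\le\;C\Big(\frac n{\log n}\Big)^{-\frac{2s}{2s+1}} .$$ -/

import Mathlib

open MeasureTheory Filter
open scoped ENNReal ComplexConjugate

noncomputable section

namespace MeyerDensity

/-! ### Meyer scaling function and wavelet -/

/-- Admissible Fourier transforms `θ` of the Meyer scaling function. In terms of the low-pass filter
`h` one has `θ ω = h (ω / 2) / √2` for `|ω| ≤ 4π/3` and `θ ω = 0` beyond. The `C^∞` windows are
included, and so are the usual piecewise polynomial choices, which are only finitely smooth. -/
structure IsMeyerWindow (θ : ℝ → ℝ) : Prop where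
  smooth : ContDiff ℝ 1 θ
  even : ∀ ω, θ (-ω) = θ ω
  eq_one : ∀ ω, |ω| ≤ 2 * Real.pi / 3 → θ ω = 1
  eq_zero : ∀ ω, 4 * Real.pi / 3 ≤ |ω| → θ ω = 0
  quadrature : ∀ ω, 2 * Real.pi / 3 ≤ ω → ω ≤ 4 * Real.pi / 3 →
    θ ω ^ 2 + θ (2 * Real.pi - ω) ^ 2 = 1

/-- Fourier transform of the Meyer wavelet,
`exp (-iω/2) * m (ω/2 + π) * θ (ω/2)`, where `m (ω/2) = ∑ l, θ (ω + 4πl)` is the `2π`-periodic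
low-pass filter. On the support of `θ (ω/2)` only the two shifts below are nonzero. -/
def waveletFT (θ : ℝ → ℝ) (ω : ℝ) : ℂ :=
  Complex.exp (-(Complex.I * (ω / 2 : ℝ))) *
    (((θ (ω + 2 * Real.pi) + θ (ω - 2 * Real.pi)) * θ (ω / 2) : ℝ) : ℂ)

/-- The real line function with Fourier transform `g` (convention `∫ u x * exp (-iωx) dx = g ω`).
For the two transforms used below the inverse transform is real-valued, as `g (-ω) = conj (g ω)`;
the real part only serves to have a real-valued function. -/
def inverseFT (g : ℝ → ℂ) (x : ℝ) : ℝ :=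
  ((1 / (2 * Real.pi) : ℝ) * ∫ ω : ℝ, g ω * Complex.exp (Complex.I * (ω * x : ℝ)) : ℂ).re

/-- The Meyer scaling function on the line. -/
def scalingLine (θ : ℝ → ℝ) : ℝ → ℝ := inverseFT (fun ω => (θ ω : ℂ))

/-- The Meyer wavelet on the line. -/
def waveletLine (θ : ℝ → ℝ) : ℝ → ℝ := inverseFT (waveletFT θ)

/-- `x ↦ 2^(j/2) * ∑ i, u (2^j (x + i) - k)`. -/
def periodize (u : ℝ → ℝ) (j k : ℕ) (x : ℝ) : ℝ :=
  (2 : ℝ) ^ ((j : ℝ) / 2) * ∑' i : ℤ, u ((2 : ℝ) ^ j * (x + i) - k)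

/-- Periodized scaling function `φ_{j,k}`. -/
def phi (θ : ℝ → ℝ) (j k : ℕ) : ℝ → ℝ := periodize (scalingLine θ) j k

/-- Periodized wavelet `ψ_{j,k}`. -/
def psi (θ : ℝ → ℝ) (j k : ℕ) : ℝ → ℝ := periodize (waveletLine θ) j k

/-! ### Densities and Besov balls on `[0,1]` -/

/-- Lebesgue measure on `[0,1]`. -/
def unitVolume : Measure ℝ := volume.restrict (Set.Icc 0 1)

/-- `⟨f, g⟩ = ∫₀¹ f g`. -/
def coeff (f g : ℝ → ℝ) : ℝ := ∫ x, f x * g x ∂unitVolume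

/-- The class `D²([0,1])` of square-integrable densities on `[0,1]` (functions are considered on
`[0,1]` only, up to null sets). -/
def densityClass : Set (ℝ → ℝ) :=
  {f | MemLp f 2 unitVolume ∧ (∀ᵐ x ∂unitVolume, 0 ≤ f x) ∧ ∫ x, f x ∂unitVolume = 1}

/-- The Besov norm with (finite) parameters `s, p, q`, in terms of the Meyer wavelet coefficients
with coarsest level `J`; it is `∞` when the series diverges. -/
def besovNorm (θ : ℝ → ℝ) (J : ℕ) (s p q : ℝ) (f : ℝ → ℝ) : ℝ≥0∞ :=
  (∑ k ∈ Finset.range (2 ^ J), ENNReal.ofReal |coeff f (phi θ J k)| ^ p) ^ (1 / p) +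
  (∑' i : ℕ, ENNReal.ofReal ((2 : ℝ) ^ (((J + i : ℕ) : ℝ) * (s + 1 / 2 - 1 / p) * q)) *
    (∑ k ∈ Finset.range (2 ^ (J + i)),
      ENNReal.ofReal |coeff f (psi θ (J + i) k)| ^ p) ^ (q / p)) ^ (1 / q)

/-- The Besov ball `B^s_{p,q}(A)`. -/
def besovBall (θ : ℝ → ℝ) (J : ℕ) (s p q A : ℝ) : Set (ℝ → ℝ) :=
  {f | MemLp f 2 unitVolume ∧ besovNorm θ J s p q f ≤ ENNReal.ofReal A}

/-- The densities in the Besov ball, `D^s_{p,q}(A)`. -/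
def besovDensities (θ : ℝ → ℝ) (J : ℕ) (s p q A : ℝ) : Set (ℝ → ℝ) :=
  densityClass ∩ besovBall θ J s p q A

/-! ### Empirical coefficients, random thresholds and the estimator

Below `g` is one of the functions `φ_{j,k}`, `ψ_{j,k}`, and `X` is the sample. -/

/-- Fourier coefficient `g_ℓ = ∫₀¹ g(u) exp (-2πiℓu) du`. -/
def fourierCoef (g : ℝ → ℝ) (l : ℤ) : ℂ :=
  ∫ u, (g u : ℂ) * Complex.exp (-(2 * Real.pi * Complex.I * l * u)) ∂unitVolume

/-- The (finite) set of active frequencies of `g`. -/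
def freqs (g : ℝ → ℝ) : Set ℤ := {l | fourierCoef g l ≠ 0}

/-- Empirical Fourier coefficient `(1/n) * ∑ m, exp (-2πiℓ X_m)`. -/
def empFourier {n : ℕ} (X : Fin n → ℝ) (l : ℤ) : ℂ :=
  (1 / n : ℂ) * ∑ m, Complex.exp (-(2 * Real.pi * Complex.I * l * X m))

/-- Empirical coefficient `∑_{ℓ} conj(g_ℓ) * (1/n) ∑_m exp (-2πiℓ X_m)`, the unbiased estimator of
`⟨f, g⟩ = ∑_ℓ conj(g_ℓ) f_ℓ`. The sum is real because `g` is. -/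
def empCoeff {n : ℕ} (g : ℝ → ℝ) (X : Fin n → ℝ) : ℝ :=
  (∑ᶠ l ∈ freqs g, conj (fourierCoef g l) * empFourier X l).re

/-- `V̂ = n⁻² ∑_m |∑_ℓ conj(g_ℓ) exp (-2πiℓ X_m)|²`. -/
def empVar {n : ℕ} (g : ℝ → ℝ) (X : Fin n → ℝ) : ℝ :=
  1 / (n : ℝ) ^ 2 * ∑ m, ‖∑ᶠ l ∈ freqs g,
    conj (fourierCoef g l) * Complex.exp (-(2 * Real.pi * Complex.I * l * X m))‖ ^ 2

/-- `∑_ℓ |g_ℓ|`, which for `g = ψ_{j,k}` is the number `η_j`. -/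
def etaSum (g : ℝ → ℝ) : ℝ := ∑ᶠ l ∈ freqs g, ‖fourierCoef g l‖

def kappa : ℝ := 4 / 3 + Real.sqrt (5 / 3)

/-- The random threshold `τ_{j,k}` (for `g = ψ_{j,k}`). -/
def threshold {n : ℕ} (δ : ℝ) (g : ℝ → ℝ) (X : Fin n → ℝ) : ℝ :=
  Real.sqrt (2 * δ * Real.log n *
    (empVar g X
      + Real.sqrt (2 * δ * Real.log n * empVar g X * (etaSum g ^ 2 / (n : ℝ) ^ 2))
      + δ * Real.log n * kappa * (etaSum g ^ 2 / (n : ℝ) ^ 2)))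
  + δ * Real.log n / (3 * n) * etaSum g

open Classical in
/-- The hard-thresholding estimator `f̂_n` with levels `j₀, j₁`. -/
def estimator {n : ℕ} (θ : ℝ → ℝ) (δ : ℝ) (j₀ j₁ : ℕ) (X : Fin n → ℝ) (x : ℝ) : ℝ :=
  ∑ k ∈ Finset.range (2 ^ j₀), empCoeff (phi θ j₀ k) X * phi θ j₀ k x +
  ∑ j ∈ Finset.Icc j₀ j₁, ∑ k ∈ Finset.range (2 ^ j),
    if threshold δ (psi θ j k) X ≤ |empCoeff (psi θ j k) X| then
      empCoeff (psi θ j k) X * psi θ j k x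
    else 0

/-- The integer `j` with `2^j > log n ≥ 2^(j-1)`. -/
def IsCoarseLevel (n j : ℕ) : Prop :=
  Real.log n < (2 : ℝ) ^ j ∧ (2 : ℝ) ^ ((j : ℤ) - 1) ≤ Real.log n

/-- The integer `j` with `2^j > n^η (log n)^α ≥ 2^(j-1)`. -/
def IsFineLevel (η α : ℝ) (n j : ℕ) : Prop :=
  (n : ℝ) ^ η * Real.log n ^ α < (2 : ℝ) ^ j ∧
    (2 : ℝ) ^ ((j : ℤ) - 1) ≤ (n : ℝ) ^ η * Real.log n ^ α

/-- The law on `ℝ` with density `f` on `[0,1]`. -/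
def densityLaw (f : ℝ → ℝ) : Measure ℝ :=
  unitVolume.withDensity (fun x => ENNReal.ofReal (f x))

/-- The quadratic risk `E ‖f̂_n - f‖²` in `L²([0,1])` when `X₁, …, X_n` are i.i.d. with density `f`,
as an element of `[0, ∞]`. -/
def risk (θ : ℝ → ℝ) (δ : ℝ) (n j₀ j₁ : ℕ) (f : ℝ → ℝ) : ℝ≥0∞ :=
  ∫⁻ X : Fin n → ℝ, (∫⁻ x, ENNReal.ofReal ((estimator θ δ j₀ j₁ X x - f x) ^ 2) ∂unitVolume)
    ∂(Measure.pi fun _ : Fin n => densityLaw f)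

end MeyerDensity

end

/-!
Up to a constant, hard thresholding pays at most `min (β², τ²)` for each wavelet coefficient, and
over a Besov ball with `p ≤ 2` the sum of these minima, with `τ²` of the order of `log n / n`, is of
the order of `(log n / n) ^ (2s / (2s + 1))`.

*The periodized Meyer system.* By Poisson summation, which needs only one derivative of `θ`, the
functions `φ_{j,k}` and `ψ_{j,k}` are real trigonometric polynomials (`IsBandWindow.isTrigPoly`).
Hence empirical coefficients are empirical means, and the energy of the coefficients of one level is
a double sum over pairs of frequencies that agree modulo `2^j` (`levelEnergy_eq`). In this form the
two-scale relation is an identity between summands (`IsMeyerWindow.levelEnergy_succ`), and it gives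
Bessel's inequality (`levelEnergy_le`) and completeness (`sum_low_le_levelEnergy`). Orthonormality
is not used: the synthesis operator of a family with Bessel's inequality is a contraction, and this
bounds the `L²` error of a wavelet series by the squared errors of its coefficients plus the energy
of the missing levels (`integral_sq_wavelet_series_sub_le`).

*Uniform second moments.* On the Besov ball the Fourier coefficients of `f` are absolutely summable
with a uniform bound `M`, by the Cauchy-Schwarz inequality on dyadic blocks of frequencies
(`exists_sum_norm_fourierCoef_le`). Therefore `∫ f u²` is at most `M` times the energy of `u`, for
each trigonometric polynomial `u`, and each empirical coefficient has variance of order `1 / n`.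

*Thresholds.* Bernstein's inequality with the raw second moment, and the sub-Gaussian lower tail of
the empirical second moment, show that the error of an empirical coefficient exceeds the random
threshold with probability at most `3 n^(-δ)` (`IsTrigPoly.measure_threshold_lt`). As `δ > 1/2`, one
can pick `a < 1` with `a² δ = 1/2`; errors beyond `a` times the threshold then still have
probability of order `n^(-1/2)`. Off this rare event, thresholding loses at most a multiple of
`min (β², τ²)`; on it, at most a multiple of the squared error of the empirical coefficient
(`sq_hardThreshold_sub_le`), which is of order `log n / n` except with probability `2 n^(-4)`. So
the rare events of the at most `4 √n` coefficients cost `O(log n / n)` in total (`sum_loss_bound_le`).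

*Rates.* The oracle sum is controlled level by level, by `2^j T` below the level with
`2^j = T^(-1/(2s+1))` and by the Besov norm above it (`sum_min_sq_le`). The coarse part has
`2^{j₀} ≤ 2 log n` coefficients of variance `O(1 / n)`, and the levels beyond `j₁` have energy
`O(2^(-2 j₁ (s + 1/2 - 1/p))) = O(1 / n)`, because `s + 1/2 - 1/p > 1`.
-/

noncomputable section

namespace MeyerDensity

/-! ### The low-pass filter -/

section LowPass

/-- The `4π`-periodic function that agrees with `θ` on `[-2π, 2π]`. It is the Meyer low-pass filter,
written in the variable in which `θ ω = lowPass θ ω * θ (ω / 2)`. -/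
def lowPass (θ : ℝ → ℝ) (ω : ℝ) : ℝ := θ (ω - 4 * Real.pi * round (ω / (4 * Real.pi)))

variable {θ : ℝ → ℝ}

lemma IsMeyerWindow.eq_zero_of_le (hθ : IsMeyerWindow θ) {ω : ℝ} (h : 4 * Real.pi / 3 ≤ ω) :
    θ ω = 0 := hθ.eq_zero ω (h.trans (le_abs_self ω))

lemma IsMeyerWindow.eq_zero_of_le_neg (hθ : IsMeyerWindow θ) {ω : ℝ}
    (h : 4 * Real.pi / 3 ≤ -ω) : θ ω = 0 := hθ.eq_zero ω (h.trans (neg_le_abs ω))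

lemma IsMeyerWindow.sq_add_sq (hθ : IsMeyerWindow θ) {u : ℝ} (h0 : 0 ≤ u)
    (h1 : u ≤ 2 * Real.pi) : θ u ^ 2 + θ (2 * Real.pi - u) ^ 2 = 1 := by
  have hpi := Real.pi_pos
  rcases le_total u (2 * Real.pi / 3) with h | h
  · rw [hθ.eq_one u (by rw [abs_of_nonneg h0]; exact h), hθ.eq_zero_of_le (by linarith)]; norm_num
  rcases le_total u (4 * Real.pi / 3) with h' | h'
  · exact hθ.quadrature u h h'
  · rw [hθ.eq_zero_of_le h', hθ.eq_one _ (by rw [abs_of_nonneg (by linarith)]; linarith)]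
    norm_num

lemma IsMeyerWindow.abs_le_one (hθ : IsMeyerWindow θ) (ω : ℝ) : |θ ω| ≤ 1 := by
  have key : ∀ u, 0 ≤ u → |θ u| ≤ 1 := by
    intro u hu
    have hpi := Real.pi_pos
    rcases le_total u (2 * Real.pi) with h | h
    · have := hθ.sq_add_sq hu h
      exact abs_le_one_iff_mul_self_le_one.2 (by nlinarith [sq_nonneg (θ (2 * Real.pi - u))])
    · rw [hθ.eq_zero_of_le (by linarith)]; norm_num
  rcases le_total 0 ω with h | h
  · exact key ω h
  · rw [← hθ.even]; exact key _ (by linarith)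

lemma lowPass_add (θ : ℝ → ℝ) (ω : ℝ) (t : ℤ) :
    lowPass θ (ω + 4 * Real.pi * t) = lowPass θ ω := by
  have hpi := Real.pi_ne_zero
  have : (ω + 4 * Real.pi * t) / (4 * Real.pi) = ω / (4 * Real.pi) + t := by field_simp
  unfold lowPass
  rw [this, round_add_intCast]
  congr 1; push_cast; ring

lemma IsMeyerWindow.lowPass_eq (hθ : IsMeyerWindow θ) {ω : ℝ} (h : |ω| ≤ 2 * Real.pi) :
    lowPass θ ω = θ ω := by
  have hpi := Real.pi_pos
  unfold lowPass
  by_cases hr : round (ω / (4 * Real.pi)) = 0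
  · simp [hr]
  have h1 : (1 : ℝ) ≤ |(round (ω / (4 * Real.pi)) : ℝ)| := by
    exact_mod_cast Int.one_le_abs hr
  have h2 : 4 * Real.pi ≤ |4 * Real.pi * (round (ω / (4 * Real.pi)) : ℝ)| := by
    rw [abs_mul, abs_of_pos (by positivity : 0 < 4 * Real.pi)]; nlinarith
  have h3 := abs_sub_abs_le_abs_sub (4 * Real.pi * (round (ω / (4 * Real.pi)) : ℝ)) ω
  rw [abs_sub_comm] at h3
  have h4 := abs_sub_round (ω / (4 * Real.pi))
  have h5 : |ω - 4 * Real.pi * (round (ω / (4 * Real.pi)) : ℝ)| ≤ 2 * Real.pi := by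
    have : ω - 4 * Real.pi * (round (ω / (4 * Real.pi)) : ℝ)
        = 4 * Real.pi * (ω / (4 * Real.pi) - round (ω / (4 * Real.pi))) := by field_simp
    rw [this, abs_mul, abs_of_pos (by positivity : 0 < 4 * Real.pi)]; nlinarith
  rw [hθ.eq_zero _ (by linarith), hθ.eq_zero ω (by linarith)]

/-- The quadrature mirror condition, which makes the system a tight frame. -/
lemma IsMeyerWindow.lowPass_sq (hθ : IsMeyerWindow θ) (ω : ℝ) :
    lowPass θ ω ^ 2 + lowPass θ (ω + 2 * Real.pi) ^ 2 = 1 := by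
  have hpi := Real.pi_pos
  have key : ∀ v : ℝ, |v| ≤ 2 * Real.pi →
      lowPass θ v ^ 2 + lowPass θ (v + 2 * Real.pi) ^ 2 = 1 := by
    intro v hv
    rw [hθ.lowPass_eq hv]
    obtain ⟨h1, h2⟩ := abs_le.1 hv
    rcases le_total v 0 with h | h
    · rw [hθ.lowPass_eq (abs_le.2 ⟨by linarith, by linarith⟩), ← hθ.even v,
        ← hθ.sq_add_sq (u := -v) (by linarith) (by linarith)]
      congr 3; ring
    · have := lowPass_add θ (v - 2 * Real.pi) 1
      rw [show v - 2 * Real.pi + 4 * Real.pi * (1 : ℤ) = v + 2 * Real.pi by push_cast; ring] at this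
      rw [this, hθ.lowPass_eq (abs_le.2 ⟨by linarith, by linarith⟩), ← hθ.even (v - 2 * Real.pi),
        ← hθ.sq_add_sq (u := v) (by linarith) (by linarith)]
      congr 3; ring
  have h4 := abs_sub_round (ω / (4 * Real.pi))
  set r := round (ω / (4 * Real.pi))
  have h5 : |ω - 4 * Real.pi * (r : ℝ)| ≤ 2 * Real.pi := by
    have : ω - 4 * Real.pi * (r : ℝ) = 4 * Real.pi * (ω / (4 * Real.pi) - r) := by field_simp
    rw [this, abs_mul, abs_of_pos (by positivity : 0 < 4 * Real.pi)]; nlinarith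
  have h6 := key _ h5
  rw [← lowPass_add θ _ r, ← lowPass_add θ (ω - 4 * Real.pi * (r : ℝ) + 2 * Real.pi) r] at h6
  rw [← h6]; congr 3 <;> ring

lemma IsMeyerWindow.lowPass_mul (hθ : IsMeyerWindow θ) (ω : ℝ) :
    lowPass θ ω * θ (ω / 2) = θ ω := by
  have hpi := Real.pi_pos
  rcases le_total (|ω|) (4 * Real.pi / 3) with h | h
  · rw [hθ.lowPass_eq (by linarith), hθ.eq_one (ω / 2), mul_one]
    rw [abs_div, abs_of_pos (by norm_num : (0:ℝ) < 2)]; linarith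
  rw [hθ.eq_zero ω h]
  rcases le_total (8 * Real.pi / 3) (|ω|) with h1 | h1
  · rw [hθ.eq_zero (ω / 2), mul_zero]
    rw [abs_div, abs_of_pos (by norm_num : (0:ℝ) < 2)]; linarith
  suffices lowPass θ ω = 0 by rw [this, zero_mul]
  rcases le_total (|ω|) (2 * Real.pi) with h2 | h2
  · rw [hθ.lowPass_eq h2, hθ.eq_zero ω h]
  rcases abs_cases ω with ⟨h3, h4⟩ | ⟨h3, h4⟩ <;> rw [h3] at h h1 h2
  · rw [← lowPass_add θ ω (-1), hθ.lowPass_eq (by rw [abs_le]; push_cast; constructor <;> linarith),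
      hθ.eq_zero_of_le_neg (by push_cast; linarith)]
  · rw [← lowPass_add θ ω 1, hθ.lowPass_eq (by rw [abs_le]; push_cast; constructor <;> linarith),
      hθ.eq_zero_of_le (by push_cast; linarith)]

/-- The modulus of the Fourier transform of the wavelet is the shifted filter times the dilated
window. -/
lemma IsMeyerWindow.lowPass_shift_mul (hθ : IsMeyerWindow θ) (ω : ℝ) :
    (θ (ω + 2 * Real.pi) + θ (ω - 2 * Real.pi)) * θ (ω / 2)
      = lowPass θ (ω + 2 * Real.pi) * θ (ω / 2) := by
  have hpi := Real.pi_pos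
  rcases le_total (8 * Real.pi / 3) (|ω|) with h1 | h1
  · rw [hθ.eq_zero (ω / 2), mul_zero, mul_zero]
    rw [abs_div, abs_of_pos (by norm_num : (0:ℝ) < 2)]; linarith
  congr 1
  obtain ⟨h1, h2⟩ := abs_le.1 h1
  rcases le_total 0 ω with h | h
  · rw [hθ.eq_zero_of_le (ω := ω + 2 * Real.pi) (by linarith), zero_add,
      ← lowPass_add θ (ω + 2 * Real.pi) (-1), ← hθ.lowPass_eq]
    · congr 1; push_cast; ring
    · rw [abs_le]; constructor <;> linarith
  · rw [hθ.eq_zero_of_le_neg (ω := ω - 2 * Real.pi) (by linarith), add_zero, hθ.lowPass_eq]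
    rw [abs_le]; constructor <;> linarith

lemma IsMeyerWindow.norm_waveletFT_le (hθ : IsMeyerWindow θ) (ω : ℝ) : ‖waveletFT θ ω‖ ≤ 2 := by
  have h1 : ‖Complex.exp (-(Complex.I * (ω / 2 : ℝ)))‖ = 1 := by
    rw [Complex.norm_exp]; simp
  rw [waveletFT, norm_mul, h1, one_mul, Complex.norm_real, Real.norm_eq_abs, abs_mul]
  calc _ ≤ 2 * 1 := mul_le_mul ((abs_add_le _ _).trans
        (by linarith [hθ.abs_le_one (ω + 2 * Real.pi), hθ.abs_le_one (ω - 2 * Real.pi)]))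
        (hθ.abs_le_one _) (abs_nonneg _) (by norm_num)
    _ = 2 := by norm_num

end LowPass

/-! ### Energies of the levels in the frequency domain -/

section Energy

/-- Orthogonality of the characters of `ℤ / N`. -/
lemma sum_exp_eq_ite {N : ℕ} (hN : N ≠ 0) (d : ℤ) :
    ∑ k ∈ Finset.range N, Complex.exp (2 * Real.pi * Complex.I * d * k / N)
      = if (N : ℤ) ∣ d then (N : ℂ) else 0 := by
  set x : ℂ := Complex.exp (2 * Real.pi * Complex.I / N) ^ d with hx
  have hprim := Complex.isPrimitiveRoot_exp N hN
  have hterm : ∀ k : ℕ, Complex.exp (2 * Real.pi * Complex.I * d * k / N) = x ^ k := by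
    intro k
    rw [hx, ← Complex.exp_int_mul, ← Complex.exp_nat_mul]; congr 1; ring
  simp_rw [hterm]
  split_ifs with h
  · have hx1 : x = 1 := (hprim.zpow_eq_one_iff_dvd d).2 h
    simp [hx1]
  · have hx1 : x ≠ 1 := fun h1 => h ((hprim.zpow_eq_one_iff_dvd d).1 h1)
    have hxN : x ^ N = 1 := by
      rw [hx, ← zpow_natCast, zpow_comm, zpow_natCast, hprim.pow_eq_one, one_zpow]
    rw [geom_sum_eq hx1, hxN, sub_self, zero_div]

/-- Fourier coefficients of the periodized function `x ↦ 2^(j/2) ∑ᵢ u (2^j (x+i) - k)` when `u` has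
Fourier transform `g`. -/
def atomCoef (g : ℝ → ℂ) (j k : ℕ) (l : ℤ) : ℂ :=
  ((2 : ℝ) ^ (-((j : ℝ) / 2)) : ℝ) * g (2 * Real.pi * l / 2 ^ j)
    * Complex.exp (-(2 * Real.pi * Complex.I * l * k / 2 ^ j))

/-- The energy `∑ₖ |⟨f, g_{j,k}⟩|²` of the `2^j` atoms of level `j`, for a function with Fourier
coefficients `c` on the frequencies `S`. -/
def levelEnergy (g : ℝ → ℂ) (j : ℕ) (S : Finset ℤ) (c : ℤ → ℂ) : ℝ :=
  ∑ k ∈ Finset.range (2 ^ j), ‖∑ l ∈ S, conj (atomCoef g j k l) * c l‖ ^ 2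

/-- Summing over the translates leaves only the pairs of frequencies that agree modulo `2^j`. -/
lemma levelEnergy_eq (g : ℝ → ℂ) (j : ℕ) (S : Finset ℤ) (c : ℤ → ℂ) :
    (levelEnergy g j S c : ℂ) = ∑ l ∈ S, ∑ m ∈ S, if ((2 ^ j : ℕ) : ℤ) ∣ l - m then
      (c l * conj (g (2 * Real.pi * l / 2 ^ j))) * conj (c m * conj (g (2 * Real.pi * m / 2 ^ j)))
      else 0 := by
  have hN : (2 ^ j : ℕ) ≠ 0 := by positivity
  have hs : ((((2 : ℝ) ^ (-((j : ℝ) / 2)) : ℝ) : ℂ)) * (((2 : ℝ) ^ (-((j : ℝ) / 2)) : ℝ) : ℂ)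
      * ((2 ^ j : ℕ) : ℂ) = 1 := by
    have : (2 : ℝ) ^ (-((j : ℝ) / 2)) * (2 : ℝ) ^ (-((j : ℝ) / 2)) * ((2 ^ j : ℕ) : ℝ) = 1 := by
      push_cast
      rw [← Real.rpow_natCast, ← Real.rpow_add (by norm_num), ← Real.rpow_add (by norm_num),
        show -((j : ℝ) / 2) + -((j : ℝ) / 2) + j = 0 by ring, Real.rpow_zero]
    exact_mod_cast this
  have hsq : ∀ k : ℕ, ((‖∑ l ∈ S, conj (atomCoef g j k l) * c l‖ ^ 2 : ℝ) : ℂ)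
      = ∑ l ∈ S, ∑ m ∈ S, (conj (atomCoef g j k l) * c l) *
        conj (conj (atomCoef g j k m) * c m) := by
    intro k
    rw [← Finset.sum_mul_sum, ← map_sum, Complex.mul_conj, Complex.normSq_eq_norm_sq]
  have hterm : ∀ (k : ℕ) (l m : ℤ), (conj (atomCoef g j k l) * c l) *
        conj (conj (atomCoef g j k m) * c m) =
      ((((2 : ℝ) ^ (-((j : ℝ) / 2)) : ℝ) : ℂ)) * (((2 : ℝ) ^ (-((j : ℝ) / 2)) : ℝ) : ℂ) *
      ((c l * conj (g (2 * Real.pi * l / 2 ^ j))) *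
        conj (c m * conj (g (2 * Real.pi * m / 2 ^ j)))) *
      Complex.exp (2 * Real.pi * Complex.I * ((l - m : ℤ) : ℂ) * k / (2 ^ j : ℕ)) := by
    intro k l m
    have : Complex.exp (2 * Real.pi * Complex.I * ((l - m : ℤ) : ℂ) * k / (2 ^ j : ℕ))
        = Complex.exp (2 * Real.pi * Complex.I * l * k / 2 ^ j) *
          Complex.exp (-(2 * Real.pi * Complex.I * m * k / 2 ^ j)) := by
      rw [← Complex.exp_add]; congr 1; push_cast; ring
    have hc : ∀ l : ℤ, conj (Complex.exp (-(2 * Real.pi * Complex.I * l * k / 2 ^ j)))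
        = Complex.exp (2 * Real.pi * Complex.I * l * k / 2 ^ j) := by
      intro l
      rw [← Complex.exp_conj]; congr 1
      simp only [map_neg, map_div₀, map_mul, Complex.conj_ofReal, Complex.conj_I, map_ofNat,
        map_natCast, map_intCast, map_pow]
      ring
    have hc' : conj (Complex.exp (2 * Real.pi * Complex.I * m * k / 2 ^ j))
        = Complex.exp (-(2 * Real.pi * Complex.I * m * k / 2 ^ j)) := by
      rw [← hc, Complex.conj_conj]
    rw [this]
    simp only [atomCoef, map_mul, hc, hc', Complex.conj_ofReal, Complex.conj_conj]
    ring
  rw [levelEnergy]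
  rw [Complex.ofReal_sum]
  simp_rw [hsq, hterm]
  rw [Finset.sum_comm]
  refine Finset.sum_congr rfl fun l _ => ?_
  rw [Finset.sum_comm]
  refine Finset.sum_congr rfl fun m _ => ?_
  rw [← Finset.mul_sum, sum_exp_eq_ite hN]
  split_ifs with h
  · rw [mul_right_comm, hs, one_mul]
  · rw [mul_zero]

lemma levelEnergy_nonneg (g : ℝ → ℂ) (j : ℕ) (S : Finset ℤ) (c : ℤ → ℂ) :
    0 ≤ levelEnergy g j S c := Finset.sum_nonneg fun _ _ => by positivity

variable {θ : ℝ → ℝ}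

/-- The two-scale relation, in terms of energies. -/
lemma IsMeyerWindow.levelEnergy_succ (hθ : IsMeyerWindow θ) (j : ℕ) (S : Finset ℤ) (c : ℤ → ℂ) :
    levelEnergy (fun ω => (θ ω : ℂ)) (j + 1) S c
      = levelEnergy (fun ω => (θ ω : ℂ)) j S c + levelEnergy (waveletFT θ) j S c := by
  have hpi := Real.pi_pos
  have h2j : (2 : ℝ) ^ j ≠ 0 := by positivity
  have : (levelEnergy (fun ω => (θ ω : ℂ)) (j + 1) S c : ℂ)
      = levelEnergy (fun ω => (θ ω : ℂ)) j S c + levelEnergy (waveletFT θ) j S c := by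
    rw [levelEnergy_eq, levelEnergy_eq, levelEnergy_eq, ← Finset.sum_add_distrib]
    refine Finset.sum_congr rfl fun l _ => ?_
    rw [← Finset.sum_add_distrib]
    refine Finset.sum_congr rfl fun m _ => ?_
    by_cases hd : ((2 ^ j : ℕ) : ℤ) ∣ l - m
    swap
    · rw [if_neg hd, if_neg hd, if_neg, add_zero]
      exact fun h => hd (dvd_trans ⟨2, by push_cast; ring⟩ h)
    rw [if_pos hd, if_pos hd]
    obtain ⟨t, ht⟩ := hd
    have hlm : (l : ℝ) = m + 2 ^ j * t := by
      have : l = m + 2 ^ j * t := by push_cast at ht; linarith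
      rw [this]; push_cast; ring
    -- `ω` and `ν` are the frequencies `2πl/2^j` and `2πm/2^j`, which differ by `2πt`
    set ω : ℝ := 2 * Real.pi * l / 2 ^ j with hω
    set ν : ℝ := 2 * Real.pi * m / 2 ^ j with hν
    have hων : ω = ν + 2 * Real.pi * t := by rw [hω, hν, hlm]; field_simp
    have hω2 : 2 * Real.pi * l / 2 ^ (j + 1) = ω / 2 := by rw [hω, pow_succ]; field_simp
    have hν2 : 2 * Real.pi * m / 2 ^ (j + 1) = ν / 2 := by rw [hν, pow_succ]; field_simp
    have hphase : conj (Complex.exp (-(Complex.I * (ω / 2 : ℝ)))) *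
        Complex.exp (-(Complex.I * (ν / 2 : ℝ))) = (-1) ^ t := by
      rw [← Complex.exp_conj, ← Complex.exp_add, ← Complex.exp_pi_mul_I, ← Complex.exp_int_mul]
      congr 1
      simp only [map_neg, map_mul, Complex.conj_I, Complex.conj_ofReal]
      rw [hων]; push_cast; ring
    rw [hω2, hν2]
    simp only [waveletFT, hθ.lowPass_shift_mul, map_mul, Complex.conj_ofReal, Complex.conj_conj]
    rw [← hθ.lowPass_mul ω, ← hθ.lowPass_mul ν]
    have hcomb : ∀ x y : ℝ,
        c l * (conj (Complex.exp (-(Complex.I * (ω / 2 : ℝ)))) * (x : ℂ)) *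
          (conj (c m) * (Complex.exp (-(Complex.I * (ν / 2 : ℝ))) * (y : ℂ)))
        = (-1) ^ t * (c l * x * (conj (c m) * y)) := by
      intro x y; rw [← hphase]; ring
    rw [hcomb]
    have hcast : ((2 ^ (j + 1) : ℕ) : ℤ) ∣ l - m ↔ Even t := by
      rw [ht]; push_cast; rw [pow_succ, mul_dvd_mul_iff_left (by positivity), even_iff_two_dvd]
    rcases Int.even_or_odd t with he | ho
    · rw [if_pos (hcast.2 he), he.neg_one_zpow]
      obtain ⟨r, hr⟩ := he
      have e1 : lowPass θ ω = lowPass θ ν := by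
        rw [hων, ← lowPass_add θ ν r, hr]; congr 1; push_cast; ring
      have e2 : lowPass θ (ω + 2 * Real.pi) = lowPass θ (ν + 2 * Real.pi) := by
        rw [hων, ← lowPass_add θ (ν + 2 * Real.pi) r, hr]; congr 1; push_cast; ring
      rw [e1, e2]
      have h1 : ((lowPass θ ν : ℂ)) ^ 2 + (lowPass θ (ν + 2 * Real.pi) : ℂ) ^ 2 = 1 := by
        exact_mod_cast hθ.lowPass_sq ν
      push_cast
      linear_combination (-(c l * conj (c m) * θ (ω / 2) * θ (ν / 2))) * h1
    · rw [if_neg (fun h => (Int.not_even_iff_odd.2 ho) (hcast.1 h)), ho.neg_one_zpow]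
      obtain ⟨r, hr⟩ := ho
      have e1 : lowPass θ ω = lowPass θ (ν + 2 * Real.pi) := by
        rw [hων, ← lowPass_add θ (ν + 2 * Real.pi) r, hr]; congr 1; push_cast; ring
      have e2 : lowPass θ (ω + 2 * Real.pi) = lowPass θ ν := by
        rw [hων, ← lowPass_add θ ν (r + 1), hr]; congr 1; push_cast; ring
      rw [e1, e2]; push_cast; ring
  exact_mod_cast this

lemma IsMeyerWindow.levelEnergy_add (hθ : IsMeyerWindow θ) (j i : ℕ) (S : Finset ℤ) (c : ℤ → ℂ) :
    levelEnergy (fun ω => (θ ω : ℂ)) (j + i) S c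
      = levelEnergy (fun ω => (θ ω : ℂ)) j S c
        + ∑ r ∈ Finset.range i, levelEnergy (waveletFT θ) (j + r) S c := by
  induction i with
  | zero => simp
  | succ i ih => rw [← add_assoc, hθ.levelEnergy_succ, ih, Finset.sum_range_succ, add_assoc]

lemma theta_eq_one_of_low (hθ : IsMeyerWindow θ) {j : ℕ} {l : ℤ} (h : 3 * |l| ≤ 2 ^ j) :
    θ (2 * Real.pi * l / 2 ^ j) = 1 := by
  have hpi := Real.pi_pos
  apply hθ.eq_one
  have h' : 3 * |(l : ℝ)| ≤ 2 ^ j := by exact_mod_cast h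
  rw [abs_div, abs_mul, abs_of_pos (by positivity : 0 < 2 * Real.pi),
    abs_of_pos (by positivity : (0 : ℝ) < 2 ^ j), div_le_div_iff₀ (by positivity) (by norm_num)]
  nlinarith

lemma theta_eq_zero_of_high (hθ : IsMeyerWindow θ) {j : ℕ} {l : ℤ} (h : 2 * 2 ^ j ≤ 3 * |l|) :
    θ (2 * Real.pi * l / 2 ^ j) = 0 := by
  have hpi := Real.pi_pos
  apply hθ.eq_zero
  have h' : 2 * 2 ^ j ≤ 3 * |(l : ℝ)| := by exact_mod_cast h
  rw [abs_div, abs_mul, abs_of_pos (by positivity : 0 < 2 * Real.pi),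
    abs_of_pos (by positivity : (0 : ℝ) < 2 ^ j), div_le_div_iff₀ (by norm_num) (by positivity)]
  nlinarith

/-- A frequency in the plateau of the window shares its residue class modulo `2^j` with no other
frequency of the support of the window. -/
lemma theta_alias (hθ : IsMeyerWindow θ) {j : ℕ} {l m : ℤ} (hl : 3 * |l| ≤ 2 ^ j)
    (hd : ((2 ^ j : ℕ) : ℤ) ∣ l - m) (hne : l ≠ m) : θ (2 * Real.pi * m / 2 ^ j) = 0 := by
  apply theta_eq_zero_of_high hθ
  have h1 : ((2 ^ j : ℕ) : ℤ) ≤ |l - m| :=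
    Int.le_of_dvd (abs_pos.2 (sub_ne_zero.2 hne)) ((dvd_abs _ _).2 hd)
  push_cast at h1
  have := abs_sub l m
  omega

lemma levelEnergy_eq_of_low (hθ : IsMeyerWindow θ) {j : ℕ} {S : Finset ℤ} (c : ℤ → ℂ)
    (hS : ∀ l ∈ S, 3 * |l| ≤ 2 ^ j) :
    levelEnergy (fun ω => (θ ω : ℂ)) j S c = ∑ l ∈ S, ‖c l‖ ^ 2 := by
  have : (levelEnergy (fun ω => (θ ω : ℂ)) j S c : ℂ) = ((∑ l ∈ S, ‖c l‖ ^ 2 : ℝ) : ℂ) := by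
    rw [levelEnergy_eq, Complex.ofReal_sum]
    refine Finset.sum_congr rfl fun l hl => ?_
    rw [Finset.sum_eq_single_of_mem l hl]
    · simp only [sub_self, dvd_zero, if_true, theta_eq_one_of_low hθ (hS l hl), Complex.ofReal_one,
        map_one, mul_one]
      rw [Complex.mul_conj, Complex.normSq_eq_norm_sq]
    · intro m hm hne
      split_ifs with hd
      · rw [theta_alias hθ (hS l hl) hd hne.symm]; simp
      · rfl
  exact_mod_cast this

lemma exists_freq_bound (T : Finset ℤ) : ∃ J : ℕ, ∀ l ∈ T, 3 * |l| ≤ 2 ^ J := by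
  refine ⟨∑ l ∈ T, (3 * |l|).toNat, fun l hl => ?_⟩
  have h1 : (3 * |l|).toNat ≤ ∑ l ∈ T, (3 * |l|).toNat :=
    Finset.single_le_sum (f := fun l : ℤ => (3 * |l|).toNat) (fun _ _ => Nat.zero_le _) hl
  have h2 := h1.trans (Nat.lt_two_pow_self (n := _)).le
  calc 3 * |l| ≤ (3 * |l|).toNat := Int.self_le_toNat _
    _ ≤ _ := by exact_mod_cast h2

/-- Bessel's inequality for one level of scaling functions. -/
lemma levelEnergy_le (hθ : IsMeyerWindow θ) (j : ℕ) (S : Finset ℤ) (c : ℤ → ℂ) :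
    levelEnergy (fun ω => (θ ω : ℂ)) j S c ≤ ∑ l ∈ S, ‖c l‖ ^ 2 := by
  -- the energy increases with the level, and at high levels it is the full energy
  obtain ⟨i, hi⟩ := exists_freq_bound S
  have hi' : ∀ l ∈ S, 3 * |l| ≤ 2 ^ (j + i) := fun l hl =>
    (hi l hl).trans (pow_le_pow_right₀ (by norm_num) (Nat.le_add_left i j))
  rw [← levelEnergy_eq_of_low hθ c hi', hθ.levelEnergy_add]
  exact le_add_of_nonneg_right (Finset.sum_nonneg fun _ _ => levelEnergy_nonneg _ _ _ _)

/-- One level of scaling functions captures the full energy of the frequencies in the plateau. -/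
lemma sum_low_le_levelEnergy (hθ : IsMeyerWindow θ) (j : ℕ) (S : Finset ℤ) (c : ℤ → ℂ) :
    ∑ l ∈ S with 3 * |l| ≤ 2 ^ j, ‖c l‖ ^ 2 ≤ levelEnergy (fun ω => (θ ω : ℂ)) j S c := by
  set S₁ := S.filter fun l => 3 * |l| ≤ 2 ^ j with hS₁
  set S₂ := S.filter fun l => ¬ 3 * |l| ≤ 2 ^ j with hS₂
  have key : levelEnergy (fun ω => (θ ω : ℂ)) j S c
      = levelEnergy (fun ω => (θ ω : ℂ)) j S₁ c + levelEnergy (fun ω => (θ ω : ℂ)) j S₂ c := by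
    have : (levelEnergy (fun ω => (θ ω : ℂ)) j S c : ℂ)
      = levelEnergy (fun ω => (θ ω : ℂ)) j S₁ c + levelEnergy (fun ω => (θ ω : ℂ)) j S₂ c := by
      rw [levelEnergy_eq, levelEnergy_eq, levelEnergy_eq,
        ← Finset.sum_filter_add_sum_filter_not S (fun l => 3 * |l| ≤ 2 ^ j)]
      congr 1
      · refine Finset.sum_congr rfl fun l hl => ?_
        rw [← Finset.sum_filter_add_sum_filter_not S (fun l => 3 * |l| ≤ 2 ^ j), add_eq_left]
        refine Finset.sum_eq_zero fun m hm => ?_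
        have hl' := (Finset.mem_filter.1 hl).2
        have hm' := (Finset.mem_filter.1 hm).2
        split_ifs with hd
        · rw [theta_alias hθ hl' hd (by rintro rfl; exact hm' hl')]; simp
        · rfl
      · refine Finset.sum_congr rfl fun l hl => ?_
        rw [← Finset.sum_filter_add_sum_filter_not S (fun l => 3 * |l| ≤ 2 ^ j), add_eq_right]
        refine Finset.sum_eq_zero fun m hm => ?_
        have hl' := (Finset.mem_filter.1 hl).2
        have hm' := (Finset.mem_filter.1 hm).2
        split_ifs with hd
        · rw [theta_alias hθ hm' ((dvd_sub_comm).1 hd) (by rintro rfl; exact hl' hm')]; simp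
        · rfl
    exact_mod_cast this
  rw [key, levelEnergy_eq_of_low hθ c (fun l hl => (Finset.mem_filter.1 hl).2)]
  exact le_add_of_nonneg_right (levelEnergy_nonneg _ _ _ _)

end Energy

/-! ### Poisson summation -/

section Poisson

open scoped FourierTransform in
lemma isBigO_rpow_of_hasCompactSupport {f : ℝ → ℂ} (hs : HasCompactSupport f) :
    f =O[cocompact ℝ] fun x : ℝ => |x| ^ (-(2 : ℝ)) := by
  have : f =ᶠ[cocompact ℝ] 0 := by
    have := hasCompactSupport_iff_eventuallyEq.1 hs
    rwa [coclosedCompact_eq_cocompact] at this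
  exact this.trans_isBigO (Asymptotics.isBigO_zero _ _)

open scoped FourierTransform in
/-- The samples of the Fourier transform at the integers are the Fourier coefficients of the
periodization, hence square-summable. -/
lemma summable_sq_fourier_int {f : ℝ → ℂ} (hc : Continuous f) (hs : HasCompactSupport f) :
    Summable fun n : ℤ => ‖𝓕 f n‖ ^ 2 := by
  have h_norm : ∀ K : TopologicalSpace.Compacts ℝ, Summable fun n : ℤ =>
      ‖((⟨f, hc⟩ : C(ℝ, ℂ)).comp <| ContinuousMap.addRight (n : ℝ)).restrict K‖ := fun K =>
    summable_of_isBigO (Real.summable_abs_int_rpow (b := 2) (by norm_num))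
      ((isBigO_norm_restrict_cocompact ⟨f, hc⟩ (by norm_num)
        (isBigO_rpow_of_hasCompactSupport hs) K).comp_tendsto Int.tendsto_coe_cofinite)
  let F : C(UnitAddCircle, ℂ) :=
    ⟨((⟨f, hc⟩ : C(ℝ, ℂ)).periodic_tsum_comp_add_zsmul 1).lift,
      continuous_coinduced_dom.mpr (map_continuous _)⟩
  have h1 : ∀ n : ℤ, fourierCoeff F n = 𝓕 f n := Real.fourierCoeff_tsum_comp_add h_norm
  have h2 := (hasSum_sq_fourierCoeff (F.toLp (E := ℂ) 2 AddCircle.haarAddCircle ℂ)).summable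
  simpa only [fourierCoeff_toLp, h1] using h2

open scoped FourierTransform in
/-- One derivative suffices for Poisson summation: the Fourier transform at `n` is `1 / n` times a
square-summable sequence. -/
lemma summable_fourier_int {f : ℝ → ℂ} (hf : ContDiff ℝ 1 f) (hs : HasCompactSupport f) :
    Summable fun n : ℤ => 𝓕 f n := by
  have hc' : Continuous (deriv f) := hf.continuous_deriv le_rfl
  have h2 := summable_sq_fourier_int hc' hs.deriv
  have hF : 𝓕 (deriv f) = fun x : ℝ => (2 * Real.pi * Complex.I * x) • (𝓕 f x) :=
    Real.fourier_deriv (hf.continuous.integrable_of_hasCompactSupport hs)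
      (hf.differentiable (by norm_num)) (hc'.integrable_of_hasCompactSupport hs.deriv)
  have h3 : Summable fun n : ℤ => 1 / (n : ℝ) ^ 2 := Real.summable_one_div_int_pow.2 (by norm_num)
  have h4 : Summable fun n : ℤ => if n = 0 then ‖𝓕 f (0 : ℝ)‖ else 0 :=
    summable_of_ne_finset_zero (s := {0}) (fun n hn => by
      rw [if_neg]; simpa using hn)
  refine Summable.of_norm_bounded ((h2.add h3).add h4) fun n => ?_
  by_cases hn : n = 0
  · subst hn
    simp only [Int.cast_zero, if_true]
    have : 0 ≤ ‖𝓕 (deriv f) 0‖ ^ 2 + 1 / (0 : ℝ) ^ 2 := by positivity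
    linarith
  · have h5 : ‖𝓕 (deriv f) n‖ = 2 * Real.pi * |(n : ℝ)| * ‖𝓕 f n‖ := by
      rw [hF]; simp [Real.pi_pos.le]
    have hn' : 0 < |(n : ℝ)| := abs_pos.2 (by exact_mod_cast hn)
    have h6 : ‖𝓕 f n‖ ≤ ‖𝓕 (deriv f) n‖ * (1 / |(n : ℝ)|) := by
      rw [h5, mul_one_div, le_div_iff₀ hn']
      have := Real.pi_gt_three
      nlinarith [mul_nonneg (norm_nonneg (𝓕 f n)) hn'.le]
    have h7 : (1 / |(n : ℝ)|) ^ 2 = 1 / (n : ℝ) ^ 2 := by rw [div_pow, sq_abs, one_pow]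
    rw [if_neg hn, ← h7]
    nlinarith [sq_nonneg (‖𝓕 (deriv f) n‖ - 1 / |(n : ℝ)|), norm_nonneg (𝓕 (deriv f) n)]

open scoped FourierTransform in
lemma tsum_fourier_int {f : ℝ → ℂ} (hf : ContDiff ℝ 1 f) (hs : HasCompactSupport f) :
    ∑' n : ℤ, 𝓕 f n = ∑' n : ℤ, f n := by
  have := Real.tsum_eq_tsum_fourier_of_rpow_decay_of_summable hf.continuous (b := 2) (by norm_num)
    (isBigO_rpow_of_hasCompactSupport hs) (summable_fourier_int hf hs) 0
  simpa using this.symm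

/-- What the Fourier transforms of the Meyer scaling function and of the Meyer wavelet have in
common. -/
structure IsBandWindow (g : ℝ → ℂ) : Prop where
  contDiff : ContDiff ℝ 1 g
  conj_symm : ∀ ω, g (-ω) = conj (g ω)
  eq_zero : ∀ ω, 8 * Real.pi / 3 ≤ |ω| → g ω = 0
  norm_le : ∀ ω, ‖g ω‖ ≤ 2

lemma IsMeyerWindow.isBandWindow (hθ : IsMeyerWindow θ) : IsBandWindow (fun ω => (θ ω : ℂ)) where
  contDiff := Complex.ofRealCLM.contDiff.comp hθ.smooth
  conj_symm ω := by rw [hθ.even, Complex.conj_ofReal]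
  eq_zero ω h := by rw [hθ.eq_zero ω (by linarith [Real.pi_pos]), Complex.ofReal_zero]
  norm_le ω := by
    rw [Complex.norm_real, Real.norm_eq_abs]; linarith [hθ.abs_le_one ω]

lemma IsMeyerWindow.isBandWindow_waveletFT (hθ : IsMeyerWindow θ) :
    IsBandWindow (waveletFT θ) where
  contDiff := by
    have h := hθ.smooth
    have hC : ContDiff ℝ 1 (fun x : ℝ => (x : ℂ)) := Complex.ofRealCLM.contDiff
    unfold waveletFT
    refine ContDiff.mul (ContDiff.cexp (ContDiff.neg (contDiff_const.mul (hC.comp ?_))))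
      (hC.comp ?_)
    · exact contDiff_id.div_const _
    · exact ((h.comp (contDiff_id.add contDiff_const)).add
        (h.comp (contDiff_id.sub contDiff_const))).mul (h.comp (contDiff_id.div_const _))
  conj_symm ω := by
    have e1 : θ (-ω + 2 * Real.pi) = θ (ω - 2 * Real.pi) := by rw [← hθ.even]; congr 1; ring
    have e2 : θ (-ω - 2 * Real.pi) = θ (ω + 2 * Real.pi) := by rw [← hθ.even]; congr 1; ring
    have e3 : θ (-ω / 2) = θ (ω / 2) := by rw [← hθ.even]; congr 1; ring
    simp only [waveletFT, e1, e2, e3, map_mul, Complex.conj_ofReal, ← Complex.exp_conj, map_neg,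
      Complex.conj_I]
    congr 1
    · congr 1; push_cast; ring
    · congr 2; ring
  eq_zero ω h := by
    have : θ (ω / 2) = 0 := hθ.eq_zero _ (by
      rw [abs_div, abs_of_pos (by norm_num : (0:ℝ) < 2)]; linarith)
    simp [waveletFT, this]
  norm_le := hθ.norm_waveletFT_le

/-- The frequencies of the atoms of level `j`. -/
def freqBox (j : ℕ) : Finset ℤ := Finset.Icc (-(2 * 2 ^ j)) (2 * 2 ^ j)

lemma mem_freqBox {j : ℕ} {l : ℤ} : l ∈ freqBox j ↔ |l| ≤ 2 * 2 ^ j := by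
  rw [freqBox, Finset.mem_Icc, abs_le]

variable {g : ℝ → ℂ}

lemma IsBandWindow.atomCoef_eq_zero (hg : IsBandWindow g) {j : ℕ} (k : ℕ) {l : ℤ}
    (hl : l ∉ freqBox j) : atomCoef g j k l = 0 := by
  have hpi := Real.pi_pos
  have h0 : g (2 * Real.pi * l / 2 ^ j) = 0 := by
    apply hg.eq_zero
    rw [mem_freqBox, not_le] at hl
    have h' : 2 * 2 ^ j < |(l : ℝ)| := by exact_mod_cast hl
    rw [abs_div, abs_mul, abs_of_pos (by positivity : 0 < 2 * Real.pi),
      abs_of_pos (by positivity : (0 : ℝ) < 2 ^ j), div_le_div_iff₀ (by norm_num) (by positivity)]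
    have : (0 : ℝ) < 2 ^ j := by positivity
    nlinarith
  rw [atomCoef, h0]; ring

open scoped FourierTransform in
/-- Periodization by Poisson summation, before the reality of the sum is used. -/
lemma IsBandWindow.periodize_eq_re (hg : IsBandWindow g) (j k : ℕ) (x : ℝ) :
    periodize (inverseFT g) j k x
      = (∑ l ∈ freqBox j, atomCoef g j k l * Complex.exp (2 * Real.pi * Complex.I * l * x)).re := by
  have hpi := Real.pi_pos
  have hN : (0 : ℝ) < 2 ^ j := by positivity
  set a : ℝ := 2 * Real.pi / 2 ^ j with ha
  have ha0 : 0 < a := by positivity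
  set h : ℝ → ℂ := fun v => (1 / 2 ^ j : ℂ) * g (a * v) *
    Complex.exp (2 * Real.pi * Complex.I * v * (x - k / 2 ^ j)) with hh
  have hh1 : ContDiff ℝ 1 h := by
    refine (contDiff_const.mul (hg.contDiff.comp (contDiff_const.mul contDiff_id))).mul
      (ContDiff.cexp ((contDiff_const.mul Complex.ofRealCLM.contDiff).mul contDiff_const))
  have hh2 : HasCompactSupport h := by
    refine HasCompactSupport.of_support_subset_isCompact
      (isCompact_Icc (a := -(8 * Real.pi / 3 / a)) (b := 8 * Real.pi / 3 / a)) fun v hv => ?_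
    rw [Set.mem_Icc, ← abs_le, le_div_iff₀ ha0]
    by_contra hlt
    apply hv
    have : g (a * v) = 0 := hg.eq_zero _ (by rw [abs_mul, abs_of_pos ha0]; linarith)
    simp [hh, this]
  have hF : ∀ i : ℤ, inverseFT g ((2 : ℝ) ^ j * (x + i) - k) = (𝓕 h ((-i : ℤ) : ℝ)).re := by
    intro i
    rw [inverseFT, Real.fourier_real_eq_integral_exp_smul]
    congr 1
    have hsub := Measure.integral_comp_mul_left (fun ω : ℝ => g ω *
      Complex.exp (Complex.I * (ω * ((2 : ℝ) ^ j * (x + i) - k) : ℝ))) a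
    rw [abs_of_pos (inv_pos.2 ha0)] at hsub
    have hsub' : ∫ ω : ℝ, g ω * Complex.exp (Complex.I * (ω * ((2 : ℝ) ^ j * (x + i) - k) : ℝ))
        = (a : ℂ) * ∫ v : ℝ, g (a * v) *
          Complex.exp (Complex.I * ((a * v) * ((2 : ℝ) ^ j * (x + i) - k) : ℝ)) := by
      rw [hsub, Complex.real_smul, ← mul_assoc, ← Complex.ofReal_mul, mul_inv_cancel₀ ha0.ne',
        Complex.ofReal_one, one_mul]
    rw [hsub', ← mul_assoc, ← integral_const_mul]
    congr 1
    funext v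
    simp only [hh, smul_eq_mul]
    have e1 : Complex.exp (Complex.I * ((a * v) * ((2 : ℝ) ^ j * (x + i) - k) : ℝ))
        = Complex.exp ((-2 * Real.pi * v * ((-i : ℤ) : ℝ) : ℝ) * Complex.I) *
          Complex.exp (2 * Real.pi * Complex.I * v * (x - k / 2 ^ j)) := by
      rw [← Complex.exp_add]; congr 1; rw [ha]; push_cast; field_simp; ring
    have e2 : ((1 / (2 * Real.pi) : ℝ) : ℂ) * (a : ℂ) = 1 / 2 ^ j := by
      rw [ha]; push_cast; field_simp
    rw [e1, e2]
    ring_nf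
  have hsum : Summable fun i : ℤ => 𝓕 h ((-i : ℤ) : ℝ) :=
    (Equiv.neg ℤ).summable_iff.2 (summable_fourier_int hh1 hh2)
  rw [periodize]
  simp_rw [hF]
  have hneg : ∑' i : ℤ, 𝓕 h ((-i : ℤ) : ℝ) = ∑' i : ℤ, 𝓕 h (i : ℝ) :=
    (Equiv.neg ℤ).tsum_eq (fun i : ℤ => 𝓕 h (i : ℝ))
  rw [← Complex.re_tsum hsum, hneg,
    tsum_fourier_int hh1 hh2, ← Complex.re_ofReal_mul]
  congr 1
  have hterm : ∀ l : ℤ, (((2 : ℝ) ^ ((j : ℝ) / 2) : ℝ) : ℂ) * h l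
      = atomCoef g j k l * Complex.exp (2 * Real.pi * Complex.I * l * x) := by
    intro l
    have e0 : (2 : ℝ) ^ (-((j : ℝ) / 2)) = (2 : ℝ) ^ ((j : ℝ) / 2) * (1 / 2 ^ j) := by
      rw [← Real.rpow_natCast 2 j, one_div, ← Real.rpow_neg (by norm_num),
        ← Real.rpow_add (by norm_num)]
      congr 1; ring
    have e1 : Complex.exp (2 * Real.pi * Complex.I * (l : ℝ) * (x - k / 2 ^ j))
        = Complex.exp (-(2 * Real.pi * Complex.I * l * k / 2 ^ j)) *
          Complex.exp (2 * Real.pi * Complex.I * l * x) := by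
      rw [← Complex.exp_add]; congr 1; push_cast; ring
    have e2 : a * l = 2 * Real.pi * l / 2 ^ j := by rw [ha]; ring
    simp only [hh, atomCoef]
    rw [e0, e1, e2]; push_cast; ring
  rw [← tsum_mul_left]
  simp_rw [hterm]
  exact tsum_eq_sum fun l hl => by rw [hg.atomCoef_eq_zero k hl, zero_mul]

/-- A real function is the trigonometric polynomial with frequencies `S` and coefficients `c`. -/
def IsTrigPoly (u : ℝ → ℝ) (S : Finset ℤ) (c : ℤ → ℂ) : Prop :=
  ∀ x : ℝ, (u x : ℂ) = ∑ l ∈ S, c l * Complex.exp (2 * Real.pi * Complex.I * l * x)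

/-- The periodized scaling functions and wavelets are trigonometric polynomials. -/
lemma IsBandWindow.isTrigPoly (hg : IsBandWindow g) (j k : ℕ) :
    IsTrigPoly (periodize (inverseFT g) j k) (freqBox j) (atomCoef g j k) := by
  intro x
  rw [hg.periodize_eq_re]
  refine (Complex.conj_eq_iff_re (z := ∑ l ∈ freqBox j, _)).1 ?_
  -- complex conjugation exchanges the frequencies `l` and `-l`
  rw [map_sum]
  refine Finset.sum_nbij' (fun l => -l) (fun l => -l) ?_ ?_ ?_ ?_ ?_
  · intro l hl; rw [mem_freqBox] at hl ⊢; rwa [abs_neg]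
  · intro l hl; rw [mem_freqBox] at hl ⊢; rwa [abs_neg]
  · intro l _; exact neg_neg l
  · intro l _; exact neg_neg l
  · intro l _
    have e : (2 * Real.pi * ((-l : ℤ) : ℝ) / 2 ^ j) = -(2 * Real.pi * l / 2 ^ j) := by
      push_cast; ring
    simp only [atomCoef, map_mul, Complex.conj_ofReal, ← Complex.exp_conj]
    rw [e, hg.conj_symm]
    congr 2
    · congr 1
      simp only [map_neg, map_div₀, map_mul, Complex.conj_ofReal, Complex.conj_I, map_ofNat,
        map_natCast, map_intCast, map_pow]
      push_cast; ring
    · simp only [Complex.conj_I, map_ofNat, map_intCast]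
      push_cast; ring

end Poisson

/-! ### Fourier analysis on the unit interval -/

section TrigPoly

instance : IsProbabilityMeasure unitVolume := ⟨by simp [unitVolume]⟩

lemma norm_exp_freq (l : ℤ) (x : ℝ) : ‖Complex.exp (2 * Real.pi * Complex.I * l * x)‖ = 1 := by
  rw [Complex.norm_exp]; simp

lemma norm_exp_neg_freq (l : ℤ) (x : ℝ) :
    ‖Complex.exp (-(2 * Real.pi * Complex.I * l * x))‖ = 1 := by
  rw [Complex.norm_exp]; simp

lemma fourierCoef_eq_fourierCoeffOn (f : ℝ → ℝ) (l : ℤ) :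
    fourierCoef f l = fourierCoeffOn zero_lt_one (fun x => (f x : ℂ)) l := by
  rw [fourierCoeffOn_eq_integral, fourierCoef, unitVolume, integral_Icc_eq_integral_Ioc,
    intervalIntegral.integral_of_le zero_le_one]
  simp only [sub_zero, div_one, one_smul]
  congr 1
  funext x
  rw [smul_eq_mul, mul_comm]
  congr 1
  rw [fourier_coe_apply]
  congr 1
  push_cast; ring

lemma integral_exp_freq (d : ℤ) :
    ∫ x : ℝ, Complex.exp (2 * Real.pi * Complex.I * d * x) ∂unitVolume
      = if d = 0 then 1 else 0 := by
  split_ifs with h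
  · subst h; simp
  · have hc : (2 * Real.pi * Complex.I * d : ℂ) ≠ 0 :=
      mul_ne_zero Complex.two_pi_I_ne_zero (by exact_mod_cast h)
    rw [unitVolume, integral_Icc_eq_integral_Ioc, ← intervalIntegral.integral_of_le zero_le_one,
      integral_exp_mul_complex hc]
    have : Complex.exp (2 * Real.pi * Complex.I * d * (1 : ℝ)) = 1 := by
      rw [Complex.exp_eq_one_iff]; exact ⟨d, by push_cast; ring⟩
    rw [this]; simp

lemma hasSum_sq_fourierCoef {f : ℝ → ℝ} (hf : MemLp f 2 unitVolume) :
    HasSum (fun l : ℤ => ‖fourierCoef f l‖ ^ 2) (∫ x, f x ^ 2 ∂unitVolume) := by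
  have h1 : MemLp (fun x => (f x : ℂ)) 2 (volume.restrict (Set.Ioc (0 : ℝ) 1)) := by
    have := hf.ofReal (K := ℂ)
    rwa [unitVolume, ← Measure.restrict_congr_set Ioc_ae_eq_Icc] at this
  have h2 := hasSum_sq_fourierCoeffOn zero_lt_one h1
  simp_rw [← fourierCoef_eq_fourierCoeffOn] at h2
  convert h2 using 1
  rw [unitVolume, integral_Icc_eq_integral_Ioc, intervalIntegral.integral_of_le zero_le_one]
  simp

lemma integrable_of_memLp_two {f : ℝ → ℝ} (hf : MemLp f 2 unitVolume) :
    Integrable f unitVolume := hf.integrable one_le_two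

lemma integrable_mul_exp {f : ℝ → ℝ} (hf : Integrable f unitVolume) (l : ℤ) :
    Integrable (fun x : ℝ => (f x : ℂ) * Complex.exp (-(2 * Real.pi * Complex.I * l * x)))
      unitVolume :=
  hf.ofReal.mul_bdd (c := 1) (by fun_prop) (ae_of_all _ fun x => (norm_exp_neg_freq l x).le)

lemma norm_fourierCoef_le {f : ℝ → ℝ} (l : ℤ) :
    ‖fourierCoef f l‖ ≤ ∫ x, |f x| ∂unitVolume := by
  refine (norm_integral_le_integral_norm _).trans_eq (integral_congr_ae (ae_of_all _ fun x => ?_))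
  simp only [norm_mul, norm_exp_neg_freq, mul_one, Complex.norm_real, Real.norm_eq_abs]

/-! ### Real trigonometric polynomials -/

variable {u : ℝ → ℝ} {S : Finset ℤ} {c : ℤ → ℂ}

lemma IsTrigPoly.continuous (hu : IsTrigPoly u S c) : Continuous u := by
  have : Continuous fun x : ℝ => (u x : ℂ) := by
    simp_rw [hu _]; fun_prop
  exact Complex.continuous_re.comp this

lemma IsTrigPoly.abs_le (hu : IsTrigPoly u S c) (x : ℝ) : |u x| ≤ ∑ l ∈ S, ‖c l‖ := by
  rw [← Real.norm_eq_abs, ← Complex.norm_real, hu x]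
  refine (norm_sum_le _ _).trans_eq (Finset.sum_congr rfl fun l _ => ?_)
  rw [norm_mul, norm_exp_freq, mul_one]

lemma IsTrigPoly.memLp (hu : IsTrigPoly u S c) : MemLp u 2 unitVolume :=
  MemLp.of_bound hu.continuous.aestronglyMeasurable _
    (ae_of_all _ fun x => (Real.norm_eq_abs _).le.trans (hu.abs_le x))

lemma IsTrigPoly.conj_eq (hu : IsTrigPoly u S c) (x : ℝ) :
    (u x : ℂ) = ∑ l ∈ S, conj (c l) * Complex.exp (-(2 * Real.pi * Complex.I * l * x)) := by
  rw [← Complex.conj_ofReal, hu x, map_sum]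
  refine Finset.sum_congr rfl fun l _ => ?_
  rw [map_mul, ← Complex.exp_conj]
  simp only [map_mul, Complex.conj_ofReal, Complex.conj_I, map_ofNat, map_intCast, mul_neg,
    neg_mul]

lemma IsTrigPoly.fourierCoef_eq (hu : IsTrigPoly u S c) (l : ℤ) :
    fourierCoef u l = if l ∈ S then c l else 0 := by
  have h : ∀ x : ℝ, (u x : ℂ) * Complex.exp (-(2 * Real.pi * Complex.I * l * x))
      = ∑ m ∈ S, c m * Complex.exp (2 * Real.pi * Complex.I * ((m - l : ℤ) : ℂ) * x) := by
    intro x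
    rw [hu x, Finset.sum_mul]
    refine Finset.sum_congr rfl fun m _ => ?_
    rw [mul_assoc, ← Complex.exp_add]
    congr 2; push_cast; ring
  rw [fourierCoef]
  simp_rw [h]
  rw [integral_finsetSum]
  · simp_rw [integral_const_mul, integral_exp_freq, sub_eq_zero, mul_ite, mul_one, mul_zero]
    rw [Finset.sum_ite_eq']
  · intro m _
    refine (Integrable.of_bound (C := 1) (by fun_prop) (ae_of_all _ fun x => ?_)).const_mul _
    exact (norm_exp_freq _ x).le

/-- Sums over the active frequencies are finite sums; summands of vanishing coefficients do not
matter. -/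
lemma IsTrigPoly.finsum_freqs {M : Type*} [AddCommMonoid M] (hu : IsTrigPoly u S c)
    (F : ℂ → ℤ → M) (hF : ∀ l, F 0 l = 0) :
    ∑ᶠ l ∈ freqs u, F (fourierCoef u l) l = ∑ l ∈ S, F (c l) l := by
  rw [← finsum_mem_finset_eq_sum]
  refine finsum_congr fun l => ?_
  by_cases hl : l ∈ S
  · by_cases hc : c l = 0
    · simp [freqs, hu.fourierCoef_eq, hl, hc, hF]
    · simp [freqs, hu.fourierCoef_eq, hl, hc]
  · simp [freqs, hu.fourierCoef_eq, hl]

lemma IsTrigPoly.etaSum_eq (hu : IsTrigPoly u S c) : etaSum u = ∑ l ∈ S, ‖c l‖ :=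
  hu.finsum_freqs (fun z _ => ‖z‖) (by simp)

lemma IsTrigPoly.abs_le_etaSum (hu : IsTrigPoly u S c) (x : ℝ) : |u x| ≤ etaSum u :=
  hu.etaSum_eq ▸ hu.abs_le x

lemma IsTrigPoly.finsum_exp_eq (hu : IsTrigPoly u S c) (x : ℝ) :
    ∑ᶠ l ∈ freqs u, conj (fourierCoef u l) * Complex.exp (-(2 * Real.pi * Complex.I * l * x))
      = u x := by
  rw [hu.finsum_freqs (fun z l => conj z * Complex.exp (-(2 * Real.pi * Complex.I * l * x)))
    (by simp), hu.conj_eq x]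

/-- The empirical coefficient is an empirical mean. -/
lemma IsTrigPoly.empCoeff_eq (hu : IsTrigPoly u S c) {n : ℕ} (X : Fin n → ℝ) :
    empCoeff u X = 1 / n * ∑ m, u (X m) := by
  rw [empCoeff, hu.finsum_freqs (fun z l => conj z * empFourier X l) (by simp)]
  have : ∑ l ∈ S, conj (c l) * empFourier X l = ((1 / n * ∑ m, u (X m) : ℝ) : ℂ) := by
    push_cast
    simp_rw [hu.conj_eq, empFourier, Finset.mul_sum]
    rw [Finset.sum_comm]
    refine Finset.sum_congr rfl fun m _ => Finset.sum_congr rfl fun l _ => by ring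
  rw [this, Complex.ofReal_re]

lemma IsTrigPoly.empVar_eq (hu : IsTrigPoly u S c) {n : ℕ} (X : Fin n → ℝ) :
    empVar u X = 1 / (n : ℝ) ^ 2 * ∑ m, u (X m) ^ 2 := by
  rw [empVar]
  simp_rw [hu.finsum_exp_eq, Complex.norm_real, Real.norm_eq_abs, sq_abs]

lemma IsTrigPoly.coeff_eq (hu : IsTrigPoly u S c) {f : ℝ → ℝ} (hf : Integrable f unitVolume) :
    (coeff f u : ℂ) = ∑ l ∈ S, conj (c l) * fourierCoef f l := by
  rw [coeff, ← integral_complex_ofReal]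
  simp_rw [fourierCoef, ← integral_const_mul]
  rw [← integral_finsetSum _ fun l _ => (integrable_mul_exp hf l).const_mul _]
  congr 1
  funext x
  rw [Complex.ofReal_mul, hu.conj_eq x, Finset.mul_sum]
  exact Finset.sum_congr rfl fun l _ => by ring

/-- If the Fourier coefficients of `f` are absolutely summable, then `∫ f u²` is at most a constant
times the energy of `u`. This replaces a bound on the supremum of `f`. -/
lemma IsTrigPoly.integral_mul_sq_le (hu : IsTrigPoly u S c) {f : ℝ → ℝ}
    (hf : Integrable f unitVolume) {M : ℝ}
    (hM : ∀ T : Finset ℤ, ∑ l ∈ T, ‖fourierCoef f l‖ ≤ M) :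
    ∫ x, f x * u x ^ 2 ∂unitVolume ≤ M * ∑ l ∈ S, ‖c l‖ ^ 2 := by
  have h1 : ((∫ x, f x * u x ^ 2 ∂unitVolume : ℝ) : ℂ)
      = ∑ l ∈ S, ∑ m ∈ S, c l * conj (c m) * fourierCoef f (m - l) := by
    rw [← integral_complex_ofReal]
    simp_rw [fourierCoef, ← integral_const_mul]
    have hint : ∀ l m : ℤ, Integrable (fun x : ℝ => c l * conj (c m) * ((f x : ℂ) *
        Complex.exp (-(2 * Real.pi * Complex.I * ((m - l : ℤ) : ℂ) * x)))) unitVolume :=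
      fun l m => (integrable_mul_exp hf _).const_mul _
    simp_rw [← integral_finsetSum _ fun m _ => hint _ m]
    rw [← integral_finsetSum _ fun l _ => integrable_finsetSum _ fun m _ => hint l m]
    congr 1
    funext x
    rw [Complex.ofReal_mul, Complex.ofReal_pow, sq]
    nth_rw 1 [hu x]
    rw [hu.conj_eq x, Finset.sum_mul_sum, Finset.mul_sum]
    refine Finset.sum_congr rfl fun l _ => ?_
    rw [Finset.mul_sum]
    refine Finset.sum_congr rfl fun m _ => ?_
    have : Complex.exp (-(2 * Real.pi * Complex.I * ((m - l : ℤ) : ℂ) * x))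
        = Complex.exp (2 * Real.pi * Complex.I * l * x) *
          Complex.exp (-(2 * Real.pi * Complex.I * m * x)) := by
      rw [← Complex.exp_add]; congr 1; push_cast; ring
    rw [this]; ring
  have hrow : ∀ l : ℤ, ∑ m ∈ S, ‖fourierCoef f (m - l)‖ ≤ M := fun l => by
    rw [← Finset.sum_image (s := S) (g := fun m : ℤ => m - l) (f := fun d => ‖fourierCoef f d‖)
      (fun a _ b _ h => by simpa using h)]
    exact hM _
  have hcol : ∀ m : ℤ, ∑ l ∈ S, ‖fourierCoef f (m - l)‖ ≤ M := fun m => by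
    rw [← Finset.sum_image (s := S) (g := fun l : ℤ => m - l) (f := fun d => ‖fourierCoef f d‖)
      (fun a _ b _ h => by simpa using h)]
    exact hM _
  calc ∫ x, f x * u x ^ 2 ∂unitVolume
      ≤ ‖((∫ x, f x * u x ^ 2 ∂unitVolume : ℝ) : ℂ)‖ := by
        rw [Complex.norm_real]; exact le_abs_self _
    _ ≤ ∑ l ∈ S, ∑ m ∈ S, ‖c l * conj (c m) * fourierCoef f (m - l)‖ := by
        rw [h1]
        exact (norm_sum_le _ _).trans (Finset.sum_le_sum fun l _ => norm_sum_le _ _)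
    _ ≤ ∑ l ∈ S, ∑ m ∈ S, (‖c l‖ ^ 2 / 2 * ‖fourierCoef f (m - l)‖
          + ‖c m‖ ^ 2 / 2 * ‖fourierCoef f (m - l)‖) := by
        refine Finset.sum_le_sum fun l _ => Finset.sum_le_sum fun m _ => ?_
        rw [norm_mul, norm_mul, RCLike.norm_conj, ← add_mul]
        refine mul_le_mul_of_nonneg_right ?_ (norm_nonneg _)
        nlinarith [sq_nonneg (‖c l‖ - ‖c m‖)]
    _ = ∑ l ∈ S, ‖c l‖ ^ 2 / 2 * ∑ m ∈ S, ‖fourierCoef f (m - l)‖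
          + ∑ m ∈ S, ‖c m‖ ^ 2 / 2 * ∑ l ∈ S, ‖fourierCoef f (m - l)‖ := by
        simp_rw [Finset.sum_add_distrib, Finset.mul_sum]
        congr 1
        exact Finset.sum_comm
    _ ≤ ∑ l ∈ S, ‖c l‖ ^ 2 / 2 * M + ∑ m ∈ S, ‖c m‖ ^ 2 / 2 * M := by
        gcongr with l _ m _
        · exact hrow l
        · exact hcol m
    _ = M * ∑ l ∈ S, ‖c l‖ ^ 2 := by
        rw [← Finset.sum_mul, ← Finset.sum_div]; ring

/-! ### Size of the atoms -/

variable {g : ℝ → ℂ}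

lemma IsBandWindow.norm_atomCoef_le (hg : IsBandWindow g) (j k : ℕ) (l : ℤ) :
    ‖atomCoef g j k l‖ ≤ 2 * (2 : ℝ) ^ (-((j : ℝ) / 2)) := by
  have h1 : ‖Complex.exp (-(2 * Real.pi * Complex.I * l * k / 2 ^ j))‖ = 1 := by
    have : -(2 * Real.pi * Complex.I * l * k / 2 ^ j : ℂ)
        = ((-(2 * Real.pi * l * k / 2 ^ j) : ℝ) : ℂ) * Complex.I := by push_cast; ring
    rw [this, Complex.norm_exp_ofReal_mul_I]
  have h2 : (0 : ℝ) ≤ (2 : ℝ) ^ (-((j : ℝ) / 2)) := by positivity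
  rw [atomCoef, norm_mul, norm_mul, h1, mul_one, Complex.norm_real, Real.norm_eq_abs,
    abs_of_nonneg h2, mul_comm]
  exact mul_le_mul_of_nonneg_right (hg.norm_le _) h2

lemma card_freqBox_le (j : ℕ) : ((freqBox j).card : ℝ) ≤ 5 * 2 ^ j := by
  have h : ((freqBox j).card : ℤ) = 4 * 2 ^ j + 1 := by
    rw [freqBox, Int.card_Icc, Int.toNat_of_nonneg]
    · ring
    · have : (0 : ℤ) < 2 ^ j := by positivity
      linarith
  have h' : ((freqBox j).card : ℝ) = 4 * 2 ^ j + 1 := by exact_mod_cast h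
  have : (1 : ℝ) ≤ 2 ^ j := one_le_pow₀ (by norm_num)
  linarith

lemma IsBandWindow.sum_sq_atomCoef_le (hg : IsBandWindow g) (j k : ℕ) :
    ∑ l ∈ freqBox j, ‖atomCoef g j k l‖ ^ 2 ≤ 20 := by
  have h2 : ((2 : ℝ) ^ (-((j : ℝ) / 2))) ^ 2 * 2 ^ j = 1 := by
    rw [← Real.rpow_natCast 2 j, ← Real.rpow_natCast _ 2, ← Real.rpow_mul (by norm_num),
      ← Real.rpow_add (by norm_num)]
    convert Real.rpow_zero 2 using 2
    push_cast; ring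
  calc _ ≤ (freqBox j).card • (2 * (2 : ℝ) ^ (-((j : ℝ) / 2))) ^ 2 :=
        Finset.sum_le_card_nsmul _ _ _ fun l _ =>
          pow_le_pow_left₀ (norm_nonneg _) (hg.norm_atomCoef_le j k l) 2
    _ ≤ 5 * 2 ^ j * (2 * (2 : ℝ) ^ (-((j : ℝ) / 2))) ^ 2 := by
        rw [nsmul_eq_mul]
        exact mul_le_mul_of_nonneg_right (card_freqBox_le j) (by positivity)
    _ = 20 * (((2 : ℝ) ^ (-((j : ℝ) / 2))) ^ 2 * 2 ^ j) := by ring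
    _ = 20 := by rw [h2, mul_one]

lemma IsBandWindow.etaSum_sq_le (hg : IsBandWindow g) (j k : ℕ) :
    etaSum (periodize (inverseFT g) j k) ^ 2 ≤ 100 * 2 ^ j := by
  rw [(hg.isTrigPoly j k).etaSum_eq]
  calc _ ≤ ((freqBox j).card : ℝ) * ∑ l ∈ freqBox j, ‖atomCoef g j k l‖ ^ 2 :=
        sq_sum_le_card_mul_sum_sq
    _ ≤ 5 * 2 ^ j * 20 :=
        mul_le_mul (card_freqBox_le j) (hg.sum_sq_atomCoef_le j k)
          (Finset.sum_nonneg fun _ _ => by positivity) (by positivity)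
    _ = 100 * 2 ^ j := by ring

end TrigPoly

/-! ### The wavelet decomposition in `L²` -/

section Decomposition

variable {θ : ℝ → ℝ} {g : ℝ → ℂ} {f : ℝ → ℝ}

lemma IsBandWindow.sum_coeff_sq (hg : IsBandWindow g) (hf : Integrable f unitVolume) {j : ℕ}
    {S : Finset ℤ} (hS : freqBox j ⊆ S) :
    ∑ k ∈ Finset.range (2 ^ j), coeff f (periodize (inverseFT g) j k) ^ 2
      = levelEnergy g j S (fourierCoef f) := by
  refine Finset.sum_congr rfl fun k _ => ?_
  rw [← Finset.sum_subset hS (fun l _ hl => by rw [hg.atomCoef_eq_zero k hl]; simp),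
    ← (hg.isTrigPoly j k).coeff_eq hf, Complex.norm_real, Real.norm_eq_abs, sq_abs]

/-- Energy of the scaling coefficients of level `j`. -/
def scalingEnergy (θ f : ℝ → ℝ) (j : ℕ) : ℝ :=
  ∑ k ∈ Finset.range (2 ^ j), coeff f (phi θ j k) ^ 2

/-- Energy of the wavelet coefficients of level `j`. -/
def waveletEnergy (θ f : ℝ → ℝ) (j : ℕ) : ℝ :=
  ∑ k ∈ Finset.range (2 ^ j), coeff f (psi θ j k) ^ 2

lemma scalingEnergy_eq (hθ : IsMeyerWindow θ) (hf : Integrable f unitVolume) {j : ℕ}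
    {S : Finset ℤ} (hS : freqBox j ⊆ S) :
    scalingEnergy θ f j = levelEnergy (fun ω => (θ ω : ℂ)) j S (fourierCoef f) :=
  hθ.isBandWindow.sum_coeff_sq hf hS

lemma waveletEnergy_eq (hθ : IsMeyerWindow θ) (hf : Integrable f unitVolume) {j : ℕ}
    {S : Finset ℤ} (hS : freqBox j ⊆ S) :
    waveletEnergy θ f j = levelEnergy (waveletFT θ) j S (fourierCoef f) :=
  hθ.isBandWindow_waveletFT.sum_coeff_sq hf hS

lemma freqBox_mono : Monotone freqBox := fun i j hij l hl => by
  rw [mem_freqBox] at hl ⊢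
  have : (2 : ℤ) ^ i ≤ 2 ^ j := pow_le_pow_right₀ (by norm_num) hij
  linarith

lemma scalingEnergy_add (hθ : IsMeyerWindow θ) (hf : Integrable f unitVolume) (j i : ℕ) :
    scalingEnergy θ f (j + i)
      = scalingEnergy θ f j + ∑ r ∈ Finset.range i, waveletEnergy θ f (j + r) := by
  rw [scalingEnergy_eq hθ hf (Finset.Subset.refl _), hθ.levelEnergy_add,
    scalingEnergy_eq hθ hf (freqBox_mono (Nat.le_add_right j i))]
  congr 1
  refine Finset.sum_congr rfl fun r hr => (waveletEnergy_eq hθ hf (freqBox_mono ?_)).symm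
  have := Finset.mem_range.1 hr
  omega

lemma scalingEnergy_le_sum (hθ : IsMeyerWindow θ) (hf : Integrable f unitVolume) (j : ℕ) :
    scalingEnergy θ f j ≤ ∑ l ∈ freqBox j, ‖fourierCoef f l‖ ^ 2 := by
  rw [scalingEnergy_eq hθ hf (Finset.Subset.refl _)]
  exact levelEnergy_le hθ _ _ _

lemma scalingEnergy_le (hθ : IsMeyerWindow θ) (hf : MemLp f 2 unitVolume) (j : ℕ) :
    scalingEnergy θ f j ≤ ∫ x, f x ^ 2 ∂unitVolume :=
  (scalingEnergy_le_sum hθ (integrable_of_memLp_two hf) j).trans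
    (sum_le_hasSum _ (fun _ _ => by positivity) (hasSum_sq_fourierCoef hf))

/-- Completeness: if the wavelet energies above level `j` sum to at most `B`, every finite part of
the Fourier energy is at most the scaling energy of level `j` plus `B`. -/
lemma sum_sq_fourierCoef_le (hθ : IsMeyerWindow θ) (hf : Integrable f unitVolume) {j : ℕ} {B : ℝ}
    (hB : ∀ i, ∑ r ∈ Finset.range i, waveletEnergy θ f (j + r) ≤ B) (T : Finset ℤ) :
    ∑ l ∈ T, ‖fourierCoef f l‖ ^ 2 ≤ scalingEnergy θ f j + B := by
  obtain ⟨i, hi⟩ := exists_freq_bound T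
  have hi' : ∀ l ∈ T, 3 * |l| ≤ 2 ^ (j + i) := fun l hl =>
    (hi l hl).trans (pow_le_pow_right₀ (by norm_num) (Nat.le_add_left i j))
  calc ∑ l ∈ T, ‖fourierCoef f l‖ ^ 2
      ≤ ∑ l ∈ freqBox (j + i) with 3 * |l| ≤ 2 ^ (j + i), ‖fourierCoef f l‖ ^ 2 := by
        refine Finset.sum_le_sum_of_subset_of_nonneg (fun l hl => ?_) fun _ _ _ => by positivity
        rw [Finset.mem_filter, mem_freqBox]
        have := hi' l hl
        have h0 := abs_nonneg l
        exact ⟨by linarith, this⟩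
    _ ≤ scalingEnergy θ f (j + i) := by
        rw [scalingEnergy_eq hθ hf (Finset.Subset.refl _)]
        exact sum_low_le_levelEnergy hθ _ _ _
    _ ≤ scalingEnergy θ f j + B := by
        rw [scalingEnergy_add hθ hf]; linarith [hB i]

lemma integral_sq_le_scalingEnergy_add (hθ : IsMeyerWindow θ) (hf : MemLp f 2 unitVolume) {j : ℕ}
    {B : ℝ} (hB : ∀ i, ∑ r ∈ Finset.range i, waveletEnergy θ f (j + r) ≤ B) :
    ∫ x, f x ^ 2 ∂unitVolume ≤ scalingEnergy θ f j + B :=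
  hasSum_le_of_sum_le (hasSum_sq_fourierCoef hf)
    fun T => sum_sq_fourierCoef_le hθ (integrable_of_memLp_two hf) hB T

/-- The Fourier energy outside the frequencies of level `j` is carried by the wavelets above that
level, because the scaling functions of level `j` see no other frequencies. -/
lemma sum_high_sq_fourierCoef_le (hθ : IsMeyerWindow θ) (hf : Integrable f unitVolume) {j : ℕ}
    {B : ℝ} (hB : ∀ i, ∑ r ∈ Finset.range i, waveletEnergy θ f (j + r) ≤ B) {T : Finset ℤ}
    (hT : Disjoint T (freqBox j)) : ∑ l ∈ T, ‖fourierCoef f l‖ ^ 2 ≤ B := by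
  have h1 := sum_sq_fourierCoef_le hθ hf hB (T ∪ freqBox j)
  have h2 := scalingEnergy_le_sum hθ hf j
  rw [Finset.sum_union hT] at h1
  linarith

/-- Synthesis from a family that satisfies Bessel's inequality. No orthonormality is needed: the
synthesis operator is the adjoint of the analysis operator, hence a contraction. -/
lemma integral_sq_synthesis_sub_le {ι : Type*} (F : Finset ι) (e : ι → ℝ → ℝ)
    (he : ∀ i, MemLp (e i) 2 unitVolume)
    (bessel : ∀ h, MemLp h 2 unitVolume →
      ∑ i ∈ F, coeff h (e i) ^ 2 ≤ ∫ x, h x ^ 2 ∂unitVolume)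
    (hf : MemLp f 2 unitVolume) (a : ι → ℝ) :
    ∫ x, (∑ i ∈ F, a i * e i x - f x) ^ 2 ∂unitVolume
      ≤ ∑ i ∈ F, (a i - coeff f (e i)) ^ 2
        + (∫ x, f x ^ 2 ∂unitVolume - ∑ i ∈ F, coeff f (e i) ^ 2) := by
  set P : ℝ → ℝ := fun x => ∑ i ∈ F, a i * e i x with hP
  have hPm : MemLp P 2 unitVolume := memLp_finsetSum _ fun i _ => (he i).const_mul (a i)
  have hint : ∀ h, MemLp h 2 unitVolume →
      ∫ x, h x * P x ∂unitVolume = ∑ i ∈ F, a i * coeff h (e i) := by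
    intro h hh
    simp_rw [hP, Finset.mul_sum, coeff, ← integral_const_mul]
    rw [integral_finsetSum]
    · refine Finset.sum_congr rfl fun i _ => ?_
      congr 1; funext x; ring
    · intro i _
      exact MemLp.integrable_mul hh ((he i).const_mul (a i))
  have hP2 : ∫ x, P x ^ 2 ∂unitVolume ≤ ∑ i ∈ F, a i ^ 2 := by
    have h1 : ∫ x, P x ^ 2 ∂unitVolume = ∑ i ∈ F, a i * coeff P (e i) := by
      rw [← hint P hPm]; congr 1; funext x; ring
    have h2 : ∑ i ∈ F, a i * coeff P (e i)
        ≤ ∑ i ∈ F, (a i ^ 2 / 2 + coeff P (e i) ^ 2 / 2) :=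
      Finset.sum_le_sum fun i _ => by nlinarith [sq_nonneg (a i - coeff P (e i))]
    rw [Finset.sum_add_distrib, ← Finset.sum_div, ← Finset.sum_div] at h2
    have h3 := bessel P hPm
    linarith
  have hexp : ∫ x, (P x - f x) ^ 2 ∂unitVolume
      = ∫ x, P x ^ 2 ∂unitVolume - 2 * ∫ x, f x * P x ∂unitVolume
        + ∫ x, f x ^ 2 ∂unitVolume := by
    have i1 : Integrable (fun x => P x ^ 2) unitVolume := hPm.integrable_sq
    have i2 : Integrable (fun x => 2 * (f x * P x)) unitVolume :=
      (MemLp.integrable_mul hf hPm).const_mul 2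
    have i3 : Integrable (fun x => f x ^ 2) unitVolume := hf.integrable_sq
    have i12 : Integrable (fun x => P x ^ 2 - 2 * (f x * P x)) unitVolume := i1.sub i2
    rw [← integral_const_mul, ← integral_sub i1 i2, ← integral_add i12 i3]
    congr 1; funext x; ring
  have hsq : ∑ i ∈ F, (a i - coeff f (e i)) ^ 2
      = ∑ i ∈ F, a i ^ 2 - 2 * ∑ i ∈ F, a i * coeff f (e i) + ∑ i ∈ F, coeff f (e i) ^ 2 := by
    rw [Finset.mul_sum, ← Finset.sum_sub_distrib, ← Finset.sum_add_distrib]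
    exact Finset.sum_congr rfl fun i _ => by ring
  rw [hexp, hint f hf, hsq]
  linarith

/-- Squared `L²` distance between `f` and a finite wavelet series, in terms of coefficients. -/
lemma integral_sq_wavelet_series_sub_le (hθ : IsMeyerWindow θ) (hf : MemLp f 2 unitVolume)
    {j₀ j₁ : ℕ} (hj : j₀ ≤ j₁ + 1) {B : ℝ}
    (hB : ∀ i, ∑ r ∈ Finset.range i, waveletEnergy θ f (j₁ + 1 + r) ≤ B)
    (a : ℕ → ℝ) (b : ℕ → ℕ → ℝ) :
    ∫ x, (∑ k ∈ Finset.range (2 ^ j₀), a k * phi θ j₀ k x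
        + ∑ j ∈ Finset.Icc j₀ j₁, ∑ k ∈ Finset.range (2 ^ j), b j k * psi θ j k x
        - f x) ^ 2 ∂unitVolume
      ≤ ∑ k ∈ Finset.range (2 ^ j₀), (a k - coeff f (phi θ j₀ k)) ^ 2
        + ∑ j ∈ Finset.Icc j₀ j₁, ∑ k ∈ Finset.range (2 ^ j), (b j k - coeff f (psi θ j k)) ^ 2
        + B := by
  let F : Finset (ℕ ⊕ (_ : ℕ) × ℕ) := (Finset.range (2 ^ j₀)).disjSum
    ((Finset.Icc j₀ j₁).sigma fun j => Finset.range (2 ^ j))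
  let e : ℕ ⊕ (_ : ℕ) × ℕ → ℝ → ℝ := Sum.elim (fun k => phi θ j₀ k) (fun q => psi θ q.1 q.2)
  let w : ℕ ⊕ (_ : ℕ) × ℕ → ℝ := Sum.elim a (fun q => b q.1 q.2)
  have hF : ∀ G : ℕ ⊕ (_ : ℕ) × ℕ → ℝ, ∑ i ∈ F, G i
      = ∑ k ∈ Finset.range (2 ^ j₀), G (Sum.inl k)
        + ∑ j ∈ Finset.Icc j₀ j₁, ∑ k ∈ Finset.range (2 ^ j), G (Sum.inr ⟨j, k⟩) := by
    intro G
    rw [Finset.sum_disjSum, Finset.sum_sigma]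
  have henergy : ∀ h, MemLp h 2 unitVolume →
      ∑ i ∈ F, coeff h (e i) ^ 2 = scalingEnergy θ h (j₁ + 1) := by
    intro h hh
    obtain ⟨i, hi⟩ := Nat.exists_eq_add_of_le hj
    rw [hF, hi, scalingEnergy_add hθ (integrable_of_memLp_two hh)]
    congr 1
    rw [← Finset.sum_image (s := Finset.range i) (g := fun r => j₀ + r)
      (f := fun j => waveletEnergy θ h j) (fun a _ b _ h => by simpa using h)]
    refine Finset.sum_congr ?_ fun j _ => rfl
    ext j
    simp only [Finset.mem_Icc, Finset.mem_image, Finset.mem_range]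
    constructor
    · rintro ⟨h1, h2⟩; exact ⟨j - j₀, by omega, by omega⟩
    · rintro ⟨r, h1, rfl⟩; omega
  have he : ∀ i, MemLp (e i) 2 unitVolume := by
    rintro (k | q)
    · exact (hθ.isBandWindow.isTrigPoly j₀ k).memLp
    · exact (hθ.isBandWindow_waveletFT.isTrigPoly q.1 q.2).memLp
  have key := integral_sq_synthesis_sub_le F e he
    (fun h hh => (henergy h hh).trans_le (scalingEnergy_le hθ hh _)) hf w
  rw [henergy f hf] at key
  simp_rw [hF] at key
  have hfB := integral_sq_le_scalingEnergy_add hθ hf hB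
  refine (key.trans ?_)
  simp only [e, w, Sum.elim_inl, Sum.elim_inr]
  linarith

/-! ### Besov balls -/

/-- What membership in the Besov ball says about one level: the index `q` plays no further role. -/
lemma sum_rpow_coeff_le {J : ℕ} {s p q A : ℝ} (hp : 0 < p) (hq : 0 < q) (hA : 0 ≤ A)
    (hf : f ∈ besovBall θ J s p q A) {j : ℕ} (hj : J ≤ j) :
    ∑ k ∈ Finset.range (2 ^ j), |coeff f (psi θ j k)| ^ p
      ≤ (A * (2 : ℝ) ^ (-(j * (s + 1 / 2 - 1 / p)))) ^ p := by
  obtain ⟨i, rfl⟩ := Nat.exists_eq_add_of_le hj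
  set W : ℝ := ∑ k ∈ Finset.range (2 ^ (J + i)), |coeff f (psi θ (J + i) k)| ^ p with hW
  have hW0 : 0 ≤ W := Finset.sum_nonneg fun _ _ => by positivity
  set b : ℝ := s + 1 / 2 - 1 / p with hb
  have h1 := (le_add_self).trans hf.2
  rw [one_div q, ENNReal.rpow_inv_le_iff hq] at h1
  have h2 := (ENNReal.le_tsum i).trans h1
  have hsum : (∑ k ∈ Finset.range (2 ^ (J + i)),
      ENNReal.ofReal |coeff f (psi θ (J + i) k)| ^ p) = ENNReal.ofReal W := by
    rw [hW, ENNReal.ofReal_sum_of_nonneg fun _ _ => by positivity]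
    exact Finset.sum_congr rfl fun k _ => ENNReal.ofReal_rpow_of_nonneg (abs_nonneg _) hp.le
  rw [hsum, ENNReal.ofReal_rpow_of_nonneg hW0 (by positivity),
    ENNReal.ofReal_rpow_of_nonneg hA hq.le, ← ENNReal.ofReal_mul (by positivity),
    ENNReal.ofReal_le_ofReal_iff (by positivity)] at h2
  have h3 : (2 : ℝ) ^ (((J + i : ℕ) : ℝ) * b * q) * W ^ (q / p)
      = ((2 : ℝ) ^ (((J + i : ℕ) : ℝ) * b) * W ^ (1 / p)) ^ q := by
    rw [Real.mul_rpow (by positivity) (by positivity), ← Real.rpow_mul (by norm_num),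
      ← Real.rpow_mul hW0]
    congr 2; ring
  rw [h3, Real.rpow_le_rpow_iff (by positivity) hA hq] at h2
  have h4 : W ^ (1 / p) ≤ A * (2 : ℝ) ^ (-(((J + i : ℕ) : ℝ) * b)) := by
    rw [Real.rpow_neg (by norm_num), ← div_eq_mul_inv, le_div_iff₀ (by positivity), mul_comm]
    exact h2
  calc W = (W ^ (1 / p)) ^ p := by
        rw [← Real.rpow_mul hW0, one_div, inv_mul_cancel₀ hp.ne', Real.rpow_one]
    _ ≤ _ := Real.rpow_le_rpow (by positivity) h4 hp.le

/-- For `p ≤ 2` the `ℓ²` norm is at most the `ℓᵖ` norm. -/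
lemma sum_sq_le_of_sum_rpow_le {ι : Type*} {F : Finset ι} {b : ι → ℝ} {p K : ℝ} (hp : 0 < p)
    (hp2 : p ≤ 2) (hK : 0 ≤ K) (h : ∑ i ∈ F, |b i| ^ p ≤ K ^ p) : ∑ i ∈ F, b i ^ 2 ≤ K ^ 2 := by
  have hi : ∀ i ∈ F, |b i| ≤ K := fun i hi => by
    refine (Real.rpow_le_rpow_iff (abs_nonneg _) hK hp).1 (le_trans ?_ h)
    exact Finset.single_le_sum (f := fun i => |b i| ^ p) (fun _ _ => by positivity) hi
  have hsplit : ∀ x : ℝ, 0 ≤ x → x ^ p * x ^ (2 - p) = x ^ 2 := fun x hx => by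
    rcases hx.eq_or_lt with rfl | hx
    · rw [Real.zero_rpow hp.ne']; simp
    · rw [← Real.rpow_add hx, ← Real.rpow_natCast]; congr 1; push_cast; ring
  calc ∑ i ∈ F, b i ^ 2 ≤ ∑ i ∈ F, |b i| ^ p * K ^ (2 - p) := by
        refine Finset.sum_le_sum fun i hi' => ?_
        rw [← sq_abs, ← hsplit _ (abs_nonneg _)]
        exact mul_le_mul_of_nonneg_left
          (Real.rpow_le_rpow (abs_nonneg _) (hi i hi') (by linarith)) (by positivity)
    _ ≤ K ^ p * K ^ (2 - p) := by
        rw [← Finset.sum_mul]; exact mul_le_mul_of_nonneg_right h (by positivity)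
    _ = K ^ 2 := hsplit K hK

lemma waveletEnergy_le {J : ℕ} {s p q A : ℝ} (hp : 0 < p) (hp2 : p ≤ 2) (hq : 0 < q) (hA : 0 ≤ A)
    (hf : f ∈ besovBall θ J s p q A) {j : ℕ} (hj : J ≤ j) :
    waveletEnergy θ f j ≤ A ^ 2 * ((2 : ℝ) ^ (-(2 * (s + 1 / 2 - 1 / p)))) ^ j := by
  refine (sum_sq_le_of_sum_rpow_le hp hp2 (by positivity)
    (sum_rpow_coeff_le hp hq hA hf hj)).trans_eq ?_
  rw [mul_pow, ← Real.rpow_natCast (2 ^ _) 2, ← Real.rpow_natCast _ j,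
    ← Real.rpow_mul (by norm_num), ← Real.rpow_mul (by norm_num)]
  congr 2; push_cast; ring

lemma sum_geometric_le {r : ℝ} (h0 : 0 ≤ r) (h1 : r < 1) (i : ℕ) :
    ∑ k ∈ Finset.range i, r ^ k ≤ 1 / (1 - r) := by
  rw [one_div, ← tsum_geometric_of_lt_one h0 h1]
  exact (summable_geometric_of_lt_one h0 h1).sum_le_tsum _ fun _ _ => by positivity

lemma sum_waveletEnergy_le {J : ℕ} {s p q A : ℝ} (hp : 0 < p) (hp2 : p ≤ 2) (hq : 0 < q)
    (hA : 0 ≤ A) (hs : 0 < s + 1 / 2 - 1 / p) (hf : f ∈ besovBall θ J s p q A) {j : ℕ}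
    (hj : J ≤ j) (i : ℕ) :
    ∑ r ∈ Finset.range i, waveletEnergy θ f (j + r)
      ≤ A ^ 2 / (1 - (2 : ℝ) ^ (-(2 * (s + 1 / 2 - 1 / p))))
        * ((2 : ℝ) ^ (-(2 * (s + 1 / 2 - 1 / p)))) ^ j := by
  set ρ := (2 : ℝ) ^ (-(2 * (s + 1 / 2 - 1 / p))) with hρ
  have hρ0 : 0 ≤ ρ := by positivity
  have hρ1 : ρ < 1 := Real.rpow_lt_one_of_one_lt_of_neg (by norm_num) (by linarith)
  calc _ ≤ ∑ r ∈ Finset.range i, A ^ 2 * ρ ^ j * ρ ^ r := by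
        refine Finset.sum_le_sum fun r _ =>
          (waveletEnergy_le hp hp2 hq hA hf (by omega)).trans_eq ?_
        rw [← hρ]; ring
    _ ≤ A ^ 2 * ρ ^ j * (1 / (1 - ρ)) := by
        rw [← Finset.mul_sum]
        exact mul_le_mul_of_nonneg_left (sum_geometric_le hρ0 hρ1 i) (by positivity)
    _ = _ := by ring

/-- Densities in the Besov ball have uniformly absolutely summable Fourier coefficients, by the
Cauchy-Schwarz inequality on dyadic blocks. -/
lemma exists_sum_norm_fourierCoef_le (hθ : IsMeyerWindow θ) (J : ℕ) {s p q A : ℝ} (hp : 0 < p)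
    (hp2 : p ≤ 2) (hq : 0 < q) (hA : 0 ≤ A) (hs : 1 / p < s) :
    ∃ M : ℝ, 0 < M ∧ ∀ f ∈ besovDensities θ J s p q A, ∀ T : Finset ℤ,
      ∑ l ∈ T, ‖fourierCoef f l‖ ≤ M := by
  set b := s + 1 / 2 - 1 / p with hb
  set ρ := (2 : ℝ) ^ (-(2 * b)) with hρ
  have hρ0 : 0 ≤ ρ := by positivity
  have hρ1 : ρ < 1 := Real.rpow_lt_one_of_one_lt_of_neg (by norm_num) (by linarith)
  set K := A ^ 2 / (1 - ρ) with hK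
  have hK0 : 0 ≤ K := div_nonneg (by positivity) (by linarith)
  set σ := (2 : ℝ) ^ (1 / 2 - b) with hσ
  have hσ0 : 0 ≤ σ := by positivity
  have hσ1 : σ < 1 := Real.rpow_lt_one_of_one_lt_of_neg (by norm_num) (by linarith)
  have hσρ : 2 * ρ = σ ^ 2 := by
    rw [hσ, hρ, ← Real.rpow_natCast _ 2, ← Real.rpow_mul (by norm_num)]
    nth_rw 1 [← Real.rpow_one 2]
    rw [← Real.rpow_add (by norm_num)]; congr 1; push_cast; ring
  set D := Real.sqrt (10 * K) with hD
  refine ⟨5 * 2 ^ J + D * σ ^ J * (1 / (1 - σ)), ?_, ?_⟩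
  · have : 0 ≤ D * σ ^ J * (1 / (1 - σ)) :=
      mul_nonneg (by positivity) (one_div_nonneg.2 (by linarith))
    positivity
  intro f hf T
  have hfi : Integrable f unitVolume := integrable_of_memLp_two hf.1.1
  have hf1 : ∫ x, |f x| ∂unitVolume = 1 := by
    rw [← hf.1.2.2]
    exact integral_congr_ae (hf.1.2.1.mono fun x hx => abs_of_nonneg hx)
  have hblock : ∀ r : ℕ, ∑ l ∈ freqBox (J + r + 1) \ freqBox (J + r), ‖fourierCoef f l‖
      ≤ D * σ ^ J * σ ^ r := by
    intro r
    have h1 : ∑ l ∈ freqBox (J + r + 1) \ freqBox (J + r), ‖fourierCoef f l‖ ^ 2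
        ≤ K * ρ ^ (J + r) := sum_high_sq_fourierCoef_le hθ hfi
      (fun i => sum_waveletEnergy_le hp hp2 hq hA (by linarith) hf.2 (by omega) i)
      Finset.sdiff_disjoint
    have h2 : ((freqBox (J + r + 1) \ freqBox (J + r)).card : ℝ) ≤ 10 * 2 ^ (J + r) := by
      refine (Nat.cast_le.2 (Finset.card_le_card Finset.sdiff_subset)).trans
        ((card_freqBox_le _).trans_eq ?_)
      ring
    refine le_of_sq_le_sq ?_ (by positivity)
    calc _ ≤ ((freqBox (J + r + 1) \ freqBox (J + r)).card : ℝ) *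
          ∑ l ∈ freqBox (J + r + 1) \ freqBox (J + r), ‖fourierCoef f l‖ ^ 2 :=
          sq_sum_le_card_mul_sum_sq
      _ ≤ 10 * 2 ^ (J + r) * (K * ρ ^ (J + r)) :=
          mul_le_mul h2 h1 (Finset.sum_nonneg fun _ _ => by positivity) (by positivity)
      _ = (10 * K) * (2 * ρ) ^ (J + r) := by rw [mul_pow]; ring
      _ = (D * σ ^ J * σ ^ r) ^ 2 := by
          rw [hσρ, ← Real.sq_sqrt (by positivity : 0 ≤ 10 * K)]; ring
  have hbox : ∀ i : ℕ, ∑ l ∈ freqBox (J + i), ‖fourierCoef f l‖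
      ≤ 5 * 2 ^ J + ∑ r ∈ Finset.range i, D * σ ^ J * σ ^ r := by
    intro i
    induction i with
    | zero =>
      simp only [add_zero, Finset.range_zero, Finset.sum_empty]
      refine (Finset.sum_le_card_nsmul _ _ 1 fun l _ => ?_).trans ?_
      · exact (norm_fourierCoef_le l).trans_eq hf1
      · rw [nsmul_eq_mul, mul_one]; exact card_freqBox_le J
    | succ i ih =>
      rw [Finset.sum_range_succ, ← add_assoc, ← add_assoc,
        ← Finset.sum_sdiff (freqBox_mono (Nat.le_succ (J + i)))]
      linarith [hblock i]
  obtain ⟨i, hi⟩ := exists_freq_bound T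
  calc ∑ l ∈ T, ‖fourierCoef f l‖ ≤ ∑ l ∈ freqBox (J + i), ‖fourierCoef f l‖ := by
        refine Finset.sum_le_sum_of_subset_of_nonneg (fun l hl => ?_) fun _ _ _ => norm_nonneg _
        rw [mem_freqBox]
        have h1 := hi l hl
        have h2 : (2 : ℤ) ^ i ≤ 2 ^ (J + i) :=
          pow_le_pow_right₀ (by norm_num) (Nat.le_add_left i J)
        have h0 := abs_nonneg l
        linarith
    _ ≤ _ := hbox i
    _ ≤ _ := by
        rw [← Finset.mul_sum]
        gcongr
        exact sum_geometric_le hσ0 hσ1 i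

end Decomposition

/-! ### Concentration of empirical means -/

section Concentration

/-- The exponential series is dominated by a geometric one, as `(k + 2)! ≥ 2 * 3 ^ k`. -/
lemma exp_le_of_abs_le {x y : ℝ} (hxy : |x| ≤ y) (hy : y < 3) :
    Real.exp x ≤ 1 + x + x ^ 2 / (2 * (1 - y / 3)) := by
  have hy0 : 0 ≤ y := (abs_nonneg x).trans hxy
  have h1 : HasSum (fun k : ℕ => x ^ k / k.factorial) (Real.exp x) := by
    rw [Real.exp_eq_exp_ℝ]; exact NormedSpace.expSeries_div_hasSum_exp x
  have h2 := (hasSum_nat_add_iff' 2).2 h1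
  have h3 : HasSum (fun k : ℕ => x ^ 2 / 2 * (y / 3) ^ k) (x ^ 2 / 2 * (1 - y / 3)⁻¹) :=
    (hasSum_geometric_of_lt_one (by positivity) (by linarith)).mul_left _
  have h4 := hasSum_le (fun k => ?_) h2 h3
  · simp only [Finset.sum_range_succ, Finset.sum_range_zero, pow_zero, pow_one, Nat.factorial,
      Nat.cast_one] at h4
    have : x ^ 2 / 2 * (1 - y / 3)⁻¹ = x ^ 2 / (2 * (1 - y / 3)) := by
      rw [div_mul_eq_div_div, div_eq_mul_inv (x ^ 2 / 2)]
    rw [this] at h4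
    simp at h4
    linarith
  · have hf : (2 * 3 ^ k : ℝ) ≤ ((k + 2).factorial : ℝ) := by
      induction k with
      | zero => simp
      | succ k ih =>
        rw [show k + 1 + 2 = (k + 2) + 1 by ring, Nat.factorial_succ]
        push_cast
        rw [pow_succ]
        nlinarith [(Nat.cast_nonneg k : (0 : ℝ) ≤ k), ih,
          (by positivity : (0 : ℝ) ≤ 2 * 3 ^ k)]
    have hn : x ^ (k + 2) ≤ x ^ 2 * y ^ k := by
      calc x ^ (k + 2) ≤ |x ^ (k + 2)| := le_abs_self _
        _ = x ^ 2 * |x| ^ k := by rw [pow_add, abs_mul, abs_pow, abs_of_nonneg (sq_nonneg x)]; ring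
        _ ≤ _ := by gcongr
    calc x ^ (k + 2) / ((k + 2).factorial : ℝ) ≤ x ^ 2 * y ^ k / ((k + 2).factorial : ℝ) := by
          gcongr
      _ ≤ x ^ 2 * y ^ k / (2 * 3 ^ k) := by gcongr
      _ = x ^ 2 / 2 * (y / 3) ^ k := by rw [div_pow]; field_simp

lemma exp_neg_le_of_nonneg {x : ℝ} (hx : 0 ≤ x) : Real.exp (-x) ≤ 1 - x + x ^ 2 / 2 := by
  have h := Real.quadratic_le_exp_of_nonneg hx
  have h0 : 0 < 1 + x + x ^ 2 / 2 := by positivity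
  rw [Real.exp_neg, inv_le_comm₀ (Real.exp_pos x) (by nlinarith [sq_nonneg (x - 1)])]
  refine le_trans ?_ h
  rw [inv_le_iff_one_le_mul₀ (by nlinarith [sq_nonneg (x - 1)])]
  nlinarith [sq_nonneg (x ^ 2)]

variable {Ω : Type*} [MeasurableSpace Ω] {μ : Measure Ω} [IsProbabilityMeasure μ] {Y : Ω → ℝ}

lemma integrable_of_abs_le (hY : Measurable Y) {b : ℝ} (hb : ∀ x, |Y x| ≤ b) : Integrable Y μ :=
  Integrable.of_bound hY.aestronglyMeasurable b (ae_of_all _ hb)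

lemma integrable_sq_of_abs_le (hY : Measurable Y) {b : ℝ} (hb : ∀ x, |Y x| ≤ b) :
    Integrable (fun x => Y x ^ 2) μ :=
  Integrable.of_bound (hY.pow_const 2).aestronglyMeasurable (b ^ 2) (ae_of_all _ fun x => by
    rw [Real.norm_eq_abs, abs_pow]; exact pow_le_pow_left₀ (abs_nonneg _) (hb x) 2)

lemma integrable_exp_of_abs_le (hY : Measurable Y) {b : ℝ} (hb : ∀ x, |Y x| ≤ b) :
    Integrable (fun x => Real.exp (Y x)) μ :=
  Integrable.of_bound hY.exp.aestronglyMeasurable (Real.exp b) (ae_of_all _ fun x => by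
    rw [Real.norm_eq_abs, Real.abs_exp]; exact Real.exp_le_exp.2 ((le_abs_self _).trans (hb x)))

/-- Chernoff's bound for a sum of independent copies of a bounded variable. -/
lemma measure_sum_ge_le {n : ℕ} (hY : Measurable Y) {b : ℝ} (hb : ∀ x, |Y x| ≤ b) {a t M : ℝ}
    (ht : 0 ≤ t) (hM : ∫ x, Real.exp (t * Y x) ∂μ ≤ Real.exp M) :
    (Measure.pi fun _ : Fin n => μ).real {X | a ≤ ∑ m, Y (X m)} ≤ Real.exp (n * M - t * a) := by
  have hsumY : Measurable fun X : Fin n → Ω => t * ∑ m, Y (X m) :=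
    (Finset.measurable_sum _ fun m _ => hY.comp (measurable_pi_apply m)).const_mul t
  have hint : Integrable (fun X : Fin n → Ω => Real.exp (t * ∑ m, Y (X m)))
      (Measure.pi fun _ : Fin n => μ) := by
    refine integrable_exp_of_abs_le hsumY (b := t * (n * b)) fun X => ?_
    rw [abs_mul, abs_of_nonneg ht]
    refine mul_le_mul_of_nonneg_left ((Finset.abs_sum_le_sum_abs _ _).trans ?_) ht
    refine (Finset.sum_le_card_nsmul _ _ b fun m _ => hb _).trans_eq ?_
    simp
  refine (ProbabilityTheory.measure_ge_le_exp_mul_mgf a ht hint).trans ?_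
  have hmgf : ProbabilityTheory.mgf (fun X : Fin n → Ω => ∑ m, Y (X m))
      (Measure.pi fun _ : Fin n => μ) t = (∫ x, Real.exp (t * Y x) ∂μ) ^ n := by
    rw [ProbabilityTheory.mgf]
    simp_rw [Finset.mul_sum, Real.exp_sum]
    rw [integral_fintype_prod_eq_pow (fun x => Real.exp (t * Y x)), Fintype.card_fin]
  rw [hmgf]
  calc _ ≤ Real.exp (-t * a) * Real.exp M ^ n := by
        gcongr
    _ = _ := by rw [← Real.exp_nat_mul, ← Real.exp_add]; congr 1; ring

/-- **Bernstein's inequality**, upper tail, with the raw second moment and the raw bound of the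
variable. -/
lemma bernstein_upper {n : ℕ} (hn : 0 < n) (hY : Measurable Y) {b v r : ℝ}
    (hb : ∀ x, |Y x| ≤ b) (hv : ∫ x, Y x ^ 2 ∂μ ≤ v) (hv0 : 0 < v) (hr : 0 < r) :
    (Measure.pi fun _ : Fin n => μ).real
      {X | n * ∫ x, Y x ∂μ + Real.sqrt (2 * r * (n * v)) + b * r / 3 ≤ ∑ m, Y (X m)}
      ≤ Real.exp (-r) := by
  have hn' : (0 : ℝ) < n := by exact_mod_cast hn
  obtain ⟨x₀⟩ : Nonempty Ω := nonempty_of_isProbabilityMeasure μ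
  have hb0 : 0 ≤ b := (abs_nonneg _).trans (hb x₀)
  -- the optimal exponent for a sub-gamma variable with variance factor `n v` and scale `b / 3`
  set w := Real.sqrt (2 * r * (n * v)) with hw
  have hw0 : 0 < w := Real.sqrt_pos.2 (by positivity)
  have hw2 : w ^ 2 = 2 * r * (n * v) := Real.sq_sqrt (by positivity)
  set x := 2 * r / w with hx
  have hx0 : 0 < x := by positivity
  set t := x / (1 + b / 3 * x) with ht
  have hd : 0 < 1 + b / 3 * x := by positivity
  have ht0 : 0 < t := by positivity
  have htb : 1 - t * b / 3 = 1 / (1 + b / 3 * x) := by rw [ht]; field_simp; ring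
  have htb3 : t * b < 3 := by
    have : 0 < 1 - t * b / 3 := by rw [htb]; positivity
    linarith
  have hM : ∫ y, Real.exp (t * Y y) ∂μ
      ≤ Real.exp (t * ∫ y, Y y ∂μ + t ^ 2 * v / (2 * (1 - t * b / 3))) := by
    have i1 := integrable_of_abs_le (μ := μ) hY hb
    have i2 := integrable_sq_of_abs_le (μ := μ) hY hb
    have i3 : Integrable (fun y => 1 + t * Y y) μ := (integrable_const 1).add (i1.const_mul t)
    have i4 : Integrable (fun y => t ^ 2 / (2 * (1 - t * b / 3)) * Y y ^ 2) μ := i2.const_mul _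
    have hpt : ∀ y, Real.exp (t * Y y)
        ≤ (1 + t * Y y) + t ^ 2 / (2 * (1 - t * b / 3)) * Y y ^ 2 := by
      intro y
      have := exp_le_of_abs_le (x := t * Y y) (y := t * b)
        (by rw [abs_mul, abs_of_pos ht0]; exact mul_le_mul_of_nonneg_left (hb y) ht0.le) htb3
      refine this.trans_eq ?_
      ring
    have hbd : ∀ y, |t * Y y| ≤ t * b := fun y => by
      rw [abs_mul, abs_of_pos ht0]; exact mul_le_mul_of_nonneg_left (hb y) ht0.le
    calc ∫ y, Real.exp (t * Y y) ∂μ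
        ≤ ∫ y, ((1 + t * Y y) + t ^ 2 / (2 * (1 - t * b / 3)) * Y y ^ 2) ∂μ :=
          integral_mono (integrable_exp_of_abs_le (hY.const_mul t) hbd) (i3.add i4) hpt
      _ = 1 + t * ∫ y, Y y ∂μ + t ^ 2 / (2 * (1 - t * b / 3)) * ∫ y, Y y ^ 2 ∂μ := by
          rw [integral_add i3 i4, integral_add (integrable_const 1) (i1.const_mul t),
            integral_const_mul, integral_const_mul]
          simp
      _ ≤ 1 + t * ∫ y, Y y ∂μ + t ^ 2 / (2 * (1 - t * b / 3)) * v := by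
          have : 0 ≤ t ^ 2 / (2 * (1 - t * b / 3)) := by rw [htb]; positivity
          gcongr
      _ = (t * ∫ y, Y y ∂μ + t ^ 2 * v / (2 * (1 - t * b / 3))) + 1 := by ring
      _ ≤ _ := Real.add_one_le_exp _
  refine (measure_sum_ge_le hY hb ht0.le hM).trans_eq ?_
  congr 1
  have hxw : x * w = 2 * r := by rw [hx]; field_simp
  have hxv : n * v * x ^ 2 = 2 * r := by
    have : n * v = w ^ 2 / (2 * r) := by rw [hw2]; field_simp
    rw [this, div_mul_eq_mul_div, ← mul_pow, mul_comm w, hxw]; field_simp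
  rw [htb]
  have e1 : n * (t ^ 2 * v / (2 * (1 / (1 + b / 3 * x)))) = r / (1 + b / 3 * x) := by
    rw [ht]
    have : n * ((x / (1 + b / 3 * x)) ^ 2 * v / (2 * (1 / (1 + b / 3 * x))))
        = (n * v * x ^ 2) / (2 * (1 + b / 3 * x)) := by field_simp
    rw [this, hxv]; field_simp
  have e2 : t * w = 2 * r / (1 + b / 3 * x) := by
    rw [ht, div_mul_eq_mul_div, hxw]
  have e3 : t * (b * r / 3) = r - r / (1 + b / 3 * x) := by rw [ht]; field_simp; ring
  linear_combination e1 - e2 - e3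

/-- **Bernstein's inequality** for empirical means. -/
lemma bernstein_mean {n : ℕ} (hn : 0 < n) (hY : Measurable Y) {b v r : ℝ}
    (hb : ∀ x, |Y x| ≤ b) (hv : ∫ x, Y x ^ 2 ∂μ ≤ n * v) (hv0 : 0 < v) (hr : 0 < r) :
    (Measure.pi fun _ : Fin n => μ).real
      {X | Real.sqrt (2 * r * v) + b * r / (3 * n) ≤ |1 / n * ∑ m, Y (X m) - ∫ x, Y x ∂μ|}
      ≤ 2 * Real.exp (-r) := by
  have hn' : (0 : ℝ) < n := by exact_mod_cast hn
  have h1 := bernstein_upper hn hY hb hv (by positivity) hr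
  have h2 := bernstein_upper (Y := fun x => -Y x) hn hY.neg (b := b) (v := n * v) (r := r)
    (μ := μ) (fun x => by rw [abs_neg]; exact hb x) (by simpa using hv) (by positivity) hr
  have hsq : Real.sqrt (2 * r * (n * (n * v))) = n * Real.sqrt (2 * r * v) := by
    rw [show 2 * r * (n * (n * v)) = (n : ℝ) ^ 2 * (2 * r * v) by ring,
      Real.sqrt_mul (by positivity), Real.sqrt_sq hn'.le]
  rw [hsq] at h1 h2
  rw [two_mul (Real.exp (-r))]
  refine le_trans (measureReal_mono ?_ (measure_ne_top _ _)) ((measureReal_union_le _ _).trans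
    (add_le_add h1 h2))
  intro X hX
  rw [Set.mem_ofPred_eq] at hX
  have e : b * r / (3 * n) = (b * r / 3) / n := by rw [div_div]
  have e' : 1 / n * ∑ m, Y (X m) - ∫ x, Y x ∂μ
      = (∑ m, Y (X m) - n * ∫ x, Y x ∂μ) / n := by field_simp
  rw [e, e', abs_div, abs_of_pos hn', le_div_iff₀ hn', add_mul, div_mul_cancel₀ _ hn'.ne'] at hX
  rcases le_abs.1 hX with h | h
  · left; rw [Set.mem_ofPred_eq]; linarith
  · right; rw [Set.mem_ofPred_eq, integral_neg, Finset.sum_neg_distrib]; linarith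

/-- A sum of independent nonnegative variables has a sub-Gaussian lower tail. -/
lemma measure_sum_le_le {n : ℕ} (hn : 0 < n) (hY : Measurable Y) {b v r : ℝ}
    (hb : ∀ x, |Y x| ≤ b) (h0 : ∀ x, 0 ≤ Y x) (hv : ∫ x, Y x ^ 2 ∂μ ≤ v) (hv0 : 0 < v)
    (hr : 0 < r) :
    (Measure.pi fun _ : Fin n => μ).real
      {X | ∑ m, Y (X m) ≤ n * ∫ x, Y x ∂μ - Real.sqrt (2 * r * (n * v))} ≤ Real.exp (-r) := by
  have hn' : (0 : ℝ) < n := by exact_mod_cast hn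
  set w := Real.sqrt (2 * r * (n * v)) with hw
  have hw0 : 0 < w := Real.sqrt_pos.2 (by positivity)
  have hw2 : w ^ 2 = 2 * r * (n * v) := Real.sq_sqrt (by positivity)
  set t := 2 * r / w with ht
  have ht0 : 0 < t := by positivity
  have hM : ∫ y, Real.exp (t * -Y y) ∂μ ≤ Real.exp (-t * ∫ y, Y y ∂μ + t ^ 2 / 2 * v) := by
    have i1 := integrable_of_abs_le (μ := μ) hY hb
    have i2 := integrable_sq_of_abs_le (μ := μ) hY hb
    have i3 : Integrable (fun y => 1 + -t * Y y) μ := (integrable_const 1).add (i1.const_mul _)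
    have i4 : Integrable (fun y => t ^ 2 / 2 * Y y ^ 2) μ := i2.const_mul _
    have hbd : ∀ y, |t * -Y y| ≤ t * b := fun y => by
      rw [abs_mul, abs_neg, abs_of_pos ht0]; exact mul_le_mul_of_nonneg_left (hb y) ht0.le
    calc ∫ y, Real.exp (t * -Y y) ∂μ
        ≤ ∫ y, ((1 + -t * Y y) + t ^ 2 / 2 * Y y ^ 2) ∂μ := by
          refine integral_mono (integrable_exp_of_abs_le (hY.neg.const_mul t) hbd) (i3.add i4)
            fun y => ?_
          have := exp_neg_le_of_nonneg (mul_nonneg ht0.le (h0 y))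
          rw [← mul_neg] at this
          refine this.trans_eq ?_
          ring
      _ = 1 + -t * ∫ y, Y y ∂μ + t ^ 2 / 2 * ∫ y, Y y ^ 2 ∂μ := by
          rw [integral_add i3 i4, integral_add (integrable_const 1) (i1.const_mul _),
            integral_const_mul, integral_const_mul]
          simp
      _ ≤ 1 + -t * ∫ y, Y y ∂μ + t ^ 2 / 2 * v := by gcongr
      _ = (-t * ∫ y, Y y ∂μ + t ^ 2 / 2 * v) + 1 := by ring
      _ ≤ _ := Real.add_one_le_exp _
  have key := measure_sum_ge_le (Y := fun x => -Y x) (b := b) (n := n)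
    (a := -(n * ∫ x, Y x ∂μ - w)) hY.neg
    (fun x => by rw [abs_neg]; exact hb x) ht0.le hM
  have hset : {X : Fin n → Ω | ∑ m, Y (X m) ≤ n * ∫ x, Y x ∂μ - w}
      = {X | -(n * ∫ x, Y x ∂μ - w) ≤ ∑ m, -Y (X m)} := by
    ext X
    rw [Set.mem_ofPred_eq, Set.mem_ofPred_eq, Finset.sum_neg_distrib, neg_le_neg_iff]
  rw [hset]
  refine key.trans_eq ?_
  congr 1
  have htw : t * w = 2 * r := by rw [ht]; field_simp
  have htv : n * (t ^ 2 / 2 * v) = r := by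
    have : n * v = w ^ 2 / (2 * r) := by rw [hw2]; field_simp
    rw [show n * (t ^ 2 / 2 * v) = t ^ 2 / 2 * (n * v) by ring, this,
      show t ^ 2 / 2 * (w ^ 2 / (2 * r)) = (t * w) ^ 2 / (4 * r) by ring, htw]
    field_simp; ring
  linear_combination htv - htw

end Concentration

/-! ### The random threshold -/

section Thresholding

lemma two_lt_kappa : 2 < kappa := by
  have : (1 : ℝ) ≤ Real.sqrt (5 / 3) := Real.one_le_sqrt.2 (by norm_num)
  unfold kappa; linarith

lemma kappa_le_four : kappa ≤ 4 := by
  have : Real.sqrt (5 / 3) ≤ 2 := Real.sqrt_le_iff.2 ⟨by norm_num, by norm_num⟩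
  unfold kappa; linarith

lemma le_of_le_add_sqrt {x y a : ℝ} (hx : 0 ≤ x) (hy : 0 ≤ y) (ha : 0 ≤ a)
    (h : x ≤ y + Real.sqrt (2 * a * x)) : x ≤ y + Real.sqrt (2 * a * y) + 2 * a := by
  rw [Real.sqrt_mul (by positivity)] at h ⊢
  have hx2 := Real.sq_sqrt hx
  have hy2 := Real.sq_sqrt hy
  have hz2 := Real.sq_sqrt (by positivity : 0 ≤ 2 * a)
  have hx0 := Real.sqrt_nonneg x
  have hy0 := Real.sqrt_nonneg y
  have hz0 := Real.sqrt_nonneg (2 * a)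
  set X := Real.sqrt x
  set Y := Real.sqrt y
  set Z := Real.sqrt (2 * a)
  have hXY : X ≤ Y + Z := by
    by_contra hlt
    push Not at hlt
    nlinarith
  nlinarith

section Threshold

variable {u : ℝ → ℝ} {S : Finset ℤ} {c : ℤ → ℂ} {n : ℕ}

lemma etaSum_nonneg (u : ℝ → ℝ) : 0 ≤ etaSum u :=
  finsum_nonneg fun _ => finsum_nonneg fun _ => norm_nonneg _

lemma empVar_nonneg (u : ℝ → ℝ) (X : Fin n → ℝ) : 0 ≤ empVar u X := by
  unfold empVar; positivity

lemma threshold_nonneg {δ : ℝ} (hδ : 0 ≤ δ) (u : ℝ → ℝ) (X : Fin n → ℝ) :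
    0 ≤ threshold δ u X := by
  have := etaSum_nonneg u
  have := Real.log_natCast_nonneg n
  unfold threshold; positivity

/-- Decreasing `δ` by the factor `a²` decreases the threshold at least by the factor `a`. -/
lemma threshold_sq_mul_le {a δ : ℝ} (ha : 0 ≤ a) (ha1 : a ≤ 1) (hδ : 0 ≤ δ) (u : ℝ → ℝ)
    (X : Fin n → ℝ) : threshold (a ^ 2 * δ) u X ≤ a * threshold δ u X := by
  have h1 := etaSum_nonneg u
  have h2 := Real.log_natCast_nonneg n
  have h3 := empVar_nonneg u X
  have hk : 0 < kappa := by linarith [two_lt_kappa]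
  have ha2 : a ^ 2 * δ ≤ δ := mul_le_of_le_one_left hδ (pow_le_one₀ ha ha1)
  have ha3 : a ^ 2 * δ ≤ a * δ := by
    rw [sq, mul_assoc]; exact mul_le_of_le_one_left (by positivity) ha1
  unfold threshold
  have hsqrt : ∀ z, a * Real.sqrt z = Real.sqrt (a ^ 2 * z) := fun z => by
    rw [Real.sqrt_mul (sq_nonneg a), Real.sqrt_sq ha]
  rw [mul_add a, hsqrt]
  refine add_le_add (Real.sqrt_le_sqrt ?_) ?_
  · rw [show 2 * (a ^ 2 * δ) * Real.log n = a ^ 2 * (2 * δ * Real.log n) by ring, mul_assoc (a ^ 2)]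
    refine mul_le_mul_of_nonneg_left (mul_le_mul_of_nonneg_left ?_ (by positivity)) (by positivity)
    refine add_le_add (add_le_add le_rfl (Real.sqrt_le_sqrt ?_)) ?_
    · have := mul_le_mul_of_nonneg_right ha2 (by positivity : 0 ≤ 2 * Real.log n)
      gcongr ?_ * _ * _
      linarith
    · gcongr
  · calc a ^ 2 * δ * Real.log n / (3 * n) * etaSum u
        ≤ a * δ * Real.log n / (3 * n) * etaSum u := by gcongr
      _ = _ := by ring

/-- The threshold is of the order of the empirical standard deviation times `√(log n)`. -/
lemma threshold_sq_le {δ : ℝ} (hδ : 0 ≤ δ) (u : ℝ → ℝ) (X : Fin n → ℝ) :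
    threshold δ u X ^ 2 ≤ 8 * (δ * Real.log n) * empVar u X
      + 21 * (δ * Real.log n) ^ 2 * (etaSum u ^ 2 / (n : ℝ) ^ 2) := by
  have h2 := Real.log_natCast_nonneg n
  have h3 := empVar_nonneg u X
  have hk := kappa_le_four
  have hk0 : 0 < kappa := by linarith [two_lt_kappa]
  unfold threshold
  have e1 : δ * Real.log n * kappa * (etaSum u ^ 2 / (n : ℝ) ^ 2)
      = kappa * (δ * Real.log n) * (etaSum u ^ 2 / (n : ℝ) ^ 2) := by ring
  have e2 : (δ * Real.log n / (3 * n) * etaSum u) ^ 2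
      = (δ * Real.log n) ^ 2 * (etaSum u ^ 2 / (n : ℝ) ^ 2) / 9 := by
    rw [mul_pow, div_pow, mul_pow 3]; ring
  have e3 : 2 * δ * Real.log n = 2 * (δ * Real.log n) := by ring
  rw [e1, e3]
  set r := δ * Real.log n
  have hr : 0 ≤ r := by positivity
  set h := etaSum u ^ 2 / (n : ℝ) ^ 2
  have hh : 0 ≤ h := by positivity
  set V := empVar u X
  have h4 : Real.sqrt (2 * r * V * h) ≤ V + r * h := by
    rw [Real.sqrt_le_left (by positivity)]
    nlinarith [sq_nonneg V, sq_nonneg (r * h)]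
  have h5 : Real.sqrt (2 * r * (V + Real.sqrt (2 * r * V * h) + kappa * r * h)) ^ 2
      ≤ 2 * r * (2 * V + 5 * (r * h)) := by
    rw [Real.sq_sqrt (by positivity)]
    refine mul_le_mul_of_nonneg_left ?_ (by positivity)
    have : kappa * r * h ≤ 4 * (r * h) := by
      rw [mul_assoc]; exact mul_le_mul_of_nonneg_right hk (by positivity)
    linarith
  have h6 := add_sq_le (a := Real.sqrt (2 * r * (V + Real.sqrt (2 * r * V * h) + kappa * r * h)))
    (b := r / (3 * n) * etaSum u)
  rw [e2] at h6
  have h7 : 0 ≤ r ^ 2 * h := by positivity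
  nlinarith

lemma IsTrigPoly.measurable_empCoeff (hu : IsTrigPoly u S c) :
    Measurable fun X : Fin n → ℝ => empCoeff u X := by
  simp_rw [hu.empCoeff_eq]
  exact (Finset.measurable_sum _ fun m _ =>
    hu.continuous.measurable.comp (measurable_pi_apply m)).const_mul _

lemma IsTrigPoly.measurable_empVar (hu : IsTrigPoly u S c) :
    Measurable fun X : Fin n → ℝ => empVar u X := by
  simp_rw [hu.empVar_eq]
  exact (Finset.measurable_sum _ fun m _ =>
    (hu.continuous.measurable.comp (measurable_pi_apply m)).pow_const 2).const_mul _

lemma IsTrigPoly.measurable_threshold (hu : IsTrigPoly u S c) (δ : ℝ) :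
    Measurable fun X : Fin n → ℝ => threshold δ u X := by
  have := hu.measurable_empVar (n := n)
  unfold threshold
  fun_prop

variable {μ : Measure ℝ} [IsProbabilityMeasure μ]

/-- The error of an empirical coefficient exceeds the random threshold with probability at most
`3 n^(-δ)`: Bernstein's inequality for the empirical mean, and the lower tail of the empirical
second moment, which is what puts the observable `V̂` in place of the variance. -/
lemma IsTrigPoly.measure_threshold_lt (hu : IsTrigPoly u S c) (hn : 1 < n) {δ : ℝ} (hδ : 0 < δ) :
    (Measure.pi fun _ : Fin n => μ).real
      {X | threshold δ u X < |empCoeff u X - ∫ x, u x ∂μ|} ≤ 3 * Real.exp (-(δ * Real.log n)) := by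
  have hn0 : 0 < n := by omega
  have hn' : (0 : ℝ) < n := by exact_mod_cast hn0
  have hL : 0 < Real.log n := Real.log_pos (by exact_mod_cast hn)
  have hum := hu.continuous.measurable
  rcases (etaSum_nonneg u).eq_or_lt with hη | hη
  · have hu0 : ∀ x, u x = 0 := fun x => by
      have := hu.abs_le_etaSum x
      rw [← hη] at this
      exact abs_nonpos_iff.1 this
    have : {X : Fin n → ℝ | threshold δ u X < |empCoeff u X - ∫ x, u x ∂μ|} = ∅ := by
      ext X
      have := threshold_nonneg hδ.le u X
      simp only [hu.empCoeff_eq, hu0, Finset.sum_const_zero, mul_zero, integral_zero, sub_self,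
        abs_zero, Set.mem_ofPred_eq, Set.mem_empty_iff_false, iff_false, not_lt]
      exact this
    rw [this]; simp; positivity
  set r := δ * Real.log n with hr
  have hr0 : 0 < r := by positivity
  set V := ∫ x, u x ^ 2 ∂μ with hV
  have hV0 : 0 ≤ V := integral_nonneg fun x => sq_nonneg _
  set a := r * (etaSum u ^ 2 / (n : ℝ) ^ 2) with ha
  have ha0 : 0 < a := by positivity
  have hk := two_lt_kappa
  -- the slack `κ - 2` makes the variance bound positive
  set v := V / n + (kappa - 2) * a with hv
  have hv0 : 0 < v := by
    have : 0 < (kappa - 2) * a := mul_pos (by linarith) ha0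
    positivity
  have hB := bernstein_mean (μ := μ) hn0 hum hu.abs_le_etaSum (v := v) (r := r)
    (by rw [← hV, hv, mul_add, mul_div_cancel₀ _ hn'.ne']
        have : 0 < n * ((kappa - 2) * a) := mul_pos hn' (mul_pos (by linarith) ha0)
        linarith) hv0 hr0
  set E : Set (Fin n → ℝ) := {X | empVar u X + Real.sqrt (2 * a * (V / n)) < V / n} with hE
  have hE' : (Measure.pi fun _ : Fin n => μ).real E ≤ Real.exp (-r) := by
    rcases hV0.eq_or_lt with h0 | h0
    · have : E = ∅ := by
        ext X
        have := empVar_nonneg u X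
        simp only [hE, ← h0, Set.mem_ofPred_eq, zero_div, mul_zero, Real.sqrt_zero, add_zero,
          Set.mem_empty_iff_false, iff_false, not_lt]
        exact this
      rw [this]; simp; positivity
    have hb2 : ∀ x, |u x ^ 2| ≤ etaSum u ^ 2 := fun x => by
      rw [abs_pow]; exact pow_le_pow_left₀ (abs_nonneg _) (hu.abs_le_etaSum x) 2
    have h4 : ∫ x, (u x ^ 2) ^ 2 ∂μ ≤ etaSum u ^ 2 * V := by
      rw [hV, ← integral_const_mul]
      refine integral_mono (integrable_sq_of_abs_le (hum.pow_const 2) hb2)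
        ((integrable_sq_of_abs_le hum hu.abs_le_etaSum).const_mul _) fun x => ?_
      have := hb2 x
      rw [abs_of_nonneg (sq_nonneg _)] at this
      simp only
      rw [sq (u x ^ 2)]
      exact mul_le_mul_of_nonneg_right this (sq_nonneg _)
    have hlow := measure_sum_le_le (μ := μ) hn0 (hum.pow_const 2) hb2 (fun x => sq_nonneg _) h4
      (by positivity) hr0
    refine le_trans (measureReal_mono (fun X hX => ?_) (measure_ne_top _ _)) hlow
    rw [hE, Set.mem_ofPred_eq, hu.empVar_eq] at hX
    rw [Set.mem_ofPred_eq]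
    have e1 : Real.sqrt (2 * r * (n * (etaSum u ^ 2 * V)))
        = (n : ℝ) ^ 2 * Real.sqrt (2 * a * (V / n)) := by
      rw [← Real.sqrt_sq (by positivity : (0 : ℝ) ≤ n ^ 2), ← Real.sqrt_mul (by positivity), ha]
      congr 1; field_simp
    rw [e1, ← hV]
    have h5 := mul_lt_mul_of_pos_left hX (by positivity : (0 : ℝ) < n ^ 2)
    rw [mul_add, ← mul_assoc, mul_one_div_cancel (by positivity), one_mul] at h5
    have e2 : (n : ℝ) ^ 2 * (V / n) = n * V := by field_simp
    rw [e2] at h5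
    linarith
  have hsum : 3 * Real.exp (-r) = 2 * Real.exp (-r) + Real.exp (-r) := by ring
  rw [hsum]
  refine le_trans (measureReal_mono ?_ (measure_ne_top _ _)) ((measureReal_union_le _ _).trans
    (add_le_add hB hE'))
  intro X hX
  rw [Set.mem_ofPred_eq, hu.empCoeff_eq] at hX
  by_cases hXE : X ∈ E
  · exact Or.inr hXE
  left
  rw [hE, Set.mem_ofPred_eq, not_lt] at hXE
  have hVX := le_of_le_add_sqrt (by positivity) (empVar_nonneg u X) ha0.le hXE
  rw [Set.mem_ofPred_eq]
  refine le_trans ?_ hX.le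
  unfold threshold
  rw [show δ * Real.log n / (3 * n) * etaSum u = etaSum u * r / (3 * n) by rw [hr]; ring]
  refine add_le_add (Real.sqrt_le_sqrt ?_) le_rfl
  rw [show 2 * δ * Real.log n = 2 * r by rw [hr]; ring]
  refine mul_le_mul_of_nonneg_left ?_ (by positivity)
  rw [show 2 * r * empVar u X * (etaSum u ^ 2 / (n : ℝ) ^ 2) = 2 * a * empVar u X by rw [ha]; ring,
    show δ * Real.log n * kappa * (etaSum u ^ 2 / (n : ℝ) ^ 2) = kappa * a by rw [ha, hr]; ring, hv]
  linarith

end Threshold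

/-! ### Risk of a single coefficient -/

/-- Hard thresholding at `τ` loses at most a multiple of `min (β², τ²)`, unless the error of the
empirical coefficient exceeds `a τ`; then it loses at most a multiple of that error. -/
lemma sq_hardThreshold_sub_le {a β b τ : ℝ} (ha : 0 < a) (ha1 : a < 1) (hτ : 0 ≤ τ) :
    ((if τ ≤ |b| then b else 0) - β) ^ 2
      ≤ (4 / a ^ 2 + 4 / (1 - a) ^ 2) * (min (β ^ 2) (τ ^ 2)
        + if a * τ < |b - β| then (b - β) ^ 2 else 0) := by
  have ha' : 0 < 1 - a := by linarith
  have hK1 : 4 ≤ 4 / a ^ 2 := by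
    rw [le_div_iff₀ (by positivity)]; nlinarith
  have hK2 : 4 ≤ 4 / (1 - a) ^ 2 := by
    rw [le_div_iff₀ (by positivity)]; nlinarith
  set K := 4 / a ^ 2 + 4 / (1 - a) ^ 2 with hK
  have hm : 0 ≤ min (β ^ 2) (τ ^ 2) := by positivity
  have hD : (b - β) ^ 2 = |b - β| ^ 2 := (sq_abs _).symm
  have hβ : β ^ 2 = |β| ^ 2 := (sq_abs _).symm
  have hD0 := abs_nonneg (b - β)
  have hβ0 := abs_nonneg β
  split_ifs with h1 h2 h2
  · have : 0 ≤ (b - β) ^ 2 := sq_nonneg _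
    nlinarith [mul_nonneg (by linarith : 0 ≤ K) hm]
  · push Not at h2
    have h3 := abs_sub_abs_le_abs_sub b β
    have h4 : (1 - a) * τ ≤ |β| := by linarith
    have h5 : (b - β) ^ 2 ≤ τ ^ 2 := by
      rw [hD]; exact pow_le_pow_left₀ hD0 (h2.trans (by nlinarith)) 2
    have h6 : τ ^ 2 ≤ 4 / (1 - a) ^ 2 * β ^ 2 := by
      have : ((1 - a) * τ) ^ 2 ≤ |β| ^ 2 := pow_le_pow_left₀ (by positivity) h4 2
      rw [hβ, div_mul_eq_mul_div, le_div_iff₀ (by positivity)]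
      nlinarith [sq_nonneg (|β|)]
    rw [add_zero]
    rcases min_cases (β ^ 2) (τ ^ 2) with ⟨h, _⟩ | ⟨h, _⟩ <;> rw [h]
    · nlinarith [sq_nonneg β]
    · nlinarith [sq_nonneg τ]
  · push Not at h1
    have h3 : |β| ≤ |b| + |b - β| := by
      have := abs_sub_abs_le_abs_sub β b
      rw [abs_sub_comm] at this; linarith
    have h4 : a * |β| ≤ 2 * |b - β| := by nlinarith
    have h5 : (a * |β|) ^ 2 ≤ (2 * |b - β|) ^ 2 := pow_le_pow_left₀ (by positivity) h4 2
    have h6 : β ^ 2 ≤ 4 / a ^ 2 * (b - β) ^ 2 := by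
      rw [hβ, hD, div_mul_eq_mul_div, le_div_iff₀ (by positivity)]; nlinarith
    have h7 : 0 ≤ 4 / (1 - a) ^ 2 * (b - β) ^ 2 := by positivity
    nlinarith [mul_nonneg (by linarith : 0 ≤ K) hm]
  · push Not at h1 h2
    have h3 : |β| ≤ |b| + |b - β| := by
      have := abs_sub_abs_le_abs_sub β b
      rw [abs_sub_comm] at this; linarith
    have h4 : |β| ≤ 2 * τ := by nlinarith
    have h5 : β ^ 2 ≤ 4 * τ ^ 2 := by
      rw [hβ]; nlinarith [pow_le_pow_left₀ hβ0 h4 2]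
    rw [add_zero, zero_sub, neg_sq]
    rcases min_cases (β ^ 2) (τ ^ 2) with ⟨h, _⟩ | ⟨h, _⟩ <;> rw [h]
    · nlinarith [sq_nonneg β]
    · nlinarith [sq_nonneg τ]

section Coefficient

variable {u : ℝ → ℝ} {S : Finset ℤ} {c : ℤ → ℂ} {n : ℕ} {μ : Measure ℝ} [IsProbabilityMeasure μ]

lemma IsTrigPoly.integral_comp_eval (hu : IsTrigPoly u S c) (m : Fin n) :
    ∫ X : Fin n → ℝ, u (X m) ^ 2 ∂(Measure.pi fun _ => μ) = ∫ x, u x ^ 2 ∂μ :=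
  MeasureTheory.integral_comp_eval (μ := fun _ : Fin n => μ) (f := fun x => u x ^ 2)
    (hu.continuous.pow 2).aestronglyMeasurable

lemma IsTrigPoly.integrable_comp_eval (hu : IsTrigPoly u S c) (m : Fin n) :
    Integrable (fun X : Fin n → ℝ => u (X m) ^ 2) (Measure.pi fun _ => μ) :=
  integrable_sq_of_abs_le (hu.continuous.measurable.comp (measurable_pi_apply m))
    (fun X => hu.abs_le_etaSum (X m))

lemma IsTrigPoly.integrable_empVar (hu : IsTrigPoly u S c) :
    Integrable (fun X : Fin n → ℝ => empVar u X) (Measure.pi fun _ => μ) := by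
  simp_rw [hu.empVar_eq]
  exact (integrable_finsetSum _ fun m _ => hu.integrable_comp_eval m).const_mul _

lemma IsTrigPoly.integral_empVar (hu : IsTrigPoly u S c) :
    ∫ X : Fin n → ℝ, empVar u X ∂(Measure.pi fun _ => μ) = (∫ x, u x ^ 2 ∂μ) / n := by
  simp_rw [hu.empVar_eq]
  rw [integral_const_mul, integral_finsetSum _ fun m _ => hu.integrable_comp_eval m]
  simp_rw [hu.integral_comp_eval]
  rw [Finset.sum_const, Finset.card_univ, Fintype.card_fin, nsmul_eq_mul]
  rcases eq_or_ne (n : ℝ) 0 with h | h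
  · simp [h]
  · field_simp

lemma IsTrigPoly.abs_empCoeff_le (hu : IsTrigPoly u S c) (hn : 0 < n) (X : Fin n → ℝ) :
    |empCoeff u X| ≤ etaSum u := by
  have hn' : (0 : ℝ) < n := by exact_mod_cast hn
  rw [hu.empCoeff_eq, abs_mul, abs_of_pos (by positivity : (0 : ℝ) < 1 / n), one_div,
    inv_mul_le_iff₀ hn']
  refine (Finset.abs_sum_le_sum_abs _ _).trans
    ((Finset.sum_le_card_nsmul _ _ _ fun m _ => hu.abs_le_etaSum _).trans_eq ?_)
  simp

lemma IsTrigPoly.abs_integral_le (hu : IsTrigPoly u S c) : |∫ x, u x ∂μ| ≤ etaSum u := by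
  rw [← Real.norm_eq_abs]
  refine (norm_integral_le_of_norm_le_const (C := etaSum u)
    (ae_of_all _ fun x => hu.abs_le_etaSum x)).trans_eq ?_
  simp

lemma IsTrigPoly.abs_empCoeff_sub_le (hu : IsTrigPoly u S c) (hn : 0 < n) (X : Fin n → ℝ) :
    |empCoeff u X - ∫ x, u x ∂μ| ≤ 2 * etaSum u := by
  have h1 := abs_sub (empCoeff u X) (∫ x, u x ∂μ)
  linarith [hu.abs_empCoeff_le hn X, hu.abs_integral_le (μ := μ)]

lemma IsTrigPoly.integrable_sq_empCoeff_sub (hu : IsTrigPoly u S c) (hn : 0 < n) :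
    Integrable (fun X : Fin n → ℝ => (empCoeff u X - ∫ x, u x ∂μ) ^ 2)
      (Measure.pi fun _ => μ) :=
  integrable_sq_of_abs_le (hu.measurable_empCoeff.sub_const _) (hu.abs_empCoeff_sub_le hn)

lemma IsTrigPoly.integral_sq_empCoeff_sub_le (hu : IsTrigPoly u S c) (hn : 0 < n) :
    ∫ X : Fin n → ℝ, (empCoeff u X - ∫ x, u x ∂μ) ^ 2 ∂(Measure.pi fun _ => μ)
      ≤ (∫ x, u x ^ 2 ∂μ) / n := by
  have hn' : (0 : ℝ) < n := by exact_mod_cast hn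
  have hum := hu.continuous.measurable
  set E := ∫ x, u x ∂μ with hE
  have hL2 : MemLp (fun x => u x - E) 2 μ :=
    MemLp.of_bound (hum.sub_const E).aestronglyMeasurable (etaSum u + |E|)
      (ae_of_all _ fun x => (abs_sub _ _).trans (by linarith [hu.abs_le_etaSum x]))
  have hu1 : Integrable u μ := integrable_of_abs_le hum hu.abs_le_etaSum
  have hvar := ProbabilityTheory.variance_sum_pi (ι := Fin n) (μ := fun _ => μ)
    (X := fun _ x => u x - E) (fun _ => hL2)
  have hmean0 : ∫ x, (u x - E) ∂μ = 0 := by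
    rw [integral_sub hu1 (integrable_const _)]; simp [hE]
  have hmean : ∀ m : Fin n, ∫ X : Fin n → ℝ, (u (X m) - E) ∂(Measure.pi fun _ => μ) = 0 := by
    intro m
    rw [← hmean0]
    exact MeasureTheory.integral_comp_eval (μ := fun _ : Fin n => μ) (f := fun x => u x - E)
      (hum.sub_const E).aestronglyMeasurable
  have hint : ∀ m : Fin n, Integrable (fun X : Fin n → ℝ => u (X m) - E)
      (Measure.pi fun _ => μ) := fun m =>
    (integrable_of_abs_le (Y := fun X : Fin n → ℝ => u (X m)) (hum.comp (measurable_pi_apply m))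
      (fun X => hu.abs_le_etaSum (X m))).sub (integrable_const _)
  have hsum : (∑ m : Fin n, fun X : Fin n → ℝ => u (X m) - E)
      = fun X : Fin n → ℝ => ∑ m, (u (X m) - E) := by
    funext X; simp
  have hzero : ∫ X : Fin n → ℝ, ∑ m, (u (X m) - E) ∂(Measure.pi fun _ => μ) = 0 := by
    rw [integral_finsetSum _ fun m _ => hint m]
    exact Finset.sum_eq_zero fun m _ => hmean m
  have hmeas : Measurable fun X : Fin n → ℝ => ∑ m, (u (X m) - E) :=
    Finset.measurable_sum _ fun m _ => (hum.comp (measurable_pi_apply m)).sub_const E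
  rw [hsum, ProbabilityTheory.variance_eq_integral hmeas.aemeasurable, hzero] at hvar
  simp only [sub_zero, Finset.sum_const, Finset.card_univ, Fintype.card_fin, nsmul_eq_mul] at hvar
  rw [ProbabilityTheory.variance_eq_integral (hum.sub_const E).aemeasurable, hmean0] at hvar
  simp only [sub_zero] at hvar
  have hV : ∫ x, (u x - E) ^ 2 ∂μ ≤ ∫ x, u x ^ 2 ∂μ := by
    have i2 := integrable_sq_of_abs_le (μ := μ) hum hu.abs_le_etaSum
    have : ∀ x, (u x - E) ^ 2 = u x ^ 2 - (2 * E * u x - E ^ 2) := fun x => by ring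
    simp_rw [this]
    have i3 : Integrable (fun x => 2 * E * u x - E ^ 2) μ :=
      (hu1.const_mul _).sub (integrable_const _)
    rw [integral_sub i2 i3, integral_sub (hu1.const_mul _) (integrable_const _),
      integral_const_mul, ← hE]
    simp
    nlinarith [sq_nonneg E]
  have hpt : ∀ X : Fin n → ℝ, (empCoeff u X - E) ^ 2
      = 1 / (n : ℝ) ^ 2 * (∑ m, (u (X m) - E)) ^ 2 := by
    intro X
    rw [hu.empCoeff_eq, Finset.sum_sub_distrib, Finset.sum_const, Finset.card_univ,
      Fintype.card_fin, nsmul_eq_mul]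
    field_simp
  simp_rw [hpt]
  rw [integral_const_mul, hvar, ← mul_assoc, le_div_iff₀ hn']
  have : 1 / (n : ℝ) ^ 2 * n * (∫ x, (u x - E) ^ 2 ∂μ) * n = ∫ x, (u x - E) ^ 2 ∂μ := by
    field_simp
  rw [this]; exact hV

/-- The loss on one thresholded coefficient has an integrable majorant whose expectation is of the
order of `min (β², log n / n)`, up to the contribution of the rare event that the error of the
empirical coefficient is not dominated by the threshold. -/
lemma IsTrigPoly.exists_loss_majorant (hu : IsTrigPoly u S c) (hn : 1 < n) {δ a V H : ℝ}
    (hδ : 0 < δ) (ha : 0 < a) (ha1 : a < 1) (hV0 : 0 < V) (hV : ∫ x, u x ^ 2 ∂μ ≤ V)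
    (hH : etaSum u ^ 2 ≤ H) :
    ∃ Φ : (Fin n → ℝ) → ℝ, Integrable Φ (Measure.pi fun _ => μ) ∧
      (∀ X, ((if threshold δ u X ≤ |empCoeff u X| then empCoeff u X else 0) - ∫ x, u x ∂μ) ^ 2
        ≤ Φ X) ∧
      ∫ X, Φ X ∂(Measure.pi fun _ => μ) ≤ (4 / a ^ 2 + 4 / (1 - a) ^ 2) *
        (min ((∫ x, u x ∂μ) ^ 2)
            (8 * δ * Real.log n * V / n + 21 * (δ * Real.log n) ^ 2 * H / (n : ℝ) ^ 2)
          + (16 * Real.log n * V / n + 4 * Real.log n ^ 2 * H / (n : ℝ) ^ 2)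
            * (3 * Real.exp (-(a ^ 2 * δ * Real.log n)))
          + 8 * H * Real.exp (-(4 * Real.log n))) := by
  have hn0 : 0 < n := by omega
  have hn' : (0 : ℝ) < n := by exact_mod_cast hn0
  have hL : 0 < Real.log n := Real.log_pos (by exact_mod_cast hn)
  have hum := hu.continuous.measurable
  have hη := etaSum_nonneg u
  have hH0 : 0 ≤ H := (sq_nonneg _).trans hH
  set L := Real.log n with hLdef
  set ν := Measure.pi fun _ : Fin n => μ with hν
  set β := ∫ x, u x ∂μ with hβ
  set K := 4 / a ^ 2 + 4 / (1 - a) ^ 2 with hK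
  have hK0 : 0 ≤ K := by positivity
  set q := 21 * (δ * L) ^ 2 * H / (n : ℝ) ^ 2 with hq
  -- the deterministic level that the error exceeds only with probability `2 n⁻⁴`
  set t := Real.sqrt (2 * (4 * L) * (V / n)) + etaSum u * (4 * L) / (3 * n) with ht
  have ht0 : 0 ≤ t := by positivity
  have ht2 : t ^ 2 ≤ 16 * L * V / n + 4 * L ^ 2 * H / (n : ℝ) ^ 2 := by
    have h1 := add_sq_le (a := Real.sqrt (2 * (4 * L) * (V / n)))
      (b := etaSum u * (4 * L) / (3 * n))
    rw [Real.sq_sqrt (by positivity)] at h1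
    have h2 : (etaSum u * (4 * L) / (3 * n)) ^ 2
        = 16 / 9 * (L ^ 2 * etaSum u ^ 2 / (n : ℝ) ^ 2) := by
      rw [div_pow]; field_simp; ring
    have h3 : L ^ 2 * etaSum u ^ 2 / (n : ℝ) ^ 2 ≤ L ^ 2 * H / (n : ℝ) ^ 2 := by gcongr
    have h4 : 0 ≤ L ^ 2 * H / (n : ℝ) ^ 2 := by positivity
    have e1 : 16 * L * V / n = 16 * (L * (V / n)) := by ring
    have e2 : 4 * L ^ 2 * H / (n : ℝ) ^ 2 = 4 * (L ^ 2 * H / (n : ℝ) ^ 2) := by ring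
    rw [e1, e2]
    rw [h2] at h1
    linarith
  set A : Set (Fin n → ℝ) := {X | a * threshold δ u X < |empCoeff u X - β|} with hA
  set B : Set (Fin n → ℝ) := {X | t ≤ |empCoeff u X - β|} with hB
  have hDm : Measurable fun X : Fin n → ℝ => |empCoeff u X - β| :=
    (hu.measurable_empCoeff.sub_const _).abs
  have hAm : MeasurableSet A := measurableSet_lt ((hu.measurable_threshold δ).const_mul a) hDm
  have hBm : MeasurableSet B := measurableSet_le measurable_const hDm
  have hPA : ν.real A ≤ 3 * Real.exp (-(a ^ 2 * δ * L)) := by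
    refine le_trans (measureReal_mono (fun X hX => ?_) (measure_ne_top _ _))
      (hu.measure_threshold_lt (μ := μ) hn (δ := a ^ 2 * δ) (by positivity))
    exact (threshold_sq_mul_le ha.le ha1.le hδ.le u X).trans_lt hX
  have hPB : ν.real B ≤ 2 * Real.exp (-(4 * L)) := by
    have := bernstein_mean (μ := μ) hn0 hum hu.abs_le_etaSum (v := V / n) (r := 4 * L)
      (by rwa [mul_div_cancel₀ _ hn'.ne']) (by positivity) (by positivity)
    simp_rw [← hu.empCoeff_eq] at this
    exact this
  set Φ₁ : (Fin n → ℝ) → ℝ := fun X => min (β ^ 2) (8 * (δ * L) * empVar u X + q) with hΦ₁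
  have hi0 : Integrable (fun X : Fin n → ℝ => 8 * (δ * L) * empVar u X + q) ν :=
    (hu.integrable_empVar.const_mul _).add (integrable_const _)
  have hi1 : Integrable Φ₁ ν := (integrable_const _).inf hi0
  have hi2 : Integrable (A.indicator fun _ => t ^ 2) ν := (integrable_const _).indicator hAm
  have hi3 : Integrable (B.indicator fun _ => 4 * H) ν := (integrable_const _).indicator hBm
  refine ⟨fun X => K * (Φ₁ X + A.indicator (fun _ => t ^ 2) X + B.indicator (fun _ => 4 * H) X),
    ((hi1.add hi2).add hi3).const_mul K, fun X => ?_, ?_⟩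
  · refine (sq_hardThreshold_sub_le ha ha1 (threshold_nonneg hδ.le u X)).trans ?_
    simp only [add_assoc]
    refine mul_le_mul_of_nonneg_left (add_le_add ?_ ?_) hK0
    · refine min_le_min le_rfl ((threshold_sq_le hδ.le u X).trans ?_)
      gcongr 8 * (δ * L) * empVar u X + ?_
      rw [hq, mul_div_assoc]
      gcongr
    · have hA0 : 0 ≤ A.indicator (fun _ => t ^ 2) X :=
        Set.indicator_nonneg (fun _ _ => sq_nonneg t) X
      have hB0 : 0 ≤ B.indicator (fun _ => 4 * H) X :=
        Set.indicator_nonneg (fun _ _ => by positivity) X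
      split_ifs with h
      · by_cases hXB : X ∈ B
        · rw [Set.indicator_of_mem hXB]
          have h1 := hu.abs_empCoeff_sub_le (μ := μ) hn0 X
          have h2 := pow_le_pow_left₀ (abs_nonneg _) h1 2
          rw [sq_abs] at h2
          nlinarith
        · rw [Set.indicator_of_mem (show X ∈ A from h)]
          have h1 : |empCoeff u X - β| ≤ t := (not_le.1 hXB).le
          have h2 := pow_le_pow_left₀ (abs_nonneg _) h1 2
          rw [sq_abs] at h2
          linarith
      · positivity
  · have hi12 : Integrable (fun X => Φ₁ X + A.indicator (fun _ => t ^ 2) X) ν := hi1.add hi2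
    rw [integral_const_mul, integral_add hi12 hi3, integral_add hi1 hi2,
      integral_indicator_const _ hAm, integral_indicator_const _ hBm, smul_eq_mul, smul_eq_mul]
    refine mul_le_mul_of_nonneg_left (add_le_add (add_le_add ?_ ?_) ?_) hK0
    · refine le_min ?_ ?_
      · refine (integral_mono hi1 (integrable_const (β ^ 2)) fun X => min_le_left _ _).trans_eq ?_
        simp
      · refine (integral_mono hi1 hi0 fun X => min_le_right _ _).trans ?_
        rw [integral_add (hu.integrable_empVar.const_mul _) (integrable_const _),
          integral_const_mul, hu.integral_empVar]
        simp only [integral_const, probReal_univ, one_smul]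
        gcongr ?_ + _
        calc 8 * (δ * L) * ((∫ x, u x ^ 2 ∂μ) / n) ≤ 8 * (δ * L) * (V / n) := by gcongr
          _ = _ := by ring
    · rw [mul_comm]
      exact mul_le_mul ht2 hPA measureReal_nonneg (by positivity)
    · calc ν.real B * (4 * H) ≤ 2 * Real.exp (-(4 * L)) * (4 * H) := by gcongr
        _ = _ := by ring

end Coefficient

end Thresholding

/-! ### Oracle inequality for the estimator -/

section Oracle

variable {θ : ℝ → ℝ} {f : ℝ → ℝ}

lemma integral_densityLaw (hf : f ∈ densityClass) (h : ℝ → ℝ) :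
    ∫ x, h x ∂densityLaw f = ∫ x, f x * h x ∂unitVolume := by
  rw [densityLaw, integral_withDensity_eq_integral_toReal_smul₀
    hf.1.1.aemeasurable.ennreal_ofReal (ae_of_all _ fun x => ENNReal.ofReal_lt_top)]
  refine integral_congr_ae (hf.2.1.mono fun x hx => ?_)
  simp only [ENNReal.toReal_ofReal hx, smul_eq_mul]

lemma isProbabilityMeasure_densityLaw (hf : f ∈ densityClass) :
    IsProbabilityMeasure (densityLaw f) := by
  constructor
  rw [densityLaw, withDensity_apply _ MeasurableSet.univ, Measure.restrict_univ,
    ← ofReal_integral_eq_lintegral_ofReal (integrable_of_memLp_two hf.1) hf.2.1, hf.2.2,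
    ENNReal.ofReal_one]

/-- A bound for the risk in terms of the wavelet coefficients of `f`. -/
lemma risk_le (hθ : IsMeyerWindow θ) (hf : f ∈ densityClass) {n j₀ j₁ : ℕ} (hn : 1 < n)
    {δ a M B : ℝ} (hδ : 0 < δ) (ha : 0 < a) (ha1 : a < 1) (hM0 : 0 < M)
    (hM : ∀ T : Finset ℤ, ∑ l ∈ T, ‖fourierCoef f l‖ ≤ M) (hj : j₀ ≤ j₁ + 1)
    (hB : ∀ i, ∑ r ∈ Finset.range i, waveletEnergy θ f (j₁ + 1 + r) ≤ B) :
    risk θ δ n j₀ j₁ f ≤ ENNReal.ofReal (2 ^ j₀ * (20 * M / n)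
      + ∑ j ∈ Finset.Icc j₀ j₁, ∑ k ∈ Finset.range (2 ^ j), (4 / a ^ 2 + 4 / (1 - a) ^ 2) *
        (min (coeff f (psi θ j k) ^ 2) (8 * δ * Real.log n * (20 * M) / n
            + 21 * (δ * Real.log n) ^ 2 * (100 * 2 ^ j₁) / (n : ℝ) ^ 2)
          + (16 * Real.log n * (20 * M) / n + 4 * Real.log n ^ 2 * (100 * 2 ^ j₁) / (n : ℝ) ^ 2)
            * (3 * Real.exp (-(a ^ 2 * δ * Real.log n)))
          + 8 * (100 * 2 ^ j₁) * Real.exp (-(4 * Real.log n))) + B) := by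
  have hn0 : 0 < n := by omega
  have hn' : (0 : ℝ) < n := by exact_mod_cast hn0
  have := isProbabilityMeasure_densityLaw hf
  have hfi := integrable_of_memLp_two hf.1
  set ν := Measure.pi fun _ : Fin n => densityLaw f with hν
  have hφ : ∀ k, IsTrigPoly (phi θ j₀ k) (freqBox j₀) (atomCoef (fun ω => (θ ω : ℂ)) j₀ k) :=
    hθ.isBandWindow.isTrigPoly j₀
  have hψ : ∀ j k, IsTrigPoly (psi θ j k) (freqBox j) (atomCoef (waveletFT θ) j k) :=
    hθ.isBandWindow_waveletFT.isTrigPoly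
  have hmean : ∀ u : ℝ → ℝ, ∫ x, u x ∂densityLaw f = coeff f u := integral_densityLaw hf
  have hφV : ∀ k, ∫ x, phi θ j₀ k x ^ 2 ∂densityLaw f ≤ 20 * M := fun k => by
    rw [integral_densityLaw hf]
    refine ((hφ k).integral_mul_sq_le hfi hM).trans ?_
    nlinarith [hθ.isBandWindow.sum_sq_atomCoef_le j₀ k]
  have hψV : ∀ j k, ∫ x, psi θ j k x ^ 2 ∂densityLaw f ≤ 20 * M := fun j k => by
    rw [integral_densityLaw hf]
    refine ((hψ j k).integral_mul_sq_le hfi hM).trans ?_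
    nlinarith [hθ.isBandWindow_waveletFT.sum_sq_atomCoef_le j k]
  have hψH : ∀ j ∈ Finset.Icc j₀ j₁, ∀ k, etaSum (psi θ j k) ^ 2 ≤ 100 * 2 ^ j₁ := fun j hj k => by
    refine (hθ.isBandWindow_waveletFT.etaSum_sq_le j k).trans ?_
    have := (Finset.mem_Icc.1 hj).2
    gcongr
    norm_num
  have hex := fun j (hj : j ∈ Finset.Icc j₀ j₁) k => (hψ j k).exists_loss_majorant
    (μ := densityLaw f) hn hδ ha ha1 (by positivity : 0 < 20 * M) (hψV j k) (hψH j hj k)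
  simp_rw [hmean] at hex
  choose! Φ hΦi hΦle hΦint using hex
  set Ψ : (Fin n → ℝ) → ℝ := fun X =>
    ∑ k ∈ Finset.range (2 ^ j₀), (empCoeff (phi θ j₀ k) X - coeff f (phi θ j₀ k)) ^ 2
      + ∑ j ∈ Finset.Icc j₀ j₁, ∑ k ∈ Finset.range (2 ^ j), Φ j k X + B with hΨ
  have hi1 : ∀ k ∈ Finset.range (2 ^ j₀), Integrable (fun X : Fin n → ℝ =>
      (empCoeff (phi θ j₀ k) X - coeff f (phi θ j₀ k)) ^ 2) ν := fun k _ => by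
    have := (hφ k).integrable_sq_empCoeff_sub (μ := densityLaw f) hn0
    rwa [hmean] at this
  have hi2 : ∀ j ∈ Finset.Icc j₀ j₁, Integrable (fun X =>
      ∑ k ∈ Finset.range (2 ^ j), Φ j k X) ν := fun j hj =>
    integrable_finsetSum _ fun k _ => hΦi j hj k
  have hs1 := integrable_finsetSum _ hi1
  have hs2 := integrable_finsetSum _ hi2
  have hs12 : Integrable (fun X : Fin n → ℝ => ∑ k ∈ Finset.range (2 ^ j₀),
      (empCoeff (phi θ j₀ k) X - coeff f (phi θ j₀ k)) ^ 2
      + ∑ j ∈ Finset.Icc j₀ j₁, ∑ k ∈ Finset.range (2 ^ j), Φ j k X) ν := hs1.add hs2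
  have hΨi : Integrable Ψ ν := hs12.add (integrable_const B)
  have hpt : ∀ X : Fin n → ℝ, (∫⁻ x, ENNReal.ofReal ((estimator θ δ j₀ j₁ X x - f x) ^ 2)
      ∂unitVolume) ≤ ENNReal.ofReal (Ψ X) := by
    intro X
    set b : ℕ → ℕ → ℝ := fun j k =>
      if threshold δ (psi θ j k) X ≤ |empCoeff (psi θ j k) X| then empCoeff (psi θ j k) X else 0
      with hb
    have hest : ∀ x, estimator θ δ j₀ j₁ X x
        = ∑ k ∈ Finset.range (2 ^ j₀), empCoeff (phi θ j₀ k) X * phi θ j₀ k x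
          + ∑ j ∈ Finset.Icc j₀ j₁, ∑ k ∈ Finset.range (2 ^ j), b j k * psi θ j k x := by
      intro x
      simp only [estimator, hb, ite_mul, zero_mul]
    have hm : MemLp (fun x => estimator θ δ j₀ j₁ X x - f x) 2 unitVolume := by
      simp_rw [hest]
      exact ((memLp_finsetSum _ fun k _ => (hφ k).memLp.const_mul _).add
        (memLp_finsetSum _ fun j _ => memLp_finsetSum _ fun k _ =>
          (hψ j k).memLp.const_mul _)).sub hf.1
    rw [← ofReal_integral_eq_lintegral_ofReal hm.integrable_sq (ae_of_all _ fun x => sq_nonneg _)]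
    apply ENNReal.ofReal_le_ofReal
    simp_rw [hest]
    refine (integral_sq_wavelet_series_sub_le hθ hf.1 hj hB _ b).trans ?_
    exact add_le_add (add_le_add le_rfl (Finset.sum_le_sum fun j hj =>
      Finset.sum_le_sum fun k _ => hΦle j hj k X)) le_rfl
  calc risk θ δ n j₀ j₁ f ≤ ∫⁻ X, ENNReal.ofReal (Ψ X) ∂ν := lintegral_mono hpt
    _ = ENNReal.ofReal (∫ X, Ψ X ∂ν) := by
        refine (ofReal_integral_eq_lintegral_ofReal hΨi (ae_of_all _ fun X => ?_)).symm
        have hB0 : 0 ≤ B := by simpa using hB 0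
        refine add_nonneg (add_nonneg (Finset.sum_nonneg fun _ _ => sq_nonneg _)
          (Finset.sum_nonneg fun j hj => Finset.sum_nonneg fun k _ =>
            (sq_nonneg _).trans (hΦle j hj k X))) hB0
    _ ≤ _ := by
        apply ENNReal.ofReal_le_ofReal
        rw [hΨ, integral_add hs12 (integrable_const B), integral_add hs1 hs2,
          integral_finsetSum _ hi1, integral_finsetSum _ hi2]
        simp only [integral_const, probReal_univ, one_smul]
        refine add_le_add (add_le_add ?_ ?_) le_rfl
        · refine (Finset.sum_le_card_nsmul _ _ (20 * M / n) fun k _ => ?_).trans_eq ?_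
          · have := (hφ k).integral_sq_empCoeff_sub_le (μ := densityLaw f) hn0
            rw [hmean] at this
            refine this.trans ?_
            have := hφV k
            gcongr
          · rw [Finset.card_range, nsmul_eq_mul]; push_cast; ring
        · refine Finset.sum_le_sum fun j hj => ?_
          rw [integral_finsetSum _ fun k _ => hΦi j hj k]
          exact Finset.sum_le_sum fun k _ => hΦint j hj k

/-! ### Rates -/

/-- A sum over dyadic levels of quantities bounded both by an increasing and by a decreasing
geometric progression is of the order of the common value at the crossing `2^j = R`. -/
lemma sum_dyadic_le (F : Finset ℕ) {x : ℕ → ℝ} {T R a B : ℝ} (hT : 0 ≤ T) (hR : 1 ≤ R)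
    (ha : 0 < a) (hB : 0 ≤ B) (h1 : ∀ j ∈ F, x j ≤ 2 ^ j * T)
    (h2 : ∀ j ∈ F, x j ≤ B * ((2 ^ j / R) ^ (-a) * (T * R))) :
    ∑ j ∈ F, x j ≤ (2 + B / (1 - (2 : ℝ) ^ (-a))) * (T * R) := by
  obtain ⟨J, hJ1, hJ2⟩ := exists_nat_pow_near hR (by norm_num : (1 : ℝ) < 2)
  set r := (2 : ℝ) ^ (-a) with hr
  have hr0 : 0 ≤ r := by positivity
  have hr1 : r < 1 := Real.rpow_lt_one_of_one_lt_of_neg (by norm_num) (by linarith)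
  have hR0 : 0 < R := by linarith
  rw [← Finset.sum_filter_add_sum_filter_not F (fun j => j ≤ J), add_mul]
  refine add_le_add ?_ ?_
  · calc ∑ j ∈ F with j ≤ J, x j ≤ ∑ j ∈ F with j ≤ J, 2 ^ j * T :=
          Finset.sum_le_sum fun j hj => h1 j (Finset.mem_filter.1 hj).1
      _ ≤ ∑ j ∈ Finset.range (J + 1), 2 ^ j * T :=
          Finset.sum_le_sum_of_subset_of_nonneg
            (fun j hj => Finset.mem_range.2 (Nat.lt_succ_of_le (Finset.mem_filter.1 hj).2))
            fun _ _ _ => by positivity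
      _ = (2 ^ (J + 1) - 1) * T := by
          rw [← Finset.sum_mul, geom_sum_eq (by norm_num)]; norm_num
      _ ≤ (2 * R) * T := by
          rw [pow_succ]; gcongr; linarith
      _ = 2 * (T * R) := by ring
  · calc ∑ j ∈ F with ¬ j ≤ J, x j ≤ ∑ j ∈ F with ¬ j ≤ J, B * (T * R) * r ^ (j - (J + 1)) := by
          refine Finset.sum_le_sum fun j hj => ?_
          obtain ⟨hjF, hjJ⟩ := Finset.mem_filter.1 hj
          refine (h2 j hjF).trans ?_
          have h3 : (2 ^ j / R) ^ (-a) ≤ r ^ (j - (J + 1)) := by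
            obtain ⟨i, rfl⟩ := Nat.exists_eq_add_of_lt (not_le.1 hjJ)
            rw [hr, ← Real.rpow_natCast (2 ^ (-a)), ← Real.rpow_mul (by norm_num), mul_comm,
              Real.rpow_mul (by norm_num), Real.rpow_natCast]
            refine Real.rpow_le_rpow_of_nonpos (by positivity) ?_ (by linarith)
            rw [le_div_iff₀ hR0]
            calc (2 : ℝ) ^ (J + i + 1 - (J + 1)) * R ≤ 2 ^ (J + i + 1 - (J + 1)) * 2 ^ (J + 1) := by
                  gcongr
              _ = _ := by rw [← pow_add]; congr 1; omega
          calc B * ((2 ^ j / R) ^ (-a) * (T * R)) ≤ B * (r ^ (j - (J + 1)) * (T * R)) := by gcongr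
            _ = _ := by ring
      _ ≤ B * (T * R) * (1 / (1 - r)) := by
          rw [← Finset.mul_sum]
          refine mul_le_mul_of_nonneg_left ?_ (by positivity)
          rw [← Finset.sum_image (g := fun j => j - (J + 1)) (f := fun i => r ^ i), one_div,
            ← tsum_geometric_of_lt_one hr0 hr1]
          · exact (summable_geometric_of_lt_one hr0 hr1).sum_le_tsum _ fun _ _ => by positivity
          · intro x hx y hy hxy
            have hx' := (Finset.mem_filter.1 (Finset.mem_coe.1 hx)).2
            have hy' := (Finset.mem_filter.1 (Finset.mem_coe.1 hy)).2
            simp only at hxy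
            omega
      _ = _ := by ring

lemma min_sq_le_rpow {x T p : ℝ} (hT : 0 < T) (hp : 0 < p) (hp2 : p ≤ 2) :
    min (x ^ 2) T ≤ |x| ^ p * T ^ (1 - p / 2) := by
  rcases eq_or_ne x 0 with rfl | hx
  · have : 0 ≤ |(0 : ℝ)| ^ p * T ^ (1 - p / 2) := by positivity
    refine (min_le_left _ _).trans ?_
    simpa using this
  have hm : 0 < min (x ^ 2) T := lt_min (by positivity) hT
  calc min (x ^ 2) T = min (x ^ 2) T ^ (p / 2) * min (x ^ 2) T ^ (1 - p / 2) := by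
        rw [← Real.rpow_add hm, add_sub_cancel, Real.rpow_one]
    _ ≤ (x ^ 2) ^ (p / 2) * T ^ (1 - p / 2) := by
        gcongr
        · exact min_le_left _ _
        · linarith
        · exact min_le_right _ _
    _ = _ := by
        rw [← sq_abs, ← Real.rpow_natCast, ← Real.rpow_mul (abs_nonneg x)]
        congr 2; push_cast; ring

/-- The oracle risk over a Besov ball: at the crossing level `2^j = T^(-1/(2s+1))` the trivial bound
`2^j T` and the bound from the Besov norm agree. -/
lemma sum_min_sq_le {J : ℕ} {s p q A T : ℝ} (hp : 0 < p) (hp2 : p ≤ 2) (hq : 0 < q) (hA : 0 ≤ A)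
    (hs : 1 / p < s) (hf : f ∈ besovBall θ J s p q A) (hT : 0 < T) (hT1 : T ≤ 1) {j₀ j₁ : ℕ}
    (hj : J ≤ j₀) :
    ∑ j ∈ Finset.Icc j₀ j₁, ∑ k ∈ Finset.range (2 ^ j), min (coeff f (psi θ j k) ^ 2) T
      ≤ (2 + A ^ p / (1 - (2 : ℝ) ^ (-(p * (s + 1 / 2 - 1 / p))))) * T ^ (2 * s / (2 * s + 1)) := by
  set b := s + 1 / 2 - 1 / p with hb
  have hs0 : 0 < s := lt_trans (by positivity) hs
  set R := T ^ (-(1 / (2 * s + 1))) with hR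
  have hR0 : 0 < R := by positivity
  have hR1 : 1 ≤ R := Real.one_le_rpow_of_pos_of_le_one_of_nonpos hT hT1
    (neg_nonpos.2 (by positivity))
  have hTR : T * R = T ^ (2 * s / (2 * s + 1)) := by
    rw [hR]
    nth_rw 1 [← Real.rpow_one T]
    rw [← Real.rpow_add hT]
    congr 1; field_simp; ring
  rw [← hTR]
  refine sum_dyadic_le _ hT.le hR1 (mul_pos hp (by linarith)) (by positivity) (fun j _ => ?_)
    (fun j hj' => ?_)
  · refine (Finset.sum_le_card_nsmul _ _ T fun k _ => min_le_right _ _).trans_eq ?_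
    rw [Finset.card_range, nsmul_eq_mul]; push_cast; rfl
  · have hJj : J ≤ j := hj.trans (Finset.mem_Icc.1 hj').1
    calc ∑ k ∈ Finset.range (2 ^ j), min (coeff f (psi θ j k) ^ 2) T
        ≤ ∑ k ∈ Finset.range (2 ^ j), |coeff f (psi θ j k)| ^ p * T ^ (1 - p / 2) :=
          Finset.sum_le_sum fun k _ => min_sq_le_rpow hT hp hp2
      _ ≤ (A * (2 : ℝ) ^ (-(j * b))) ^ p * T ^ (1 - p / 2) := by
          rw [← Finset.sum_mul]
          exact mul_le_mul_of_nonneg_right (sum_rpow_coeff_le hp hq hA hf hJj) (by positivity)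
      _ = A ^ p * (((2 : ℝ) ^ j) ^ (-(p * b)) * T ^ (1 - p / 2)) := by
          rw [Real.mul_rpow hA (by positivity), ← Real.rpow_mul (by norm_num),
            ← Real.rpow_natCast 2 j, ← Real.rpow_mul (by norm_num), mul_assoc]
          congr 3; ring
      _ = A ^ p * ((2 ^ j / R) ^ (-(p * b)) * (T * R)) := by
          have h1 : T ^ (1 - p / 2) = R ^ (p * b) * (T * R) := by
            rw [hTR, hR, ← Real.rpow_mul hT.le, ← Real.rpow_add hT]
            congr 1
            rw [hb]; field_simp; ring
          rw [Real.div_rpow (by positivity) hR0.le, Real.rpow_neg hR0.le, div_inv_eq_mul, h1]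
          ring

end Oracle

section Rate

lemma log_le_two_mul_sqrt (n : ℕ) : Real.log n ≤ 2 * Real.sqrt n := by
  have := Real.log_le_rpow_div (Nat.cast_nonneg n) (by norm_num : (0 : ℝ) < 1 / 2)
  rw [← Real.sqrt_eq_rpow] at this
  linarith

lemma tendsto_log_div_nat : Tendsto (fun n : ℕ => Real.log n / n) atTop (nhds 0) :=
  Real.isLittleO_log_id_atTop.tendsto_div_nhds_zero.comp tendsto_natCast_atTop_atTop

/-- All terms of the risk bound other than the oracle risk are of the order of `log n / n`. -/
lemma sum_loss_bound_le {n j₀ j₁ : ℕ} (hn : 3 ≤ n) (hj₁ : (2 : ℝ) ^ j₁ ≤ 2 * Real.sqrt n)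
    {K δ V T' r : ℝ} (hK : 0 ≤ K) (hδ : 0 < δ) (hV : 0 < V) (hr : r = 1 / 2)
    (hT' : T' = (8 * δ * V + 8400 * δ ^ 2) * (Real.log n / n)) (x : ℕ → ℕ → ℝ) :
    ∑ j ∈ Finset.Icc j₀ j₁, ∑ k ∈ Finset.range (2 ^ j), K *
        (min (x j k ^ 2) (8 * δ * Real.log n * V / n
            + 21 * (δ * Real.log n) ^ 2 * (100 * 2 ^ j₁) / (n : ℝ) ^ 2)
          + (16 * Real.log n * V / n + 4 * Real.log n ^ 2 * (100 * 2 ^ j₁) / (n : ℝ) ^ 2)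
            * (3 * Real.exp (-(r * Real.log n)))
          + 8 * (100 * 2 ^ j₁) * Real.exp (-(4 * Real.log n)))
      ≤ K * ∑ j ∈ Finset.Icc j₀ j₁, ∑ k ∈ Finset.range (2 ^ j), min (x j k ^ 2) T'
        + K * (192 * V + 25600) * (Real.log n / n) := by
  subst hr hT'
  have hn0 : (0 : ℝ) < n := by exact_mod_cast (by omega : 0 < n)
  have hL1 : 1 ≤ Real.log n := by
    rw [Real.le_log_iff_exp_le hn0]
    have : (3 : ℝ) ≤ n := by exact_mod_cast hn
    linarith [Real.exp_one_lt_d9]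
  set w := Real.sqrt n with hw
  have hw2 : w ^ 2 = n := Real.sq_sqrt hn0.le
  have hw0 : 0 < w := Real.sqrt_pos.2 hn0
  have hLw : Real.log n ≤ 2 * w := log_le_two_mul_sqrt n
  have hexp1 : Real.exp (-(1 / 2 * Real.log n)) = 1 / w := by
    rw [hw, Real.sqrt_eq_rpow, Real.rpow_def_of_pos hn0, one_div (Real.exp _), ← Real.exp_neg]
    congr 1; ring
  have hexp2 : Real.exp (-(4 * Real.log n)) = 1 / (n : ℝ) ^ 4 := by
    rw [Real.exp_neg, one_div, show (4 : ℝ) * Real.log n = ((4 : ℕ) : ℝ) * Real.log n by norm_num,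
      Real.exp_nat_mul, Real.exp_log hn0]
  rw [hexp1, hexp2]
  set L := Real.log n with hL
  set D : ℝ := 2 ^ j₁ with hD
  have hD0 : 0 < D := by positivity
  have hLD : L ^ 2 * D / (n : ℝ) ^ 2 ≤ 4 * (L / n) := by
    have h1 : L * D ≤ 4 * n := by
      calc L * D ≤ 2 * w * (2 * w) := mul_le_mul hLw hj₁ hD0.le (by positivity)
        _ = 4 * n := by rw [← hw2]; ring
    rw [div_le_iff₀ (by positivity)]
    have : 4 * (L / n) * (n : ℝ) ^ 2 = L * (4 * n) := by field_simp
    rw [this, sq, mul_assoc]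
    exact mul_le_mul_of_nonneg_left h1 (by linarith)
  have hT : 8 * δ * L * V / n + 21 * (δ * L) ^ 2 * (100 * D) / (n : ℝ) ^ 2
      ≤ (8 * δ * V + 8400 * δ ^ 2) * (L / n) := by
    have e1 : 8 * δ * L * V / n = 8 * δ * V * (L / n) := by ring
    have e2 : 21 * (δ * L) ^ 2 * (100 * D) / (n : ℝ) ^ 2
        = 2100 * δ ^ 2 * (L ^ 2 * D / (n : ℝ) ^ 2) := by ring
    rw [e1, e2, add_mul]
    nlinarith [mul_le_mul_of_nonneg_left hLD (by positivity : 0 ≤ 2100 * δ ^ 2)]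
  have ht : 16 * L * V / n + 4 * L ^ 2 * (100 * D) / (n : ℝ) ^ 2 ≤ (16 * V + 1600) * (L / n) := by
    have e1 : 16 * L * V / n = 16 * V * (L / n) := by ring
    have e2 : 4 * L ^ 2 * (100 * D) / (n : ℝ) ^ 2 = 400 * (L ^ 2 * D / (n : ℝ) ^ 2) := by ring
    rw [e1, e2]
    linarith
  -- the total error budget of one coefficient; there are at most `4 √n` coefficients
  set Q := (16 * V + 1600) * (L / n) * (3 * (1 / w))
    + 8 * (100 * (2 * w)) * (1 / (n : ℝ) ^ 4) with hQ
  have hQ0 : 0 ≤ Q := by positivity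
  have hcard : ∑ j ∈ Finset.Icc j₀ j₁, ∑ k ∈ Finset.range (2 ^ j), Q ≤ 4 * w * Q := by
    simp only [Finset.sum_const, Finset.card_range, nsmul_eq_mul]
    rw [← Finset.sum_mul]
    refine mul_le_mul_of_nonneg_right ?_ hQ0
    calc ∑ j ∈ Finset.Icc j₀ j₁, ((2 ^ j : ℕ) : ℝ)
        ≤ ∑ j ∈ Finset.range (j₁ + 1), ((2 ^ j : ℕ) : ℝ) :=
          Finset.sum_le_sum_of_subset_of_nonneg (fun j hj => Finset.mem_range.2
            (Nat.lt_succ_of_le (Finset.mem_Icc.1 hj).2)) fun _ _ _ => by positivity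
      _ = 2 ^ (j₁ + 1) - 1 := by
          push_cast; rw [geom_sum_eq (by norm_num)]; norm_num
      _ ≤ 4 * w := by rw [pow_succ]; linarith
  have hwQ : 4 * w * Q ≤ (192 * V + 25600) * (L / n) := by
    have e1 : 4 * w * Q = (192 * V + 19200) * (L / n) + 6400 * (w ^ 2 / (n : ℝ) ^ 4) := by
      rw [hQ]; field_simp; ring
    have e2 : w ^ 2 / (n : ℝ) ^ 4 ≤ L / n := by
      rw [hw2, div_le_div_iff₀ (by positivity) hn0]
      have h1 : (1 : ℝ) ≤ n := by exact_mod_cast (by omega : 1 ≤ n)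
      calc (n : ℝ) * n = n ^ 2 := by ring
        _ ≤ n ^ 4 := pow_le_pow_right₀ h1 (by norm_num)
        _ ≤ L * n ^ 4 := le_mul_of_one_le_left (by positivity) hL1
    rw [e1]
    linarith
  calc _ ≤ ∑ j ∈ Finset.Icc j₀ j₁, ∑ k ∈ Finset.range (2 ^ j), K *
        (min (x j k ^ 2) ((8 * δ * V + 8400 * δ ^ 2) * (L / n)) + Q) := by
        refine Finset.sum_le_sum fun j _ => Finset.sum_le_sum fun k _ => ?_
        refine mul_le_mul_of_nonneg_left ?_ hK
        rw [add_assoc]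
        refine add_le_add (min_le_min le_rfl hT) (add_le_add ?_ ?_)
        · exact mul_le_mul_of_nonneg_right ht (by positivity)
        · gcongr
    _ = K * ∑ j ∈ Finset.Icc j₀ j₁, ∑ k ∈ Finset.range (2 ^ j),
          min (x j k ^ 2) ((8 * δ * V + 8400 * δ ^ 2) * (L / n))
        + K * ∑ j ∈ Finset.Icc j₀ j₁, ∑ k ∈ Finset.range (2 ^ j), Q := by
        simp_rw [← Finset.mul_sum, ← mul_add, Finset.sum_add_distrib]
    _ ≤ _ := by
        rw [mul_assoc K]
        gcongr
        exact hcard.trans hwQ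

end Rate

end MeyerDensity

end

theorem mainTheorem4 (θ : ℝ → ℝ) (hθ : MeyerDensity.IsMeyerWindow θ)
    (j₀ j₁ : ℕ → ℕ)
    (hj₀ : ∀ n : ℕ, Real.exp 1 ≤ n → MeyerDensity.IsCoarseLevel n (j₀ n))
    (hj₁ : ∀ n : ℕ, Real.exp 1 ≤ n → MeyerDensity.IsFineLevel (1 / 2) 0 n (j₁ n))
    (δ : ℝ) (hδ : 1 / 2 < δ)
    (s p q A : ℝ) (hp₁ : 1 ≤ p) (hp₂ : p ≤ 2) (hq₁ : 1 ≤ q) (hq₂ : q ≤ 2)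
    (hs : 1 / 2 + 1 / min 2 p < s) (hA : 0 < A) (J : ℕ) :
    ∃ C : ℝ, 0 < C ∧ ∀ᶠ n : ℕ in Filter.atTop,
      (⨆ f ∈ MeyerDensity.besovDensities θ J s p q A,
        MeyerDensity.risk θ δ n (j₀ n) (j₁ n) f)
      ≤ ENNReal.ofReal (C * ((n : ℝ) / Real.log n) ^ (-(2 * s / (2 * s + 1)))) := by
  have hp : 0 < p := by linarith
  have hq : 0 < q := by linarith
  rw [min_eq_right hp₂] at hs
  have hsp : 1 / p < s := by linarith
  have hs0 : 0 < s := lt_trans (by positivity) hsp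
  obtain ⟨M, hM0, hM⟩ := MeyerDensity.exists_sum_norm_fourierCoef_le hθ J hp hp₂ hq hA.le hsp
  -- with this `a` the errors beyond `a` times the threshold have probability of order `n^(-1/2)`
  set a := Real.sqrt (1 / (2 * δ)) with ha
  have ha2 : a ^ 2 * δ = 1 / 2 := by
    rw [ha, Real.sq_sqrt (by positivity)]; field_simp
  have ha0 : 0 < a := Real.sqrt_pos.2 (by positivity)
  have ha1 : a < 1 := by
    by_contra h
    have h2 : 1 ≤ a ^ 2 := one_le_pow₀ (not_lt.1 h)
    nlinarith
  set K := 4 / a ^ 2 + 4 / (1 - a) ^ 2 with hK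
  have hK0 : 0 ≤ K := by positivity
  set V := 20 * M with hV
  have hV0 : 0 < V := by positivity
  set CT := 8 * δ * V + 8400 * δ ^ 2 with hCT
  have hCT0 : 0 < CT := by positivity
  set ρ := 2 * s / (2 * s + 1) with hρ
  have hρ1 : ρ ≤ 1 := by rw [hρ, div_le_one (by positivity)]; linarith
  set b := s + 1 / 2 - 1 / p with hb
  have hb1 : 1 ≤ b := by linarith
  set D := A ^ 2 / (1 - (2 : ℝ) ^ (-(2 * b))) with hD
  have hD0 : 0 ≤ D := by
    have : (2 : ℝ) ^ (-(2 * b)) < 1 := Real.rpow_lt_one_of_one_lt_of_neg (by norm_num) (by linarith)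
    exact div_nonneg (by positivity) (by linarith)
  set G := 2 + A ^ p / (1 - (2 : ℝ) ^ (-(p * b))) with hG
  have hG0 : 0 ≤ G := by
    have : (2 : ℝ) ^ (-(p * b)) < 1 :=
      Real.rpow_lt_one_of_one_lt_of_neg (by norm_num) (by nlinarith)
    have : 0 ≤ A ^ p / (1 - (2 : ℝ) ^ (-(p * b))) := div_nonneg (by positivity) (by linarith)
    linarith
  refine ⟨2 * V + K * (G * CT ^ ρ) + K * (192 * V + 25600) + D, by positivity, ?_⟩
  have hev1 : ∀ᶠ n : ℕ in Filter.atTop, CT * (Real.log n / n) ≤ 1 := by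
    have := (MeyerDensity.tendsto_log_div_nat.const_mul CT)
    rw [mul_zero] at this
    exact (this.eventually_lt_const zero_lt_one).mono fun n h => h.le
  have hev2 : ∀ᶠ n : ℕ in Filter.atTop, (2 : ℝ) ^ J ≤ Real.log n :=
    (Real.tendsto_log_atTop.comp tendsto_natCast_atTop_atTop).eventually_ge_atTop _
  filter_upwards [hev1, hev2, Filter.eventually_ge_atTop 3] with n hn1 hn2 hn3
  have hn3' : (3 : ℝ) ≤ n := by exact_mod_cast hn3
  have hn0 : (0 : ℝ) < n := by linarith
  have hexp : Real.exp 1 ≤ n := by linarith [Real.exp_one_lt_d9]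
  have hL1 : 1 ≤ Real.log n := (Real.le_log_iff_exp_le hn0).2 hexp
  obtain ⟨h0a, h0b⟩ := hj₀ n hexp
  obtain ⟨h1a, h1b⟩ := hj₁ n hexp
  rw [Real.rpow_zero, mul_one, ← Real.sqrt_eq_rpow] at h1a h1b
  rw [zpow_sub_one₀ (by norm_num), zpow_natCast, ← div_eq_mul_inv,
    div_le_iff₀ (by norm_num)] at h0b h1b
  have hLw := MeyerDensity.log_le_two_mul_sqrt n
  have hJ : J ≤ j₀ n := by
    have : (2 : ℝ) ^ J < 2 ^ j₀ n := hn2.trans_lt h0a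
    exact ((pow_lt_pow_iff_right₀ (by norm_num)).1 this).le
  have hj : j₀ n ≤ j₁ n + 1 := by
    have : (2 : ℝ) ^ j₀ n < 2 ^ (j₁ n + 2) := by rw [pow_add]; linarith
    have := (pow_lt_pow_iff_right₀ (by norm_num)).1 this
    omega
  set ε := Real.log n / n with hε
  have hε0 : 0 < ε := by positivity
  have hε1 : ε ≤ 1 := by
    rw [hε, div_le_one hn0]
    linarith [Real.log_le_sub_one_of_pos hn0]
  have hερ : ε ≤ ε ^ ρ := by
    nth_rw 1 [← Real.rpow_one ε]
    exact Real.rpow_le_rpow_of_exponent_ge hε0 hε1 hρ1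
  have hrate : ((n : ℝ) / Real.log n) ^ (-ρ) = ε ^ ρ := by
    rw [Real.rpow_neg (by positivity), ← Real.inv_rpow (by positivity), inv_div]
  rw [hrate]
  refine iSup₂_le fun f hf => ?_
  have htail := MeyerDensity.sum_waveletEnergy_le (j := j₁ n + 1) hp hp₂ hq hA.le
    (by linarith : 0 < s + 1 / 2 - 1 / p) hf.2 (by omega)
  refine (MeyerDensity.risk_le hθ hf.1 (by omega) (by linarith) ha0 ha1 hM0 (hM f hf) hj
    htail).trans (ENNReal.ofReal_le_ofReal ?_)
  rw [← hV, ← hK, ← hb, ← hD]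
  have hmain := MeyerDensity.sum_loss_bound_le (j₀ := j₀ n) hn3
    (by linarith : (2 : ℝ) ^ j₁ n ≤ _) hK0 (by linarith : 0 < δ) hV0 ha2 rfl
    (fun j k => MeyerDensity.coeff f (MeyerDensity.psi θ j k))
  have horacle := MeyerDensity.sum_min_sq_le (j₁ := j₁ n) hp hp₂ hq hA.le hsp hf.2
    (by positivity : 0 < CT * ε) hn1 hJ
  rw [← hb, ← hG, ← hρ, Real.mul_rpow hCT0.le hε0.le] at horacle
  rw [← hε, ← hCT] at hmain
  have hcoarse : 2 ^ j₀ n * (V / n) ≤ 2 * V * ε := by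
    calc 2 ^ j₀ n * (V / n) ≤ (Real.log n * 2) * (V / n) := by gcongr
      _ = _ := by rw [hε]; ring
  have hbias : D * ((2 : ℝ) ^ (-(2 * b))) ^ (j₁ n + 1) ≤ D * ε := by
    refine mul_le_mul_of_nonneg_left ?_ hD0
    have h4 : (2 : ℝ) ^ (-(2 * b)) ≤ 1 / 4 := by
      calc (2 : ℝ) ^ (-(2 * b)) ≤ (2 : ℝ) ^ (-(2 : ℝ)) :=
            Real.rpow_le_rpow_of_exponent_le (by norm_num) (by linarith)
        _ = 1 / 4 := by rw [Real.rpow_neg (by norm_num)]; norm_num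
    have hn4 : (n : ℝ) ≤ 4 ^ j₁ n := by
      have h5 := pow_le_pow_left₀ (Real.sqrt_nonneg n) h1a.le 2
      rw [Real.sq_sqrt hn0.le, ← pow_mul, mul_comm, pow_mul] at h5
      norm_num at h5
      exact h5
    calc ((2 : ℝ) ^ (-(2 * b))) ^ (j₁ n + 1) ≤ (1 / 4 : ℝ) ^ (j₁ n + 1) :=
          pow_le_pow_left₀ (by positivity) h4 _
      _ ≤ (1 / 4 : ℝ) ^ j₁ n := pow_le_pow_of_le_one (by norm_num) (by norm_num) (Nat.le_succ _)
      _ = 1 / 4 ^ j₁ n := by rw [div_pow, one_pow]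
      _ ≤ 1 / n := one_div_le_one_div_of_le hn0 hn4
      _ ≤ ε := by rw [hε]; gcongr
  have hKG := mul_le_mul_of_nonneg_left horacle hK0
  have hsum : 2 * V * ε + K * (192 * V + 25600) * ε + D * ε
      ≤ (2 * V + K * (192 * V + 25600) + D) * ε ^ ρ := by
    rw [← add_mul, ← add_mul]
    exact mul_le_mul_of_nonneg_left hερ (by positivity)
  have hsplit : (2 * V + K * (G * CT ^ ρ) + K * (192 * V + 25600) + D) * ε ^ ρ
      = (2 * V + K * (192 * V + 25600) + D) * ε ^ ρ + K * (G * (CT ^ ρ * ε ^ ρ)) := by ring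
  rw [hsplit]
  linarith
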